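/- Let $M$ be a compact complex manifold of complex dimension $n$. For a smooth Hermitian metric $g$ on $M$, written $g_{i\bar j}=g(\partial_i,\partial_{\bar j})$ in local holomorphic coordinates $z^1,\dots,z^n$, with $g^{k\bar l}$ determined by $\sum_l g^{k\bar l}g_{j\bar l}=\delta^k_j$, let $$\Gamma_{ij}^k=g^{k\bar l}\partial_i g_{j\bar l},\qquad R_{i\bar jk}{}^{l}=-\partial_{\bar j}\Gamma_{ik}^l,\qquad R_{i\bar jk\bar l}=g_{p\bar l}R_{i\bar jk}{}^{p}$$ be the Chern connection and the Chern curvature tensor of $g$, let $$Ric_{i\bar j}=g^{k\bar l}R_{i\bar jk\bar l},\qquad S_{i\bar j}=g^{k\bar l}R_{k\bar li\bar j}$$ be its first and second (Chern) Ricci curvatures, and let $B_{i\bar jk\bar l}=g_{i\bar j}g_{k\bar l}+g_{i\bar l}g_{k\bar j}$. The metric $g$ has Griffiths non-positive Chern curvature if there is a function $\kappa:M\to(-\infty,0]$ such that $R(X,\bar X,Y,\bar Y)\le\kappa(p)\,B(X,\bar X,Y,\bar Y)$ for all $p\in M$ and all $X,Y\in T^{1,0}_pM$. Theorem 1.1.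 Let $g_0$ be a smooth Hermitian metric on $M$ with Griffiths non-positive Chern curvature. Let $T>0$ and let $g(t)$, $t\in[0,T]$, be a family of Hermitian metrics on $M$, smooth on $M\times[0,T]$, that solves $$\partial_t g(t)=-S(g(t))\ \text{ on } M\times[0,T],\qquad g(0)=g_0 .$$ Then there is $\tau\in(0,T]$ such that for every $t\in[0,\tau]$ the first Ricci curvature of $g(t)$ is non-positive, that is, $Ric(g(t))(X,\bar X)\le 0$ for all $p\in M$ and all $X\in T^{1,0}_pM$. -/

import Mathlib

open scoped Manifold ContDiff ComplexConjugate

noncomputable section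

namespace HermitianGeometry

/-- The model space `ℂⁿ`. -/
abbrev Cn (n : ℕ) : Type := EuclideanSpace ℂ (Fin n)

section LocalFormulas

/-! ### Chern geometry in holomorphic coordinates

A Hermitian metric is given on an open subset of `ℂⁿ` by its matrix of components
`G z i j = g_{i j̄}(z) = g(∂_i, ∂_j̄)`. -/

variable {n : ℕ}

/-- The Wirtinger derivative `∂_i f = ∂f/∂zⁱ = (∂f/∂xⁱ - √-1 ∂f/∂yⁱ) / 2` at `z`. -/
def dz (i : Fin n) (f : Cn n → ℂ) (z : Cn n) : ℂ :=
  (fderiv ℝ f z (EuclideanSpace.single i 1)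
    - Complex.I * fderiv ℝ f z (EuclideanSpace.single i Complex.I)) / 2

/-- The Wirtinger derivative `∂_ī f = ∂f/∂z̄ⁱ = (∂f/∂xⁱ + √-1 ∂f/∂yⁱ) / 2` at `z`. -/
def dzbar (i : Fin n) (f : Cn n → ℂ) (z : Cn n) : ℂ :=
  (fderiv ℝ f z (EuclideanSpace.single i 1)
    + Complex.I * fderiv ℝ f z (EuclideanSpace.single i Complex.I)) / 2

/-- The inverse metric `g^{k l̄}`, normalized by `∑_l g^{k l̄} g_{j l̄} = δ_j^k`. -/
def gInv (G : Cn n → Matrix (Fin n) (Fin n) ℂ) (z : Cn n) (k l : Fin n) : ℂ :=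
  (G z)⁻¹ l k

/-- Coefficients of the Chern connection, `Γ_{ij}^k = g^{k l̄} ∂_i g_{j l̄}`. -/
def chernGamma (G : Cn n → Matrix (Fin n) (Fin n) ℂ) (i j k : Fin n) (z : Cn n) : ℂ :=
  ∑ l, gInv G z k l * dz i (fun w => G w j l) z

/-- The Chern curvature as an endomorphism-valued form, `R_{i j̄ k}^l = -∂_j̄ Γ_{ik}^l`. -/
def chernCurvUp (G : Cn n → Matrix (Fin n) (Fin n) ℂ) (i j k l : Fin n) (z : Cn n) : ℂ :=
  - dzbar j (chernGamma G i k l) z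

/-- The Chern curvature tensor `R_{i j̄ k l̄} = g_{p l̄} R_{i j̄ k}^p`. -/
def chernCurv (G : Cn n → Matrix (Fin n) (Fin n) ℂ) (i j k l : Fin n) (z : Cn n) : ℂ :=
  ∑ p, G z p l * chernCurvUp G i j k p z

/-- The first (Chern-)Ricci curvature `R_{i j̄} = g^{k l̄} R_{i j̄ k l̄}`. -/
def firstRicci (G : Cn n → Matrix (Fin n) (Fin n) ℂ) (i j : Fin n) (z : Cn n) : ℂ :=
  ∑ k, ∑ l, gInv G z k l * chernCurv G i j k l z

/-- The second (Chern-)Ricci curvature `S_{i j̄} = g^{k l̄} R_{k l̄ i j̄}`. -/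
def secondRicci (G : Cn n → Matrix (Fin n) (Fin n) ℂ) (i j : Fin n) (z : Cn n) : ℂ :=
  ∑ k, ∑ l, gInv G z k l * chernCurv G k l i j z

/-- The tensor `B_{i j̄ k l̄} = g_{i j̄} g_{k l̄} + g_{i l̄} g_{k j̄}`. -/
def tensorB (G : Cn n → Matrix (Fin n) (Fin n) ℂ) (i j k l : Fin n) (z : Cn n) : ℂ :=
  G z i j * G z k l + G z i l * G z k j

/-- `A(X, X̄) = A_{i j̄} Xⁱ X̄ʲ`. -/
def eval₂ (A : Fin n → Fin n → ℂ) (X : Fin n → ℂ) : ℂ :=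
  ∑ i, ∑ j, A i j * X i * conj (X j)

/-- `A(X, X̄, Y, Ȳ) = A_{i j̄ k l̄} Xⁱ X̄ʲ Yᵏ Ȳˡ`. -/
def eval₄ (A : Fin n → Fin n → Fin n → Fin n → ℂ) (X Y : Fin n → ℂ) : ℂ :=
  ∑ i, ∑ j, ∑ k, ∑ l, A i j k l * X i * conj (X j) * Y k * conj (Y l)

end LocalFormulas

section Global

variable {n : ℕ} {M : Type*} [TopologicalSpace M] [ChartedSpace (Cn n) M]

variable (n M) in
/-- The holomorphic coordinate charts of the complex `n`-manifold `M`. -/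
def holoCharts : Set (OpenPartialHomeomorph M (Cn n)) :=
  IsManifold.maximalAtlas 𝓘(ℂ, Cn n) ω M

/-- The coordinate vector `∂_i` at the point with coordinates `z` in the chart `e`. The complex
vector space `TangentSpace 𝓘(ℂ, Cn n) p` is the holomorphic tangent space `T^{1,0}_p M`. -/
def coordVec (e : OpenPartialHomeomorph M (Cn n)) (z : Cn n) (i : Fin n) :
    TangentSpace 𝓘(ℂ, Cn n) (e.symm z) :=
  mfderiv 𝓘(ℂ, Cn n) 𝓘(ℂ, Cn n) e.symm z (EuclideanSpace.single i (1 : ℂ) : Cn n)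

variable (n M) in
/-- A smooth Hermitian metric on the complex manifold `M`: a positive definite Hermitian form
`form p X Y = g(X, Ȳ)` on each `T^{1,0}_p M`, linear in `X` and conjugate-linear in `Y`, whose
components in holomorphic charts are (real-)smooth functions. -/
structure HermitianMetric where
  form : ∀ p : M, TangentSpace 𝓘(ℂ, Cn n) p →ₗ[ℂ] TangentSpace 𝓘(ℂ, Cn n) p →ₗ⋆[ℂ] ℂ
  conj_symm : ∀ p X Y, conj (form p X Y) = form p Y X
  pos : ∀ p X, X ≠ 0 → 0 < (form p X X).re
  smooth : ∀ e ∈ holoCharts n M, ∀ i j : Fin n,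
    ContDiffOn ℝ ∞ (fun z => form (e.symm z) (coordVec e z i) (coordVec e z j)) e.target

namespace HermitianMetric

/-- The components `g_{i j̄}(z)` of `g` in the chart `e`. -/
def comp (g : HermitianMetric n M) (e : OpenPartialHomeomorph M (Cn n)) (z : Cn n) :
    Matrix (Fin n) (Fin n) ℂ :=
  Matrix.of fun i j => g.form (e.symm z) (coordVec e z i) (coordVec e z j)

/-- `BK ≤ κ`: `R(X, X̄, Y, Ȳ) ≤ κ(p) B(X, X̄, Y, Ȳ)` for all `p` and all `X, Y ∈ T^{1,0}_p M`
(both sides are real numbers). -/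
def BisectionalLE (g : HermitianMetric n M) (κ : M → ℝ) : Prop :=
  ∀ e ∈ holoCharts n M, ∀ z ∈ e.target, ∀ X Y : Fin n → ℂ,
    (eval₄ (fun i j k l => chernCurv (g.comp e) i j k l z) X Y).re ≤
      κ (e.symm z) * (eval₄ (fun i j k l => tensorB (g.comp e) i j k l z) X Y).re

/-- `g` has Griffiths non-positive Chern curvature. -/
def GriffithsNonpos (g : HermitianMetric n M) : Prop :=
  ∃ κ : M → ℝ, (∀ p, κ p ≤ 0) ∧ g.BisectionalLE κ

/-- The first Ricci curvature of `g` is non-positive: `Ric(X, X̄) ≤ 0` for all `X ∈ T^{1,0} M`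
(the left-hand side is a real number). -/
def FirstRicciNonpos (g : HermitianMetric n M) : Prop :=
  ∀ e ∈ holoCharts n M, ∀ z ∈ e.target, ∀ X : Fin n → ℂ,
    (eval₂ (fun i j => firstRicci (g.comp e) i j z) X).re ≤ 0

end HermitianMetric

/-- `g(t)`, `t ∈ [0, T]`, is a solution of `∂_t g = -S(g)`: the components of `g(t)` are smooth
on `[0, T] × M`, and in every holomorphic chart `∂_t g_{i j̄} = -S_{i j̄}(g(t))` on `[0, T]`
(with one-sided derivatives at the end points). The values `g t` for `t ∉ [0, T]` play no role. -/
structure IsHermitianCurvatureFlow (g : ℝ → HermitianMetric n M) (T : ℝ) : Prop where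
  smooth : ∀ e ∈ holoCharts n M, ∀ i j : Fin n,
    ContDiffOn ℝ ∞ (fun q : ℝ × Cn n => (g q.1).comp e q.2 i j) (Set.Icc 0 T ×ˢ e.target)
  flow : ∀ e ∈ holoCharts n M, ∀ z ∈ e.target, ∀ i j : Fin n, ∀ t ∈ Set.Icc 0 T,
    HasDerivWithinAt (fun s => (g s).comp e z i j)
      (- secondRicci ((g t).comp e) i j z) (Set.Icc 0 T) t

end Global

end HermitianGeometry

end

/-!
# Short-time preservation of non-positive first Ricci curvature

The proof is a maximum principle for a perturbed quantity. Along the flow `∂_t g = -S(g)` the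
curvature satisfies a heat equation, but the non-positivity of `R(X, X̄, Y, Ȳ)` need not be preserved,
and the evolution of `Ric(X, X̄)` contains all the components `R(X, ·)` of the curvature, which the
Ricci curvature alone does not control. The barrier (`barrierVal`)
`Ric(X, X̄)|Y|² + δ (s R(X, X̄, Y, Ȳ) + 2 Re R(X, Z̄, Y, Ȳ)) - B |Z|²|Y|²`, where `-1 ≤ s ≤ 1` and
`δ = e^{-Lt} / 2`, contains additional vectors `Z` and `Y`. It has three properties.

* At the initial time it is non-positive (`barrierVal_nonpos`): there `Ric(X, X̄)|Y|² ≤ R(X, X̄, Y, Ȳ)`,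
  since the Ricci curvature is a trace of non-positive terms, and the mixed term is bounded by the
  non-positivity of `R(X + Z, X̄ + Z̄, Y, Ȳ)`.
* If it is bounded by `w (|X|² + |Z|²)|Y|²` for all `s`, `Z`, `Y`, then `R(X, X̄)` is bounded by the
  defect `a = w|X|² - Ric(X, X̄)`, and `R(X, ·)` by `√a`, up to constants (`curvature_bound_of_max`).
* The reaction terms in the heat equation of the barrier are linear in `R(X, X̄)` or at least quadratic
  in `R(X, ·)` and `Z`, hence bounded by multiples of `a` and `|Z|²`. If equality holds above, the decay
  of `δ` contributes a negative multiple of exactly these two quantities, with the factor `L`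
  (`reaction_sum_neg`, `exists_barrier_constants`).

Hence the quotient of the barrier by `e^{Kt} (|X|² + |Z|²)|Y|²` has no positive maximum as long as
`δ ≥ 1/4`, which is the case for a short time (`exists_barrierVal_nonpos`). With `s = 0`, `Z = 0`,
`Y = X` this says that `Ric(X, X̄) ≤ 0`.

The heat equation is computed at one point of space-time, in a chart, and the tangent bundle is treated
in two ways. The arguments `Y` and the traces refer to a holomorphic frame of the bundle in which the
first derivatives of the metric vanish at the point. Such a frame exists for every Hermitian metric,
because it need not consist of coordinate fields. The arguments `X` and `Z`, which correspond to the form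
part of the curvature, are extended by holomorphic vector fields that are parallel at the point
for the connection with the coefficients `Γ_{ip}^r`, the lower indices of the Chern connection being
interchanged (`IsAdapted`); this choice removes all the terms with derivatives of the curvature
(`ev_heat_contract_curv`). The norms `|X|²`, `|Z|²` then contribute torsion terms; those from
`B |Z|²|Y|²` are absorbed by the decay of `δ`, and those from the quotient by the factor `e^{Kt}`.

The computations are carried out in the ring of smooth functions on `[0, T] × U` (`smoothFun`), with
the commuting derivations `∂_i`, `∂_j̄`, `∂_t`, and only the commutation relations are used. The passage
between charts is an instance of the transformation law `curv_transform`, and compactness of the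
manifold provides the uniform bounds and the maximum.
-/

noncomputable section

namespace HermitianGeometry

open scoped Matrix ComplexOrder

/-! ### Rings of smooth functions and their complexified derivations -/

section SmoothFunctions

variable {E : Type*} [NormedAddCommGroup E] [NormedSpace ℝ E]
variable {E' : Type*} [NormedAddCommGroup E'] [NormedSpace ℝ E']

/-- The sets on which iterated derivatives within the set are well defined (`uniqueDiffOn`) and
commute, every point being a limit of interior points. -/
structure IsRegular (V : Set E) : Prop where
  uniqueDiffOn : UniqueDiffOn ℝ V
  subset_closure_interior : V ⊆ closure (interior V)

theorem IsRegular.of_isOpen {V : Set E} (hV : IsOpen V) : IsRegular V :=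
  ⟨hV.uniqueDiffOn, by rw [hV.interior_eq]; exact subset_closure⟩

theorem IsRegular.Icc_prod {T : ℝ} (hT : 0 < T) {U : Set E} (hU : IsOpen U) :
    IsRegular (Set.Icc 0 T ×ˢ U) := by
  refine ⟨(uniqueDiffOn_Icc hT).prod hU.uniqueDiffOn, ?_⟩
  rw [interior_prod_eq, closure_prod_eq, interior_Icc, closure_Ioo hT.ne, hU.interior_eq]
  exact Set.prod_mono le_rfl subset_closure

/-- Extension by zero of a function on `V` to the whole space. -/
def extZero {E : Type*} {V : Set E} (f : V → ℂ) : E → ℂ := Function.extend Subtype.val f 0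

@[simp] theorem extZero_coe {E : Type*} {V : Set E} (f : V → ℂ) (x : V) : extZero f x = f x :=
  Subtype.val_injective.extend_apply _ _ _

theorem extZero_apply {E : Type*} {V : Set E} (f : V → ℂ) {x : E} (hx : x ∈ V) :
    extZero f x = f ⟨x, hx⟩ :=
  extZero_coe f ⟨x, hx⟩

/-- The algebra of complex-valued functions on `V` that are (real-)smooth on `V`, up to and
including the part of the boundary that belongs to `V`. -/
def smoothFun (V : Set E) : Subalgebra ℂ (V → ℂ) where
  carrier := {f | ContDiffOn ℝ ∞ (extZero f) V}
  mul_mem' {f g} hf hg := (ContDiffOn.mul hf hg).congr fun x hx => by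
    simp [extZero_apply _ hx]
  add_mem' {f g} hf hg := (ContDiffOn.add hf hg).congr fun x hx => by
    simp [extZero_apply _ hx]
  algebraMap_mem' c := (contDiffOn_const (c := c)).congr fun x hx => by
    simp [extZero_apply _ hx]

namespace smoothFun

variable {V : Set E} {V' : Set E'}

/-- The restriction to `V` of a function on the ambient space that is smooth on `V`. -/
def mk (F : E → ℂ) (hF : ContDiffOn ℝ ∞ F V) : smoothFun V :=
  ⟨fun x => F x, hF.congr fun x hx => by simp [extZero_apply _ hx]⟩

@[simp] theorem mk_apply (F : E → ℂ) (hF : ContDiffOn ℝ ∞ F V) (x : V) :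
    (mk F hF).1 x = F x := rfl

/-- Evaluation at a point of `V`. -/
def ev (x : V) : smoothFun V →ₐ[ℂ] ℂ := (Pi.evalAlgHom ℂ (fun _ : V => ℂ) x).comp (smoothFun V).val

@[simp] theorem ev_apply (x : V) (f : smoothFun V) : ev x f = f.1 x := rfl

@[ext] theorem ext {f g : smoothFun V} (h : ∀ x, ev x f = ev x g) : f = g :=
  Subtype.ext (funext h)

/-- The differential of a smooth function on `V`, the derivative being taken within `V`; it is
one-sided at the boundary points. -/
def diff (f : smoothFun V) (x : V) : E →L[ℝ] ℂ := fderivWithin ℝ (extZero f.1) V x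

theorem contDiffOn (f : smoothFun V) : ContDiffOn ℝ ∞ (extZero f.1) V := f.2

theorem hasFDerivWithinAt (f : smoothFun V) (x : V) :
    HasFDerivWithinAt (extZero f.1) (diff f x) V x :=
  (((contDiffOn f) x x.2).differentiableWithinAt (by simp)).hasFDerivWithinAt

theorem diff_eq (hV : IsRegular V) {f : smoothFun V} {F : E → ℂ} {F' : E →L[ℝ] ℂ} {x : V}
    (hF : HasFDerivWithinAt F F' V x) (h : ∀ y : V, F y = f.1 y) : diff f x = F' :=
  (hF.congr (f₁ := extZero f.1) (fun y hy => by rw [extZero_apply _ hy, ← h ⟨y, hy⟩])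
    (by rw [extZero_coe, h])).fderivWithin (hV.uniqueDiffOn x x.2)

/-- The derivation `f ↦ df(u) + √-1 df(v)` given by the complexified vector `u + √-1 v`. -/
def der (hV : IsRegular V) (u v : E) : Derivation ℂ (smoothFun V) (smoothFun V) :=
  Derivation.mk'
    { toFun := fun f => ⟨fun x => diff f x u + Complex.I * diff f x v, by
        have h : ContDiffOn ℝ ∞ (fun x => fderivWithin ℝ (extZero f.1) V x) V :=
          (contDiffOn f).fderivWithin hV.uniqueDiffOn (by simp)
        refine ContDiffOn.congr (f := fun x => fderivWithin ℝ (extZero f.1) V x u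
          + Complex.I * fderivWithin ℝ (extZero f.1) V x v) ?_ fun x hx => ?_
        · exact (h.clm_apply contDiffOn_const).add
            (contDiffOn_const.mul (h.clm_apply contDiffOn_const))
        · rw [extZero_apply _ hx]; rfl⟩
      map_add' := fun f g => by
        ext x
        have h : diff (f + g) x = diff f x + diff g x :=
          diff_eq hV ((hasFDerivWithinAt f x).add (hasFDerivWithinAt g x)) fun y => by simp
        simp [h]; ring
      map_smul' := fun c f => by
        ext x
        have h : diff (c • f) x = c • diff f x :=
          diff_eq hV ((hasFDerivWithinAt f x).const_smul c) fun y => by simp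
        simp [h]; ring }
    fun f g => by
      ext x
      have h : diff (f * g) x = f.1 x • diff g x + g.1 x • diff f x := by
        have := (hasFDerivWithinAt f x).mul (hasFDerivWithinAt g x)
        rw [extZero_coe, extZero_coe] at this
        exact diff_eq hV this fun y => by simp
      simp [h]; ring

theorem ev_der (hV : IsRegular V) (u v : E) (f : smoothFun V) (x : V) :
    ev x (der hV u v f) = diff f x u + Complex.I * diff f x v := rfl

/-- The symmetry of second derivatives, up to the boundary. -/
theorem der_comm (hV : IsRegular V) (u v u' v' : E) (f : smoothFun V) :
    der hV u v (der hV u' v' f) = der hV u' v' (der hV u v f) := by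
  -- the differential of a derivative is the second derivative, with one argument fixed
  have key : ∀ (a b : E) (x : V), diff (der hV a b f) x =
      ((fderivWithin ℝ (fderivWithin ℝ (extZero f.1) V) V x).flip a)
        + Complex.I • ((fderivWithin ℝ (fderivWithin ℝ (extZero f.1) V) V x).flip b) := by
    intro a b x
    have h : HasFDerivWithinAt (fderivWithin ℝ (extZero f.1) V)
        (fderivWithin ℝ (fderivWithin ℝ (extZero f.1) V) V x) V x :=
      ((((contDiffOn f).fderivWithin (m := ∞) hV.uniqueDiffOn (by simp)) x
        x.2).differentiableWithinAt (by simp)).hasFDerivWithinAt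
    refine diff_eq hV (F := fun y => fderivWithin ℝ (extZero f.1) V y a
      + Complex.I • fderivWithin ℝ (extZero f.1) V y b) ?_ fun y => rfl
    have ha := h.clm_apply (hasFDerivWithinAt_const a (x : E) V)
    have hb := h.clm_apply (hasFDerivWithinAt_const b (x : E) V)
    simp only [ContinuousLinearMap.comp_zero, zero_add] at ha hb
    exact ha.add (hb.const_smul Complex.I)
  ext x
  have hs : IsSymmSndFDerivWithinAt ℝ (extZero f.1) V x :=
    ((contDiffOn f) x x.2).isSymmSndFDerivWithinAt
      (by rw [minSmoothness_of_isRCLikeNormedField]; exact WithTop.coe_le_coe.2 le_top) hV.uniqueDiffOn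
      (hV.subset_closure_interior x.2) x.2
  rw [ev_der, ev_der, key, key]
  simp only [add_apply, ContinuousLinearMap.flip_apply,
    smul_apply, smul_eq_mul]
  rw [hs.eq u u', hs.eq u v', hs.eq v u', hs.eq v v']
  ring

/-- The ring homomorphism given by composition with a smooth map. -/
def pullback (φ : E → E') (hφ : ContDiffOn ℝ ∞ φ V) (hm : Set.MapsTo φ V V') :
    smoothFun V' →ₐ[ℂ] smoothFun V where
  toFun f := ⟨fun x => f.1 ⟨φ x, hm x.2⟩, ((contDiffOn f).comp hφ hm).congr fun x hx => by
    rw [extZero_apply _ hx, Function.comp, extZero_apply _ (hm hx)]⟩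
  map_one' := rfl
  map_mul' _ _ := rfl
  map_zero' := rfl
  map_add' _ _ := rfl
  commutes' _ := rfl

@[simp] theorem ev_pullback (φ : E → E') (hφ : ContDiffOn ℝ ∞ φ V) (hm : Set.MapsTo φ V V')
    (f : smoothFun V') (x : V) : ev x (pullback φ hφ hm f) = ev ⟨φ x, hm x.2⟩ f := rfl

theorem diff_pullback (hV : IsRegular V) {φ : E → E'} (hφ : ContDiffOn ℝ ∞ φ V)
    (hm : Set.MapsTo φ V V') (f : smoothFun V') (x : V) {φ' : E →L[ℝ] E'}
    (h' : HasFDerivWithinAt φ φ' V x) :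
    diff (pullback φ hφ hm f) x = (diff f ⟨φ x, hm x.2⟩).comp φ' :=
  diff_eq hV ((hasFDerivWithinAt f ⟨φ x, hm x.2⟩).comp x.1 h' hm) fun y => by
    rw [Function.comp, extZero_apply _ (hm y.2)]; rfl

/-- Complex conjugation of functions. -/
def conjHom (V : Set E) : smoothFun V →+* smoothFun V where
  toFun f := ⟨fun x => conj (f.1 x),
    (Complex.conjCLE.contDiff.comp_contDiffOn (contDiffOn f)).congr fun x hx => by
      simp [extZero_apply _ hx]⟩
  map_one' := by ext x; simp
  map_mul' _ _ := by ext x; simp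
  map_zero' := by ext x; simp
  map_add' _ _ := by ext x; simp

@[simp] theorem ev_conjHom (f : smoothFun V) (x : V) :
    ev x (conjHom V f) = conj (ev x f) := rfl

theorem conjHom_der (hV : IsRegular V) (u v : E) (f : smoothFun V) :
    conjHom V (der hV u v f) = der hV u (-v) (conjHom V f) := by
  ext x
  have h : diff (conjHom V f) x = (Complex.conjCLE : ℂ →L[ℝ] ℂ).comp (diff f x) :=
    diff_eq hV ((Complex.conjCLE : ℂ →L[ℝ] ℂ).hasFDerivAt.comp_hasFDerivWithinAt x.1
      (hasFDerivWithinAt f x)) fun y => by simp; rfl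
  rw [ev_conjHom, ev_der, ev_der, h]
  simp

theorem isUnit_of_forall_ne_zero {f : smoothFun V} (h : ∀ x, ev x f ≠ 0) : IsUnit f := by
  refine IsUnit.of_mul_eq_one ⟨fun x => (f.1 x)⁻¹, ?_⟩ ?_
  · refine ((contDiffOn f).inv fun x hx => ?_).congr fun x hx => ?_
    · rw [extZero_apply _ hx]; exact h ⟨x, hx⟩
    · simp [extZero_apply _ hx]
  · ext x; simpa using mul_inv_cancel₀ (h x)

end smoothFun

end SmoothFunctions

/-! ### Curvature of a Hermitian form over a ring with commuting derivations -/

section MatrixDerivation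

variable {n : ℕ} {A A' : Type*} [CommRing A] [Algebra ℂ A] [CommRing A'] [Algebra ℂ A']

/-- A derivation applied to all the entries of a matrix. -/
def mder (D : Derivation ℂ A A) :
    Matrix (Fin n) (Fin n) A →+ Matrix (Fin n) (Fin n) A where
  toFun M := M.map D
  map_zero' := by ext; simp
  map_add' M N := by ext; simp

@[simp] theorem mder_apply (D : Derivation ℂ A A) (M : Matrix (Fin n) (Fin n) A) (k l : Fin n) :
    mder D M k l = D (M k l) := rfl

theorem mder_mul (D : Derivation ℂ A A) (M N : Matrix (Fin n) (Fin n) A) :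
    mder D (M * N) = mder D M * N + M * mder D N := by
  ext k l
  simp only [mder_apply, Matrix.mul_apply, Matrix.add_apply, map_sum, Derivation.leibniz,
    smul_eq_mul, ← Finset.sum_add_distrib]
  exact Finset.sum_congr rfl fun _ _ => by ring

theorem mder_smul (D : Derivation ℂ A A) (a : A) (M : Matrix (Fin n) (Fin n) A) :
    mder D (a • M) = D a • M + a • mder D M := by
  ext k l
  simp only [mder_apply, Matrix.smul_apply, Matrix.add_apply, Derivation.leibniz, smul_eq_mul]
  ring

@[simp] theorem mder_one (D : Derivation ℂ A A) :
    mder D (1 : Matrix (Fin n) (Fin n) A) = 0 := by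
  ext k l
  by_cases h : k = l <;> simp [h]

theorem mder_inv (D : Derivation ℂ A A) {G Gi : Matrix (Fin n) (Fin n) A} (h : G * Gi = 1) :
    mder D Gi = -(Gi * mder D G * Gi) := by
  have h' : Gi * G = 1 := mul_eq_one_comm.1 h
  have h1 : mder D G * Gi + G * mder D Gi = 0 := by rw [← mder_mul, h, mder_one]
  have h2 : Gi * (mder D G * Gi + G * mder D Gi) = 0 := by rw [h1, mul_zero]
  rw [mul_add, ← mul_assoc, ← mul_assoc, h', one_mul] at h2
  exact eq_neg_of_add_eq_zero_right h2

theorem mder_comm {D D' : Derivation ℂ A A} (h : ∀ f, D (D' f) = D' (D f))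
    (M : Matrix (Fin n) (Fin n) A) : mder D (mder D' M) = mder D' (mder D M) := by
  ext k l; simp [h]

/-- The matrix `(R_{i j̄ k l̄})_{k l}` of the Chern curvature of the form `G` with inverse `Gi`:
`R_{i j̄} = -∂_i ∂_j̄ G + ∂_i G · G⁻¹ · ∂_j̄ G`. The inverse `Gi` is an independent argument, so that
the definition makes sense over every ring; the lemmas assume `G * Gi = 1`. -/
def curv (d db : Fin n → Derivation ℂ A A) (G Gi : Matrix (Fin n) (Fin n) A) (i j : Fin n) :
    Matrix (Fin n) (Fin n) A :=
  -mder (d i) (mder (db j) G) + mder (d i) G * Gi * mder (db j) G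

/-- The curvature as an endomorphism, lowered with the metric. -/
theorem neg_mder_mul_eq_curv {d db : Fin n → Derivation ℂ A A}
    (comm : ∀ i j f, d i (db j f) = db j (d i f))
    {G Gi : Matrix (Fin n) (Fin n) A} (h : G * Gi = 1) (i j : Fin n) :
    -mder (db j) (mder (d i) G * Gi) * G = curv d db G Gi i j := by
  have h' : Gi * G = 1 := mul_eq_one_comm.1 h
  rw [curv, mder_mul, mder_inv _ h, mder_comm (comm i j)]
  simp only [mul_neg, neg_add_rev, neg_neg, add_mul, neg_mul, mul_assoc, h', mul_one]
  rw [add_comm]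

/-- Transformation of the curvature under a change of coordinates `θ` (with holomorphic Jacobian
matrix `J`, and its conjugate `Jc`) combined with a change of frame by a holomorphic matrix `P`
(and the antiholomorphic matrix `Q`, its conjugate transpose). -/
theorem curv_transform {d db : Fin n → Derivation ℂ A A} {d' db' : Fin n → Derivation ℂ A' A'}
    (θ : A' →ₐ[ℂ] A) {J Jc : Matrix (Fin n) (Fin n) A}
    (hd : ∀ i f, d i (θ f) = ∑ a, J i a * θ (d' a f))
    (hdb : ∀ j f, db j (θ f) = ∑ b, Jc j b * θ (db' b f))
    (comm : ∀ i j f, d i (db j f) = db j (d i f)) (hJc : ∀ i j b, d i (Jc j b) = 0)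
    {P Q Pi Qi : Matrix (Fin n) (Fin n) A} (hP : ∀ j, mder (db j) P = 0)
    (hQ : ∀ i, mder (d i) Q = 0) (hPP : P * Pi = 1) (hQQ : Q * Qi = 1)
    {G Gi : Matrix (Fin n) (Fin n) A'} (hG : G * Gi = 1) (i j : Fin n) :
    curv d db (P * θ.mapMatrix G * Q) (Qi * θ.mapMatrix Gi * Pi) i j =
      ∑ a, ∑ b, (J i a * Jc j b) • (P * θ.mapMatrix (curv d' db' G Gi a b) * Q) := by
  have hPP' : Pi * P = 1 := mul_eq_one_comm.1 hPP
  have hGi : Gi * G = 1 := mul_eq_one_comm.1 hG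
  have tG : θ.mapMatrix G * θ.mapMatrix Gi = 1 := by rw [← map_mul, hG, map_one]
  have tG' : θ.mapMatrix Gi * θ.mapMatrix G = 1 := by rw [← map_mul, hGi, map_one]
  have md : ∀ i (M : Matrix (Fin n) (Fin n) A'),
      mder (d i) (θ.mapMatrix M) = ∑ a, J i a • θ.mapMatrix (mder (d' a) M) := by
    intro i M; ext k l; simp [hd, Matrix.sum_apply]
  have mdb : ∀ i (M : Matrix (Fin n) (Fin n) A'),
      mder (db i) (θ.mapMatrix M) = ∑ a, Jc i a • θ.mapMatrix (mder (db' a) M) := by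
    intro i M; ext k l; simp [hdb, Matrix.sum_apply]
  have mddb : mder (d i) (mder (db j) (θ.mapMatrix G)) =
      ∑ a, ∑ b, (J i a * Jc j b) • θ.mapMatrix (mder (d' a) (mder (db' b) G)) := by
    rw [mdb, map_sum, Finset.sum_comm]
    refine Finset.sum_congr rfl fun b _ => ?_
    rw [mder_smul, hJc, zero_smul, zero_add, md, Finset.smul_sum]
    exact Finset.sum_congr rfl fun a _ => by rw [smul_smul, mul_comm]
  have hR : ∑ a, ∑ b, (J i a * Jc j b) • (P * θ.mapMatrix (curv d' db' G Gi a b) * Q) =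
      P * (-mder (d i) (mder (db j) (θ.mapMatrix G)) +
        mder (d i) (θ.mapMatrix G) * θ.mapMatrix Gi * mder (db j) (θ.mapMatrix G)) * Q := by
    rw [mddb, md, mdb]
    simp only [Finset.sum_mul, Finset.mul_sum, mul_add, add_mul, curv, map_add, map_neg, map_mul,
      smul_add, Finset.sum_add_distrib, mul_neg, neg_mul, smul_neg, Finset.sum_neg_distrib,
      Matrix.smul_mul, Matrix.mul_smul, smul_smul]
    congr 1
    rw [Finset.sum_comm]
    exact Finset.sum_congr rfl fun a _ => Finset.sum_congr rfl fun b _ => by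
      rw [mul_comm]
  rw [hR, curv]
  set G' := θ.mapMatrix G
  set Gi' := θ.mapMatrix Gi
  simp only [mder_mul, map_add, hP, hQ, mul_zero, zero_mul, add_zero, zero_add]
  have e1 : (mder (d i) P * G' + P * mder (d i) G') * Q * (Qi * Gi' * Pi) *
      (P * mder (db j) G' * Q + P * G' * mder (db j) Q) =
      (mder (d i) P * G' + P * mder (d i) G') * Gi' *
      (mder (db j) G' * Q + G' * mder (db j) Q) := by
    calc _ = (mder (d i) P * G' + P * mder (d i) G') * (Q * Qi) * Gi' * (Pi * P) *
        (mder (db j) G' * Q + G' * mder (db j) Q) := by noncomm_ring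
      _ = _ := by rw [hQQ, hPP', mul_one, mul_one]
  rw [e1]
  have e2 : (mder (d i) P * G' + P * mder (d i) G') * Gi' *
      (mder (db j) G' * Q + G' * mder (db j) Q) = mder (d i) P * (G' * Gi') * mder (db j) G' * Q
      + mder (d i) P * (G' * Gi') * G' * mder (db j) Q
      + P * mder (d i) G' * Gi' * mder (db j) G' * Q
      + P * mder (d i) G' * (Gi' * G') * mder (db j) Q := by noncomm_ring
  have e3 : mder (d i) (mder (db j) Q) = 0 := by rw [mder_comm (comm i j), hQ, map_zero]
  rw [e2, tG, tG', e3]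
  noncomm_ring

theorem mapMatrix_mder_mul_mul (ev : A →ₐ[ℂ] ℂ) (D : Derivation ℂ A A)
    {X M Y : Matrix (Fin n) (Fin n) A} (hX : ev.mapMatrix X = 0) (hY : ev.mapMatrix Y = 0) :
    ev.mapMatrix (mder D (X * M * Y)) = 0 := by
  simp only [mder_mul, map_add, map_mul, hX, hY, zero_mul, mul_zero, add_zero]

theorem mapMatrix_mder_mder_mul_mul (ev : A →ₐ[ℂ] ℂ) (D D' : Derivation ℂ A A)
    {X M Y : Matrix (Fin n) (Fin n) A} (hX : ev.mapMatrix X = 0) (hY : ev.mapMatrix Y = 0) :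
    ev.mapMatrix (mder D (mder D' (X * M * Y))) =
      ev.mapMatrix (mder D' X) * ev.mapMatrix M * ev.mapMatrix (mder D Y) +
      ev.mapMatrix (mder D X) * ev.mapMatrix M * ev.mapMatrix (mder D' Y) := by
  simp only [mder_mul, map_add, map_mul, hX, hY, zero_mul, mul_zero, add_zero, zero_add]

/-- The evolution of the curvature under `∂_t H = -∑ w^{p q̄} R_{p q̄}` in a frame that is normal
at the point `ev`, i.e. in which the first derivatives of `H` vanish there. The frame need not
come from coordinates, so there is no assumption on the torsion; the derivatives of the weights
`w^{p q̄}` appear on the right-hand side. -/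
theorem mapMatrix_mder_curv {d db : Fin n → Derivation ℂ A A} {dt : Derivation ℂ A A}
    (cdd : ∀ i j f, d i (d j f) = d j (d i f)) (cbb : ∀ i j f, db i (db j f) = db j (db i f))
    (cdb : ∀ i j f, d i (db j f) = db j (d i f))
    (ctd : ∀ i f, dt (d i f) = d i (dt f)) (ctb : ∀ i f, dt (db i f) = db i (dt f))
    (ev : A →ₐ[ℂ] ℂ) {H Hi : Matrix (Fin n) (Fin n) A}
    (hd : ∀ i, ev.mapMatrix (mder (d i) H) = 0) (hb : ∀ i, ev.mapMatrix (mder (db i) H) = 0)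
    (w : Fin n → Fin n → A) (flow : mder dt H = -∑ p, ∑ q, w p q • curv d db H Hi p q)
    (i j : Fin n) :
    ev.mapMatrix (mder dt (curv d db H Hi i j)) =
      ∑ p, ∑ q, (ev (w p q) • ev.mapMatrix (mder (d p) (mder (db q) (curv d db H Hi i j)))
        + ev (w p q) •
          (ev.mapMatrix (curv d db H Hi p j) * ev.mapMatrix Hi * ev.mapMatrix (curv d db H Hi i q)
          - ev.mapMatrix (curv d db H Hi i q) * ev.mapMatrix Hi *
            ev.mapMatrix (curv d db H Hi p j))
        + ev (d i (w p q)) • ev.mapMatrix (mder (db q) (curv d db H Hi p j))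
        + ev (db j (w p q)) • ev.mapMatrix (mder (d p) (curv d db H Hi i q))
        + ev (d i (db j (w p q))) • ev.mapMatrix (curv d db H Hi p q)) := by
  have evs : ∀ (a : A) (M : Matrix (Fin n) (Fin n) A),
      ev.mapMatrix (a • M) = ev a • ev.mapMatrix M := by
    intro a M; ext k l; simp
  have hR : ∀ p q, ev.mapMatrix (curv d db H Hi p q) =
      -ev.mapMatrix (mder (d p) (mder (db q) H)) := by
    intro p q
    rw [curv, map_add, map_neg, map_mul, map_mul, hd, zero_mul, zero_mul, add_zero]
  have hR' : ∀ p q, ev.mapMatrix (mder (db q) (mder (d p) H)) =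
      -ev.mapMatrix (curv d db H Hi p q) := by
    intro p q; rw [hR, neg_neg, mder_comm (cdb p q)]
  have hR'' : ∀ p q, ev.mapMatrix (mder (d p) (mder (db q) H)) =
      -ev.mapMatrix (curv d db H Hi p q) := by
    intro p q; rw [hR, neg_neg]
  -- The second Bianchi identity, without torsion terms because the frame is normal.
  have bianchi₁ : ∀ p q, ev.mapMatrix (mder (db j) (curv d db H Hi p q)) =
      ev.mapMatrix (mder (db q) (curv d db H Hi p j)) := by
    intro p q
    rw [curv, curv, map_add, map_add, map_add, map_add, mapMatrix_mder_mul_mul ev _ (hd p) (hb q),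
      mapMatrix_mder_mul_mul ev _ (hd p) (hb j), map_neg, map_neg, map_neg, map_neg,
      mder_comm (cdb p q), mder_comm (cdb p j), mder_comm (cbb j q)]
  have bianchi₂ : ∀ p q, ev.mapMatrix (mder (d i) (curv d db H Hi p q)) =
      ev.mapMatrix (mder (d p) (curv d db H Hi i q)) := by
    intro p q
    rw [curv, curv, map_add, map_add, map_add, map_add, mapMatrix_mder_mul_mul ev _ (hd p) (hb q),
      mapMatrix_mder_mul_mul ev _ (hd i) (hb q), map_neg, map_neg, map_neg, map_neg,
      mder_comm (cdd i p)]
  -- The commutation of two pairs of derivatives produces the quadratic terms.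
  have second : ∀ p q, ev.mapMatrix (mder (d i) (mder (db j) (curv d db H Hi p q))) =
      ev.mapMatrix (mder (d p) (mder (db q) (curv d db H Hi i j))) +
      (ev.mapMatrix (curv d db H Hi p j) * ev.mapMatrix Hi * ev.mapMatrix (curv d db H Hi i q)
        - ev.mapMatrix (curv d db H Hi i q) * ev.mapMatrix Hi *
          ev.mapMatrix (curv d db H Hi p j)) := by
    intro p q
    have h4 : mder (d i) (mder (db j) (mder (d p) (mder (db q) H))) =
        mder (d p) (mder (db q) (mder (d i) (mder (db j) H))) := by
      rw [← mder_comm (cdb p j), mder_comm (cdd i p), mder_comm (cbb j q), mder_comm (cdb i q)]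
    conv_lhs => rw [curv]
    conv_rhs => enter [1]; rw [curv]
    simp only [map_add, mapMatrix_mder_mder_mul_mul ev _ _ (hd _) (hb _), map_neg, h4, hR', hR'',
      mder_comm (cdd i p), mder_comm (cbb j q)]
    noncomm_ring
  -- At the centre of the frame only `-∂_i ∂_j̄ ∂_t H` contributes to the time derivative.
  have lhs : ev.mapMatrix (mder dt (curv d db H Hi i j)) =
      ev.mapMatrix (mder (d i) (mder (db j) (∑ p, ∑ q, w p q • curv d db H Hi p q))) := by
    conv_lhs => rw [curv]
    rw [map_add, map_add, mapMatrix_mder_mul_mul ev _ (hd i) (hb j), add_zero, map_neg,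
      mder_comm (ctd i), mder_comm (ctb j), flow]
    simp only [map_neg, neg_neg]
  rw [lhs]
  simp only [map_sum]
  refine Finset.sum_congr rfl fun p _ => Finset.sum_congr rfl fun q _ => ?_
  simp only [mder_smul, map_add, evs, bianchi₁, bianchi₂, second, smul_add]
  abel

end MatrixDerivation

/-! ### The heat operator in an adapted frame -/

section Heat

variable {n : ℕ} {A : Type*} [CommRing A] [Algebra ℂ A]

/-- The heat operator `∂_t - ∑ w^{p q̄} ∂_p ∂_q̄`. -/
def heat (d db : Fin n → Derivation ℂ A A) (dt : Derivation ℂ A A) (w : Fin n → Fin n → A) :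
    A →ₗ[ℂ] A :=
  (dt : A →ₗ[ℂ] A) - ∑ p, ∑ q,
    LinearMap.mulLeft ℂ (w p q) ∘ₗ (d p : A →ₗ[ℂ] A) ∘ₗ (db q : A →ₗ[ℂ] A)

theorem heat_apply (d db : Fin n → Derivation ℂ A A) (dt : Derivation ℂ A A)
    (w : Fin n → Fin n → A) (f : A) :
    heat d db dt w f = dt f - ∑ p, ∑ q, w p q * d p (db q f) := by
  simp [heat, LinearMap.sum_apply]

/-- Pairs of vector fields `U = U^i ∂_i` (holomorphic) and `Ub` (antiholomorphic, its conjugate),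
independent of time, that at the point `ev` are parallel for the connection with coefficients
`Γ_{ip}^r`, the lower indices of the Chern connection being interchanged:
`∂_p U^r = -Γ_{ip}^r U^i`. -/
structure IsAdapted (d db : Fin n → Derivation ℂ A A) (dt : Derivation ℂ A A)
    (G Gi : Matrix (Fin n) (Fin n) A) (ev : A →ₐ[ℂ] ℂ) (U Ub : Fin n → A) : Prop where
  db_eq : ∀ q r, db q (U r) = 0
  d_eq : ∀ p r, d p (Ub r) = 0
  dt_eq : ∀ r, dt (U r) = 0
  dt_bar_eq : ∀ r, dt (Ub r) = 0
  ev_d : ∀ p r, ev (d p (U r)) = -∑ i, ev (U i) * ev ((mder (d i) G * Gi) p r)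
  ev_db : ∀ q s, ev (db q (Ub s)) = -∑ j, ev (Ub j) * ev ((Gi * mder (db j) G) s q)

/-- The contraction `∑ U^i V^j r_{i j}` of a family of matrices with two vectors. -/
def contract {R : Type*} [CommRing R] (r : Fin n → Fin n → Matrix (Fin n) (Fin n) R)
    (U V : Fin n → R) : Matrix (Fin n) (Fin n) R :=
  ∑ i, ∑ j, (U i * V j) • r i j

theorem contract_apply {R : Type*} [CommRing R] (r : Fin n → Fin n → Matrix (Fin n) (Fin n) R)
    (U V : Fin n → R) (k l : Fin n) :
    contract r U V k l = ∑ i, ∑ j, U i * V j * r i j k l := by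
  simp [contract, Matrix.sum_apply]

/-- The reaction term in the evolution equation of the curvature `r` (in the direction of `u` and
the conjugate vector `v`). Here `gi` is the inverse of the matrix of the metric, whose entry
`gi q p` is `g^{p q̄}`. -/
def reaction (gi : Matrix (Fin n) (Fin n) ℂ) (r : Fin n → Fin n → Matrix (Fin n) (Fin n) ℂ)
    (u v : Fin n → ℂ) : Matrix (Fin n) (Fin n) ℂ :=
  ∑ p, ∑ q, ((gi * contract r u v * gi) q p • r p q + gi q p •
    ((∑ j, v j • r p j) * gi * (∑ i, u i • r i q) - (∑ i, u i • r i q) * gi * ∑ j, v j • r p j))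

/-- The summation behind the evolution equation of the contracted curvature: the first derivatives
of the weights `w` and those of the vectors `u`, `v` cancel, by `h1`, `h2` and `h3`. -/
theorem sum_contract_aux (u v : Fin n → ℂ) (w du dv : Fin n → Fin n → ℂ)
    (dw dbw : Fin n → Fin n → Fin n → ℂ) (ddw c dd : Fin n → Fin n → Fin n → Fin n → ℂ)
    (B D : Fin n → Fin n → Fin n → ℂ) (ρ : Fin n → Fin n → ℂ) (S : Fin n → Fin n → ℂ)
    (h1 : ∀ p q, ∑ i, u i * dw i p q = ∑ m, w m q * du m p)
    (h2 : ∀ p q, ∑ j, v j * dbw j p q = ∑ m, w p m * dv m q)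
    (h3 : ∀ p q, ∑ i, ∑ j, u i * v j * ddw i j p q = S p q + ∑ a, ∑ b, w a b * du a p * dv b q) :
    ∑ i, ∑ j, u i * v j * ∑ p, ∑ q, (w p q * dd i j p q + w p q * c i j p q + dw i p q * B q p j
        + dbw j p q * D p i q + ddw i j p q * ρ p q)
      - ∑ p, ∑ q, w p q * ∑ i, ∑ j, (du p i * dv q j * ρ i j + du p i * v j * B q i j
        + u i * dv q j * D p i j + u i * v j * dd i j p q) =
    ∑ p, ∑ q, (S p q * ρ p q + w p q * ∑ i, ∑ j, u i * v j * c i j p q) := by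
  have swap : ∀ F : Fin n → Fin n → Fin n → Fin n → ℂ,
      ∑ i, ∑ j, ∑ p, ∑ q, F i j p q = ∑ p, ∑ q, ∑ i, ∑ j, F i j p q := by
    intro F
    calc _ = ∑ i, ∑ p, ∑ j, ∑ q, F i j p q :=
          Finset.sum_congr rfl fun i _ => Finset.sum_comm
      _ = ∑ p, ∑ i, ∑ j, ∑ q, F i j p q := Finset.sum_comm
      _ = ∑ p, ∑ i, ∑ q, ∑ j, F i j p q :=
          Finset.sum_congr rfl fun p _ => Finset.sum_congr rfl fun i _ => Finset.sum_comm
      _ = _ := Finset.sum_congr rfl fun p _ => Finset.sum_comm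
  have t1 : ∑ i, ∑ j, ∑ p, ∑ q, u i * v j * (dw i p q * B q p j) =
      ∑ p, ∑ q, ∑ i, ∑ j, w p q * (du p i * v j * B q i j) := by
    calc _ = ∑ p, ∑ q, ∑ j, v j * B q p j * ∑ i, u i * dw i p q := by
          rw [swap]
          refine Finset.sum_congr rfl fun p _ => Finset.sum_congr rfl fun q _ => ?_
          rw [Finset.sum_comm]
          refine Finset.sum_congr rfl fun j _ => ?_
          rw [Finset.mul_sum]
          exact Finset.sum_congr rfl fun i _ => by ring
      _ = ∑ p, ∑ q, ∑ j, ∑ m, w m q * (du m p * v j * B q p j) := by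
          refine Finset.sum_congr rfl fun p _ => Finset.sum_congr rfl fun q _ =>
            Finset.sum_congr rfl fun j _ => ?_
          rw [h1, Finset.mul_sum]
          exact Finset.sum_congr rfl fun i _ => by ring
      _ = ∑ m, ∑ q, ∑ p, ∑ j, w m q * (du m p * v j * B q p j) := by
          calc _ = ∑ p, ∑ q, ∑ m, ∑ j, w m q * (du m p * v j * B q p j) :=
                Finset.sum_congr rfl fun p _ => Finset.sum_congr rfl fun q _ => Finset.sum_comm
            _ = ∑ p, ∑ m, ∑ q, ∑ j, w m q * (du m p * v j * B q p j) :=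
                Finset.sum_congr rfl fun p _ => Finset.sum_comm
            _ = ∑ m, ∑ p, ∑ q, ∑ j, w m q * (du m p * v j * B q p j) := Finset.sum_comm
            _ = _ := Finset.sum_congr rfl fun p _ => Finset.sum_comm
  have t2 : ∑ i, ∑ j, ∑ p, ∑ q, u i * v j * (dbw j p q * D p i q) =
      ∑ p, ∑ q, ∑ i, ∑ j, w p q * (u i * dv q j * D p i j) := by
    calc _ = ∑ p, ∑ q, ∑ i, u i * D p i q * ∑ j, v j * dbw j p q := by
          rw [swap]
          refine Finset.sum_congr rfl fun p _ => Finset.sum_congr rfl fun q _ =>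
            Finset.sum_congr rfl fun i _ => ?_
          rw [Finset.mul_sum]
          exact Finset.sum_congr rfl fun j _ => by ring
      _ = ∑ p, ∑ q, ∑ i, ∑ m, w p m * (u i * dv m q * D p i q) := by
          refine Finset.sum_congr rfl fun p _ => Finset.sum_congr rfl fun q _ =>
            Finset.sum_congr rfl fun j _ => ?_
          rw [h2, Finset.mul_sum]
          exact Finset.sum_congr rfl fun i _ => by ring
      _ = ∑ p, ∑ m, ∑ i, ∑ q, w p m * (u i * dv m q * D p i q) := by
          refine Finset.sum_congr rfl fun p _ => ?_
          calc _ = ∑ q, ∑ m, ∑ i, w p m * (u i * dv m q * D p i q) :=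
                Finset.sum_congr rfl fun q _ => Finset.sum_comm
            _ = ∑ m, ∑ q, ∑ i, w p m * (u i * dv m q * D p i q) := Finset.sum_comm
            _ = _ := Finset.sum_congr rfl fun m _ => Finset.sum_comm
  have t3 : ∑ i, ∑ j, ∑ p, ∑ q, u i * v j * (ddw i j p q * ρ p q) =
      ∑ p, ∑ q, S p q * ρ p q + ∑ p, ∑ q, ∑ i, ∑ j, w p q * (du p i * dv q j * ρ i j) := by
    rw [swap]
    calc _ = ∑ p, ∑ q, (S p q * ρ p q + ∑ a, ∑ b, w a b * (du a p * dv b q * ρ p q)) := by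
          refine Finset.sum_congr rfl fun p _ => Finset.sum_congr rfl fun q _ => ?_
          calc _ = (∑ i, ∑ j, u i * v j * ddw i j p q) * ρ p q := by
                simp only [Finset.sum_mul]
                exact Finset.sum_congr rfl fun i _ => Finset.sum_congr rfl fun j _ => by ring
            _ = _ := by
                rw [h3, add_mul]
                simp only [Finset.sum_mul]
                congr 1
                exact Finset.sum_congr rfl fun i _ => Finset.sum_congr rfl fun j _ => by ring
      _ = _ := by
          simp only [Finset.sum_add_distrib]
          rw [swap]
  have t4 : ∑ i, ∑ j, ∑ p, ∑ q, u i * v j * (w p q * dd i j p q) =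
      ∑ p, ∑ q, ∑ i, ∑ j, w p q * (u i * v j * dd i j p q) := by
    rw [swap]
    exact Finset.sum_congr rfl fun p _ => Finset.sum_congr rfl fun q _ =>
      Finset.sum_congr rfl fun i _ => Finset.sum_congr rfl fun j _ => by ring
  have t5 : ∑ i, ∑ j, ∑ p, ∑ q, u i * v j * (w p q * c i j p q) =
      ∑ p, ∑ q, ∑ i, ∑ j, w p q * (u i * v j * c i j p q) := by
    rw [swap]
    exact Finset.sum_congr rfl fun p _ => Finset.sum_congr rfl fun q _ =>
      Finset.sum_congr rfl fun i _ => Finset.sum_congr rfl fun j _ => by ring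
  simp only [Finset.mul_sum, mul_add, Finset.sum_add_distrib]
  rw [t1, t2, t3, t4, t5]
  ring

/-- The coordinate derivations `∂_i`, `∂_j̄`, `∂_t` commute. -/
structure Commuting (d db : Fin n → Derivation ℂ A A) (dt : Derivation ℂ A A) : Prop where
  d_d : ∀ i j f, d i (d j f) = d j (d i f)
  db_db : ∀ i j f, db i (db j f) = db j (db i f)
  d_db : ∀ i j f, d i (db j f) = db j (d i f)
  dt_d : ∀ i f, dt (d i f) = d i (dt f)
  dt_db : ∀ i f, dt (db i f) = db i (dt f)

/-- `H` is the form `G` in a frame that agrees with the given one at the point `ev` and is normal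
there: the first derivatives of `H` vanish at `ev`. -/
structure IsNormalFrame (d db : Fin n → Derivation ℂ A A)
    (G Gi H Hi : Matrix (Fin n) (Fin n) A) (ev : A →ₐ[ℂ] ℂ) : Prop where
  mul_inv : H * Hi = 1
  ev_inv : ev.mapMatrix Hi = ev.mapMatrix Gi
  ev_curv : ∀ i j, ev.mapMatrix (curv d db H Hi i j) = ev.mapMatrix (curv d db G Gi i j)
  ev_d : ∀ i, ev.mapMatrix (mder (d i) H) = 0
  ev_db : ∀ i, ev.mapMatrix (mder (db i) H) = 0

variable {d db : Fin n → Derivation ℂ A A} {dt : Derivation ℂ A A}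
  {G Gi H Hi : Matrix (Fin n) (Fin n) A} {ev : A →ₐ[ℂ] ℂ} {U Ub V Vb : Fin n → A}

/-- The defining equation of adapted vector fields is chosen such that their derivatives match
those of the inverse metric. -/
theorem IsAdapted.sum_ev_d_inv (hU : IsAdapted d db dt G Gi ev U Ub) (hG : G * Gi = 1)
    (p q : Fin n) :
    ∑ i, ev (U i) * ev (d i (Gi q p)) = ∑ m, ev (Gi q m) * ev (d m (U p)) := by
  have h : ∀ i, ev (d i (Gi q p)) = -∑ m, ev (Gi q m) * ev ((mder (d i) G * Gi) m p) := by
    intro i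
    rw [← mder_apply (d i) Gi, mder_inv _ hG, mul_assoc, Matrix.neg_apply, Matrix.mul_apply]
    simp only [map_neg, map_sum, map_mul]
  simp only [h, hU.ev_d, mul_neg, Finset.mul_sum, Finset.sum_neg_distrib]
  rw [Finset.sum_comm]
  exact congrArg _ (Finset.sum_congr rfl fun i _ => Finset.sum_congr rfl fun j _ => by ring)

theorem IsAdapted.sum_ev_db_inv (hU : IsAdapted d db dt G Gi ev U Ub) (hG : G * Gi = 1)
    (p q : Fin n) :
    ∑ j, ev (Ub j) * ev (db j (Gi q p)) = ∑ m, ev (Gi m p) * ev (db m (Ub q)) := by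
  have h : ∀ i, ev (db i (Gi q p)) = -∑ m, ev ((Gi * mder (db i) G) q m) * ev (Gi m p) := by
    intro i
    rw [← mder_apply (db i) Gi, mder_inv _ hG, Matrix.neg_apply, Matrix.mul_apply]
    simp only [map_neg, map_sum, map_mul]
  simp only [h, hU.ev_db, mul_neg, Finset.mul_sum, Finset.sum_neg_distrib]
  rw [Finset.sum_comm]
  exact congrArg _ (Finset.sum_congr rfl fun i _ => Finset.sum_congr rfl fun j _ => by ring)

theorem mder_mder_inv (hG : G * Gi = 1)
    (i j : Fin n) :
    mder (d i) (mder (db j) Gi) =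
      Gi * curv d db G Gi i j * Gi + Gi * mder (db j) G * (Gi * (mder (d i) G * Gi)) := by
  rw [mder_inv _ hG, curv]
  simp only [map_neg, mder_mul, mder_inv (d i) hG]
  noncomm_ring

/-- The second derivatives of the inverse metric in the direction of adapted vector fields: the
curvature with raised indices and the product of the first derivatives of the fields. -/
theorem sum_ev_d_db_inv (hG : G * Gi = 1)
    (hU : IsAdapted d db dt G Gi ev U Ub) (hV : IsAdapted d db dt G Gi ev V Vb) (p q : Fin n) :
    ∑ i, ∑ j, ev (U i) * ev (Vb j) * ev (d i (db j (Gi q p))) =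
      (ev.mapMatrix Gi * contract (fun i j => ev.mapMatrix (curv d db G Gi i j))
        (fun i => ev (U i)) (fun j => ev (Vb j)) * ev.mapMatrix Gi) q p
      + ∑ a, ∑ b, ev (Gi b a) * ev (d a (U p)) * ev (db b (Vb q)) := by
  have h : ∀ i j, ev (d i (db j (Gi q p))) =
      (ev.mapMatrix Gi * ev.mapMatrix (curv d db G Gi i j) * ev.mapMatrix Gi) q p +
      ∑ b, ev ((Gi * mder (db j) G) q b) *
        ∑ a, ev (Gi b a) * ev ((mder (d i) G * Gi) a p) := by
    intro i j
    have := congrFun (congrFun (mder_mder_inv (d := d) (db := db) hG i j) q) p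
    simp only [mder_apply] at this
    rw [this, Matrix.add_apply, map_add, ← map_mul, ← map_mul]
    congr 1
    rw [Matrix.mul_apply, map_sum]
    refine Finset.sum_congr rfl fun b _ => ?_
    rw [map_mul, Matrix.mul_apply (M := Gi) (N := mder (d i) G * Gi), map_sum]
    simp only [map_mul]
  simp only [h, mul_add, Finset.sum_add_distrib]
  congr 1
  · rw [contract]
    simp only [Finset.mul_sum, Finset.sum_mul, Matrix.sum_apply, Matrix.mul_smul,
      Matrix.smul_mul, Matrix.smul_apply, smul_eq_mul]
  · calc _ = ∑ b, ∑ a, ∑ i, ∑ j, ev (Gi b a) * (ev (U i) * ev ((mder (d i) G * Gi) a p))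
          * (ev (Vb j) * ev ((Gi * mder (db j) G) q b)) := by
          simp only [Finset.mul_sum]
          calc _ = ∑ i, ∑ b, ∑ j, ∑ a, ev (U i) * ev (Vb j) * (ev ((Gi * mder (db j) G) q b) *
                (ev (Gi b a) * ev ((mder (d i) G * Gi) a p))) :=
                Finset.sum_congr rfl fun i _ => Finset.sum_comm
            _ = ∑ b, ∑ i, ∑ a, ∑ j, ev (U i) * ev (Vb j) * (ev ((Gi * mder (db j) G) q b) *
                (ev (Gi b a) * ev ((mder (d i) G * Gi) a p))) := by
                rw [Finset.sum_comm]
                exact Finset.sum_congr rfl fun i _ => Finset.sum_congr rfl fun b _ =>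
                  Finset.sum_comm
            _ = ∑ b, ∑ a, ∑ i, ∑ j, ev (U i) * ev (Vb j) * (ev ((Gi * mder (db j) G) q b) *
                (ev (Gi b a) * ev ((mder (d i) G * Gi) a p))) :=
                Finset.sum_congr rfl fun b _ => Finset.sum_comm
            _ = _ := Finset.sum_congr rfl fun b _ => Finset.sum_congr rfl fun a _ =>
                Finset.sum_congr rfl fun i _ => Finset.sum_congr rfl fun j _ => by ring
      _ = _ := by
          rw [Finset.sum_comm]
          refine Finset.sum_congr rfl fun a _ => Finset.sum_congr rfl fun b _ => ?_
          rw [hU.ev_d, hV.ev_db, mul_neg, mul_neg, neg_mul, neg_neg, mul_assoc,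
            Finset.sum_mul_sum, Finset.mul_sum]
          refine Finset.sum_congr rfl fun i _ => ?_
          rw [Finset.mul_sum]
          exact Finset.sum_congr rfl fun j _ => by ring

/-- The evolution equation of the curvature contracted with adapted vector fields: in a normal
frame the heat operator applied to `R(U, V̄)` is the reaction term, without any terms that contain
derivatives of the curvature. -/
theorem ev_heat_contract_curv (hc : Commuting d db dt) (hG : G * Gi = 1)
    (hH : IsNormalFrame d db G Gi H Hi ev)
    (flow : mder dt H = -∑ p, ∑ q, Gi q p • curv d db H Hi p q)
    (hU : IsAdapted d db dt G Gi ev U Ub) (hV : IsAdapted d db dt G Gi ev V Vb) (k l : Fin n) :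
    ev (heat d db dt (fun p q => Gi q p) (contract (curv d db H Hi) U Vb k l)) =
      reaction (ev.mapMatrix Gi) (fun i j => ev.mapMatrix (curv d db G Gi i j))
        (fun i => ev (U i)) (fun j => ev (Vb j)) k l := by
  have key := sum_contract_aux (fun i => ev (U i)) (fun j => ev (Vb j)) (fun p q => ev (Gi q p))
    (fun p i => ev (d p (U i))) (fun q j => ev (db q (Vb j)))
    (fun i p q => ev (d i (Gi q p))) (fun j p q => ev (db j (Gi q p)))
    (fun i j p q => ev (d i (db j (Gi q p))))
    (fun i j p q => (ev.mapMatrix (curv d db H Hi p j) * ev.mapMatrix Hi *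
      ev.mapMatrix (curv d db H Hi i q) - ev.mapMatrix (curv d db H Hi i q) * ev.mapMatrix Hi *
      ev.mapMatrix (curv d db H Hi p j)) k l)
    (fun i j p q => ev (d p (db q (curv d db H Hi i j k l))))
    (fun q p j => ev (db q (curv d db H Hi p j k l)))
    (fun p i q => ev (d p (curv d db H Hi i q k l)))
    (fun p q => ev (curv d db H Hi p q k l))
    (fun p q => (ev.mapMatrix Gi * contract (fun i j => ev.mapMatrix (curv d db G Gi i j))
        (fun i => ev (U i)) (fun j => ev (Vb j)) * ev.mapMatrix Gi) q p)
    (fun p q => hU.sum_ev_d_inv hG p q) (fun p q => hV.sum_ev_db_inv hG p q)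
    (fun p q => sum_ev_d_db_inv hG hU hV p q)
  have evo : ∀ i j, ev (dt (curv d db H Hi i j k l)) = _ := fun i j =>
    congrFun (congrFun (mapMatrix_mder_curv hc.d_d hc.db_db hc.d_db hc.dt_d hc.dt_db ev hH.ev_d
      hH.ev_db (fun p q => Gi q p) flow i j) k) l
  simp only [Matrix.sum_apply, Matrix.add_apply, Matrix.smul_apply, smul_eq_mul] at evo
  have e1 : ev (dt (contract (curv d db H Hi) U Vb k l)) =
      ∑ i, ∑ j, ev (U i) * ev (Vb j) * ev (dt (curv d db H Hi i j k l)) := by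
    simp only [contract_apply, map_sum, Derivation.leibniz, hU.dt_eq, hV.dt_bar_eq, smul_eq_mul,
      map_mul, mul_zero, add_zero]
  have e2 : ∀ p q, ev (d p (db q (contract (curv d db H Hi) U Vb k l))) =
      ∑ i, ∑ j, (ev (d p (U i)) * ev (db q (Vb j)) * ev (curv d db H Hi i j k l)
        + ev (d p (U i)) * ev (Vb j) * ev (db q (curv d db H Hi i j k l))
        + ev (U i) * ev (db q (Vb j)) * ev (d p (curv d db H Hi i j k l))
        + ev (U i) * ev (Vb j) * ev (d p (db q (curv d db H Hi i j k l)))) := by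
    intro p q
    simp only [contract_apply, map_sum, Derivation.leibniz, smul_eq_mul,
      map_add, map_mul, hU.db_eq, hV.d_eq, hc.d_db p q (Vb _), map_zero, mul_zero, add_zero, zero_add]
    exact Finset.sum_congr rfl fun i _ => Finset.sum_congr rfl fun j _ => by ring
  rw [heat_apply, map_sub, e1]
  simp only [map_sum, map_mul, e2]
  simp only [evo]
  refine key.trans ?_
  rw [reaction]
  simp only [Matrix.sum_apply, Matrix.add_apply, Matrix.smul_apply, smul_eq_mul]
  refine Finset.sum_congr rfl fun p _ => Finset.sum_congr rfl fun q _ => ?_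
  congr 1
  · rw [← hH.ev_curv]; rfl
  · simp only [Matrix.sub_apply, mul_sub, Finset.sum_sub_distrib, hH.ev_curv, hH.ev_inv]
    congr 2
    · simp only [Finset.sum_mul, Finset.mul_sum, Matrix.sum_apply, Matrix.smul_mul,
        Matrix.mul_smul, Matrix.smul_apply, smul_eq_mul]
      exact Finset.sum_congr rfl fun j _ => Finset.sum_congr rfl fun i _ => by ring
    · simp only [Finset.sum_mul, Finset.mul_sum, Matrix.sum_apply, Matrix.smul_mul,
        Matrix.mul_smul, Matrix.smul_apply, smul_eq_mul]
      rw [Finset.sum_comm]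
      exact Finset.sum_congr rfl fun j _ => Finset.sum_congr rfl fun i _ => by ring

end Heat

/-! ### The heat operator on the terms of the barrier -/

section HeatNormal

variable {n : ℕ} {A : Type*} [CommRing A] [Algebra ℂ A]

variable {d db : Fin n → Derivation ℂ A A} {dt : Derivation ℂ A A}
  {G Gi H Hi : Matrix (Fin n) (Fin n) A} {ev : A →ₐ[ℂ] ℂ} {U Ub V Vb : Fin n → A}

theorem heat_mul (w : Fin n → Fin n → A) (f g : A) :
    heat d db dt w (f * g) = heat d db dt w f * g + f * heat d db dt w g
      - ∑ p, ∑ q, w p q * (d p f * db q g + db q f * d p g) := by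
  have h : ∑ p, ∑ q, w p q * d p (db q (f * g)) = (∑ p, ∑ q, w p q * d p (db q f)) * g
      + f * (∑ p, ∑ q, w p q * d p (db q g))
      + ∑ p, ∑ q, w p q * (d p f * db q g + db q f * d p g) := by
    simp only [Finset.sum_mul, Finset.mul_sum, ← Finset.sum_add_distrib]
    refine Finset.sum_congr rfl fun p _ => Finset.sum_congr rfl fun q _ => ?_
    simp only [Derivation.leibniz, map_add, smul_eq_mul]
    ring
  rw [heat_apply, heat_apply, heat_apply, h, Derivation.leibniz, smul_eq_mul, smul_eq_mul]
  ring

theorem ev_heat_mul_of_normal (w : Fin n → Fin n → A) (f : A) {g : A}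
    (hd : ∀ p, ev (d p g) = 0) (hb : ∀ p, ev (db p g) = 0) :
    ev (heat d db dt w (f * g)) =
      ev (heat d db dt w f) * ev g + ev f * ev (heat d db dt w g) := by
  simp [heat_mul, hd, hb]

theorem heat_mul_of_time (w : Fin n → Fin n → A) {δ : A} (hd : ∀ p, d p δ = 0)
    (hb : ∀ p, db p δ = 0) (f : A) :
    heat d db dt w (δ * f) = dt δ * f + δ * heat d db dt w f := by
  rw [heat_mul, heat_apply _ _ _ _ δ]
  simp [hd, hb]

/-- The value `∑ Y^k M_{k l} Yb^l` of a sesquilinear form with matrix `M` at constant vectors. -/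
def quad {R : Type*} [AddCommMonoid R] [Module ℂ R] (M : Matrix (Fin n) (Fin n) R)
    (Y Yb : Fin n → ℂ) : R :=
  ∑ k, ∑ l, (Y k * Yb l) • M k l

theorem map_quad {R R' : Type*} [AddCommMonoid R] [Module ℂ R] [AddCommMonoid R'] [Module ℂ R']
    (f : R →ₗ[ℂ] R') (M : Matrix (Fin n) (Fin n) R) (Y Yb : Fin n → ℂ) :
    f (quad M Y Yb) = quad (M.map f) Y Yb := by
  simp [quad]

theorem ev_quad (M : Matrix (Fin n) (Fin n) A) (Y Yb : Fin n → ℂ) :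
    ev (quad M Y Yb) = quad (ev.mapMatrix M) Y Yb :=
  map_quad ev.toLinearMap M Y Yb

theorem der_quad (D : Derivation ℂ A A) (M : Matrix (Fin n) (Fin n) A) (Y Yb : Fin n → ℂ) :
    D (quad M Y Yb) = quad (mder D M) Y Yb :=
  map_quad (D : A →ₗ[ℂ] A) M Y Yb

theorem quad_zero (Y Yb : Fin n → ℂ) : quad (0 : Matrix (Fin n) (Fin n) ℂ) Y Yb = 0 := by
  simp [quad]

/-- In a normal frame the first derivatives drop out of the curvature, and the flow is the heat
equation at the centre. -/
theorem IsNormalFrame.ev_dt (hH : IsNormalFrame d db G Gi H Hi ev)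
    (flow : mder dt H = -∑ p, ∑ q, Gi q p • curv d db H Hi p q) :
    ev.mapMatrix (mder dt H) =
      ∑ p, ∑ q, ev (Gi q p) • ev.mapMatrix (mder (d p) (mder (db q) H)) := by
  have evs : ∀ (a : A) (M : Matrix (Fin n) (Fin n) A),
      ev.mapMatrix (a • M) = ev a • ev.mapMatrix M := by
    intro a M; ext k l; simp
  have hR : ∀ p q, ev.mapMatrix (curv d db H Hi p q) =
      -ev.mapMatrix (mder (d p) (mder (db q) H)) := by
    intro p q
    rw [curv, map_add, map_neg, map_mul, map_mul, hH.ev_d, zero_mul, zero_mul, add_zero]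
  rw [flow]
  simp only [map_neg, map_sum, evs, hR, smul_neg, Finset.sum_neg_distrib, neg_neg]

/-- The flow makes the squared norm of a vector with constant components in a normal frame a
solution of the heat equation at the centre of the frame. -/
theorem IsNormalFrame.ev_heat_form (hH : IsNormalFrame d db G Gi H Hi ev)
    (flow : mder dt H = -∑ p, ∑ q, Gi q p • curv d db H Hi p q) (k l : Fin n) :
    ev (heat d db dt (fun p q => Gi q p) (H k l)) = 0 := by
  have h := congrFun (congrFun (hH.ev_dt flow) k) l
  simp only [Matrix.sum_apply, Matrix.smul_apply, smul_eq_mul] at h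
  rw [heat_apply, map_sub, sub_eq_zero]
  simp only [map_sum, map_mul]
  exact h

theorem IsNormalFrame.ev_d_inv (hH : IsNormalFrame d db G Gi H Hi ev) (i k l : Fin n) :
    ev (d i (Hi k l)) = 0 := by
  have : ev.mapMatrix (mder (d i) Hi) = 0 := by
    rw [mder_inv _ hH.mul_inv, map_neg, map_mul, map_mul, hH.ev_d, mul_zero, zero_mul, neg_zero]
  exact congrFun (congrFun this k) l

theorem IsNormalFrame.ev_db_inv (hH : IsNormalFrame d db G Gi H Hi ev) (i k l : Fin n) :
    ev (db i (Hi k l)) = 0 := by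
  have : ev.mapMatrix (mder (db i) Hi) = 0 := by
    rw [mder_inv _ hH.mul_inv, map_neg, map_mul, map_mul, hH.ev_db, mul_zero, zero_mul, neg_zero]
  exact congrFun (congrFun this k) l

theorem IsNormalFrame.ev_heat_inv (hH : IsNormalFrame d db G Gi H Hi ev)
    (flow : mder dt H = -∑ p, ∑ q, Gi q p • curv d db H Hi p q) (k l : Fin n) :
    ev (heat d db dt (fun p q => Gi q p) (Hi k l)) = 0 := by
  have h1 : ev.mapMatrix (mder dt Hi) = ∑ p, ∑ q, ev (Gi q p) •
      ev.mapMatrix (mder (d p) (mder (db q) Hi)) := by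
    have h2 : ∀ p q, ev.mapMatrix (mder (d p) (mder (db q) Hi)) =
        -(ev.mapMatrix Hi * ev.mapMatrix (mder (d p) (mder (db q) H)) * ev.mapMatrix Hi) := by
      intro p q
      rw [mder_inv _ hH.mul_inv]
      simp only [map_neg, mder_mul, map_add, map_mul, hH.ev_db, mul_zero, zero_mul, add_zero,
        zero_add]
    rw [mder_inv _ hH.mul_inv, map_neg, map_mul, map_mul, hH.ev_dt flow]
    simp only [h2, Finset.mul_sum, Finset.sum_mul, smul_neg, Finset.sum_neg_distrib,
      Matrix.mul_smul, Matrix.smul_mul]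
  have h := congrFun (congrFun h1 k) l
  simp only [Matrix.sum_apply, Matrix.smul_apply, smul_eq_mul] at h
  rw [heat_apply, map_sub, sub_eq_zero]
  simp only [map_sum, map_mul]
  exact h

theorem ev_heat_quad_contract (hc : Commuting d db dt) (hG : G * Gi = 1)
    (hH : IsNormalFrame d db G Gi H Hi ev)
    (flow : mder dt H = -∑ p, ∑ q, Gi q p • curv d db H Hi p q)
    (hU : IsAdapted d db dt G Gi ev U Ub) (hV : IsAdapted d db dt G Gi ev V Vb)
    (Y Yb : Fin n → ℂ) :
    ev (heat d db dt (fun p q => Gi q p) (quad (contract (curv d db H Hi) U Vb) Y Yb)) =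
      quad (reaction (ev.mapMatrix Gi) (fun i j => ev.mapMatrix (curv d db G Gi i j))
        (fun i => ev (U i)) (fun j => ev (Vb j))) Y Yb := by
  rw [map_quad, ev_quad]
  congr 1
  ext k l
  exact ev_heat_contract_curv hc hG hH flow hU hV k l

theorem ev_heat_trace (hc : Commuting d db dt) (hG : G * Gi = 1)
    (hH : IsNormalFrame d db G Gi H Hi ev)
    (flow : mder dt H = -∑ p, ∑ q, Gi q p • curv d db H Hi p q)
    (hU : IsAdapted d db dt G Gi ev U Ub) (hV : IsAdapted d db dt G Gi ev V Vb) :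
    ev (heat d db dt (fun p q => Gi q p) (contract (curv d db H Hi) U Vb * Hi).trace) =
      (reaction (ev.mapMatrix Gi) (fun i j => ev.mapMatrix (curv d db G Gi i j))
        (fun i => ev (U i)) (fun j => ev (Vb j)) * ev.mapMatrix Gi).trace := by
  simp only [Matrix.trace, Matrix.diag_apply, Matrix.mul_apply, map_sum]
  refine Finset.sum_congr rfl fun k _ => Finset.sum_congr rfl fun l _ => ?_
  rw [ev_heat_mul_of_normal _ _ (fun p => hH.ev_d_inv p l k) (fun p => hH.ev_db_inv p l k),
    ev_heat_contract_curv hc hG hH flow hU hV, hH.ev_heat_inv flow, mul_zero, add_zero,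
    ← hH.ev_inv]
  rfl

/-- The heat operator on the squared norm of an adapted vector field: the value is minus the squared
norm of the covariant derivative of the field for the Chern connection, which is a torsion term. -/
theorem ev_heat_norm (hG : G * Gi = 1)
    (flow : mder dt G = -∑ p, ∑ q, Gi q p • curv d db G Gi p q)
    (hc : Commuting d db dt) (hU : IsAdapted d db dt G Gi ev U Ub) :
    ev (heat d db dt (fun p q => Gi q p) (∑ i, ∑ j, U i * Ub j * G i j)) =
      -∑ p, ∑ q, ev (Gi q p) *
        (((fun r => ev (d p (U r))) + Matrix.vecMul (fun i => ev (U i))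
            (ev.mapMatrix (mder (d p) G) * ev.mapMatrix Gi)) ⬝ᵥ
          Matrix.mulVec (ev.mapMatrix G) ((fun r => ev (db q (Ub r))) +
            Matrix.mulVec (ev.mapMatrix Gi * ev.mapMatrix (mder (db q) G))
              (fun i => ev (Ub i)))) := by
  have hgi : ev.mapMatrix G * ev.mapMatrix Gi = 1 := by rw [← map_mul, hG, map_one]
  have hig : ev.mapMatrix Gi * ev.mapMatrix G = 1 := mul_eq_one_comm.1 hgi
  have sq : ∀ (a b : Fin n → ℂ) (M : Matrix (Fin n) (Fin n) ℂ),
      ∑ i, ∑ j, a i * b j * M i j = a ⬝ᵥ M.mulVec b := by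
    intro a b M
    simp only [dotProduct, Matrix.mulVec, Finset.mul_sum]
    exact Finset.sum_congr rfl fun i _ => Finset.sum_congr rfl fun j _ => by ring
  have evs : ∀ (a : A) (M : Matrix (Fin n) (Fin n) A),
      ev.mapMatrix (a • M) = ev a • ev.mapMatrix M := by
    intro a M; ext k l; simp
  have e1 : ev (dt (∑ i, ∑ j, U i * Ub j * G i j)) =
      (fun i => ev (U i)) ⬝ᵥ (ev.mapMatrix (mder dt G)).mulVec (fun i => ev (Ub i)) := by
    rw [← sq]
    simp [hU.dt_eq, hU.dt_bar_eq]
  have e2 : ∀ p q, ev (d p (db q (∑ i, ∑ j, U i * Ub j * G i j))) =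
      (fun i => ev (U i)) ⬝ᵥ (ev.mapMatrix (mder (d p) (mder (db q) G))).mulVec
        (fun i => ev (Ub i))
      + (fun i => ev (U i)) ⬝ᵥ (ev.mapMatrix (mder (d p) G)).mulVec (fun i => ev (db q (Ub i)))
      + (fun i => ev (d p (U i))) ⬝ᵥ (ev.mapMatrix (mder (db q) G)).mulVec (fun i => ev (Ub i))
      + (fun i => ev (d p (U i))) ⬝ᵥ (ev.mapMatrix G).mulVec (fun i => ev (db q (Ub i))) := by
    intro p q
    simp only [← sq, ← Finset.sum_add_distrib]
    simp only [map_sum, Derivation.leibniz, smul_eq_mul, map_add, map_mul, hU.db_eq, hU.d_eq,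
      hc.d_db p q (Ub _), map_zero, mul_zero, add_zero, zero_add]
    refine Finset.sum_congr rfl fun i _ => Finset.sum_congr rfl fun j _ => ?_
    simp only [AlgHom.mapMatrix_apply, Matrix.map_apply, mder_apply]
    ring
  generalize (∑ i, ∑ j, U i * Ub j * G i j) = x at e1 e2 ⊢
  rw [heat_apply, map_sub, e1, flow]
  simp only [map_sum, map_neg, evs, map_mul, e2, curv, map_add]
  have e3 : ∀ (u v : Fin n → ℂ) (M : Fin n → Fin n → Matrix (Fin n) (Fin n) ℂ),
      u ⬝ᵥ Matrix.mulVec (-∑ p, ∑ q, M p q) v = -∑ p, ∑ q, u ⬝ᵥ (M p q).mulVec v := by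
    intro u v M
    simp only [Matrix.neg_mulVec, dotProduct_neg, Matrix.sum_mulVec, dotProduct_sum]
  rw [e3, ← neg_add', ← Finset.sum_add_distrib]
  congr 1
  refine Finset.sum_congr rfl fun p _ => ?_
  rw [← Finset.sum_add_distrib]
  refine Finset.sum_congr rfl fun q _ => ?_
  rw [Matrix.smul_mulVec, dotProduct_smul, smul_eq_mul, ← mul_add]
  congr 1
  simp only [Matrix.mulVec_add, dotProduct_add, add_dotProduct, Matrix.add_mulVec,
    Matrix.neg_mulVec, dotProduct_neg, Matrix.mulVec_mulVec, ← Matrix.dotProduct_mulVec,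
    mul_assoc, ← mul_assoc (ev.mapMatrix G), hgi, hig, one_mul, mul_one]
  ring

/-- The function whose sign is controlled by the maximum principle, as an element of the ring of
functions: `Ric(U, Ū)|Y|² + δ (s R(U, Ū, Y, Ȳ) + R(U, V̄, Y, Ȳ) + R(V, Ū, Y, Ȳ)) - B |V|²|Y|²`,
minus the multiple `κ (|U|² + |V|²)|Y|²` of the norms. -/
def barrier (d db : Fin n → Derivation ℂ A A) (G H Hi : Matrix (Fin n) (Fin n) A)
    (U Ub V Vb : Fin n → A) (Y Yb : Fin n → ℂ) (s B : ℂ) (δ κ : A) : A :=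
  (contract (curv d db H Hi) U Ub * Hi).trace * quad H Y Yb
    + δ * (s • quad (contract (curv d db H Hi) U Ub) Y Yb
      + quad (contract (curv d db H Hi) U Vb) Y Yb + quad (contract (curv d db H Hi) V Ub) Y Yb)
    - B • ((∑ i, ∑ j, V i * Vb j * G i j) * quad H Y Yb)
    - κ * (((∑ i, ∑ j, U i * Ub j * G i j) + ∑ i, ∑ j, V i * Vb j * G i j) * quad H Y Yb)

/-- The heat operator applied to the barrier, at the centre of a normal frame, is a sum of terms
without derivatives of the curvature. -/
theorem ev_heat_barrier (hc : Commuting d db dt) (hG : G * Gi = 1)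
    (hH : IsNormalFrame d db G Gi H Hi ev)
    (flow : mder dt H = -∑ p, ∑ q, Gi q p • curv d db H Hi p q)
    (hU : IsAdapted d db dt G Gi ev U Ub) (hV : IsAdapted d db dt G Gi ev V Vb)
    (Y Yb : Fin n → ℂ) (s B : ℂ) {δ κ : A} (hδ : ∀ p, d p δ = 0) (hδ' : ∀ p, db p δ = 0)
    (hκ : ∀ p, d p κ = 0) (hκ' : ∀ p, db p κ = 0)
    {r : Fin n → Fin n → Matrix (Fin n) (Fin n) ℂ} {gi : Matrix (Fin n) (Fin n) ℂ}
    (hr : ∀ i j, ev.mapMatrix (curv d db G Gi i j) = r i j) (hgi : ev.mapMatrix Gi = gi)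
    {u ub v vb : Fin n → ℂ} (hu : ∀ i, ev (U i) = u i) (hub : ∀ i, ev (Ub i) = ub i)
    (hv : ∀ i, ev (V i) = v i) (hvb : ∀ i, ev (Vb i) = vb i) {y : ℂ}
    (hy : ev (quad H Y Yb) = y) :
    ev (heat d db dt (fun p q => Gi q p) (barrier d db G H Hi U Ub V Vb Y Yb s B δ κ)) =
      (reaction gi r u ub * gi).trace * y
      + ev (dt δ) * (s * quad (contract r u ub) Y Yb + quad (contract r u vb) Y Yb
          + quad (contract r v ub) Y Yb)
      + ev δ * (s * quad (reaction gi r u ub) Y Yb + quad (reaction gi r u vb) Y Yb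
          + quad (reaction gi r v ub) Y Yb)
      - B * (ev (heat d db dt (fun p q => Gi q p) (∑ i, ∑ j, V i * Vb j * G i j)) * y)
      - ev (dt κ) * ((ev (∑ i, ∑ j, U i * Ub j * G i j)
          + ev (∑ i, ∑ j, V i * Vb j * G i j)) * y)
      - ev κ * ((ev (heat d db dt (fun p q => Gi q p) (∑ i, ∑ j, U i * Ub j * G i j))
          + ev (heat d db dt (fun p q => Gi q p) (∑ i, ∑ j, V i * Vb j * G i j))) * y) := by
  have hq : ∀ (D : Derivation ℂ A A), ev.mapMatrix (mder D H) = 0 →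
      ev (D (quad H Y Yb)) = 0 := by
    intro D h
    rw [der_quad, ev_quad, h, quad_zero]
  have hd := fun p => hq (d p) (hH.ev_d p)
  have hb := fun p => hq (db p) (hH.ev_db p)
  have hyh : ev (heat d db dt (fun p q => Gi q p) (quad H Y Yb)) = 0 := by
    rw [map_quad, ev_quad, ← quad_zero (n := n) Y Yb]
    congr 1
    ext k l
    exact hH.ev_heat_form flow k l
  have hcon : ∀ {U' U'b : Fin n → A} {u' v' : Fin n → ℂ}, (∀ i, ev (U' i) = u' i) →
      (∀ i, ev (U'b i) = v' i) → ev (quad (contract (curv d db H Hi) U' U'b) Y Yb) =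
        quad (contract r u' v') Y Yb := by
    intro U' U'b u' v' h h'
    rw [ev_quad]
    congr 1
    ext k l
    simp only [AlgHom.mapMatrix_apply, Matrix.map_apply, contract_apply, map_sum, map_mul, h, h']
    refine Finset.sum_congr rfl fun i _ => Finset.sum_congr rfl fun j _ => ?_
    rw [← hr, ← hH.ev_curv]
    rfl
  have hu' : (fun i => ev (U i)) = u := funext hu
  have hub' : (fun i => ev (Ub i)) = ub := funext hub
  have hv' : (fun i => ev (V i)) = v := funext hv
  have hvb' : (fun i => ev (Vb i)) = vb := funext hvb
  have hr' : (fun i j => ev.mapMatrix (curv d db G Gi i j)) = r :=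
    funext fun i => funext fun j => hr i j
  rw [barrier]
  simp only [heat_mul_of_time _ hδ hδ', heat_mul_of_time _ hκ hκ', map_sub, map_add, map_mul,
    map_smul, smul_eq_mul, ev_heat_mul_of_normal _ _ hd hb, hyh, mul_zero, add_zero, hy,
    ev_heat_trace hc hG hH flow hU hU, ev_heat_quad_contract hc hG hH flow hU hU,
    ev_heat_quad_contract hc hG hH flow hU hV, ev_heat_quad_contract hc hG hH flow hV hU,
    hcon hu hub, hcon hu hvb, hcon hv hub, hu', hub', hv', hvb', hr', hgi]
  ring

end HeatNormal

/-! ### Wirtinger derivations on rings of smooth functions -/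

section Wirtinger

open smoothFun

variable {n : ℕ}

theorem cn_eq_sum (v : Cn n) : v = ∑ a, ((v a).re • EuclideanSpace.single a (1 : ℂ)
    + (v a).im • EuclideanSpace.single a Complex.I) := by
  ext b
  simp [Pi.single_apply, Finset.sum_add_distrib]

/-- A real-linear form decomposes into its complex-linear and its antilinear part. -/
theorem real_linear_eq_sum (ℓ : Cn n →L[ℝ] ℂ) (v : Cn n) :
    ℓ v = ∑ a, (v a * ((ℓ (EuclideanSpace.single a 1)
        - Complex.I * ℓ (EuclideanSpace.single a Complex.I)) / 2)
      + conj (v a) * ((ℓ (EuclideanSpace.single a 1)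
        + Complex.I * ℓ (EuclideanSpace.single a Complex.I)) / 2)) := by
  conv_lhs => rw [cn_eq_sum v]
  rw [map_sum]
  refine Finset.sum_congr rfl fun a _ => ?_
  rw [map_add, map_smul, map_smul]
  simp only [Complex.real_smul]
  have h1 : conj (v a) = (v a).re - (v a).im * Complex.I := by
    apply Complex.ext <;> simp
  have h2 : v a = (v a).re + (v a).im * Complex.I := (Complex.re_add_im _).symm
  rw [h1]
  generalize (v a).re = x at *
  generalize (v a).im = y at *
  rw [h2]
  linear_combination (y : ℂ) * ℓ (EuclideanSpace.single a Complex.I) * Complex.I_mul_I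

variable {E : Type*} [NormedAddCommGroup E] [NormedSpace ℝ E] {V : Set E}

/-- The derivation `∂_i` of the ring of smooth functions on a subset of `E`, the coordinate
directions being embedded in `E` by `ι`. -/
def wd (hV : IsRegular V) (ι : Cn n →L[ℝ] E) (i : Fin n) :
    Derivation ℂ (smoothFun V) (smoothFun V) :=
  der hV ((2⁻¹ : ℝ) • ι (EuclideanSpace.single i 1))
    (-((2⁻¹ : ℝ) • ι (EuclideanSpace.single i Complex.I)))

/-- The derivation `∂_ī` of the ring of smooth functions on a subset of `E`. -/
def wdb (hV : IsRegular V) (ι : Cn n →L[ℝ] E) (i : Fin n) :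
    Derivation ℂ (smoothFun V) (smoothFun V) :=
  der hV ((2⁻¹ : ℝ) • ι (EuclideanSpace.single i 1))
    ((2⁻¹ : ℝ) • ι (EuclideanSpace.single i Complex.I))

theorem ev_wd (hV : IsRegular V) (ι : Cn n →L[ℝ] E) (i : Fin n) (f : smoothFun V) (x : V) :
    ev x (wd hV ι i f) = (diff f x (ι (EuclideanSpace.single i 1))
      - Complex.I * diff f x (ι (EuclideanSpace.single i Complex.I))) / 2 := by
  rw [wd, ev_der, map_neg, map_smul, map_smul]
  simp only [Complex.real_smul]
  push_cast
  ring

theorem ev_wdb (hV : IsRegular V) (ι : Cn n →L[ℝ] E) (i : Fin n) (f : smoothFun V) (x : V) :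
    ev x (wdb hV ι i f) = (diff f x (ι (EuclideanSpace.single i 1))
      + Complex.I * diff f x (ι (EuclideanSpace.single i Complex.I))) / 2 := by
  rw [wdb, ev_der, map_smul, map_smul]
  simp only [Complex.real_smul]
  push_cast
  ring

theorem commuting_wd (hV : IsRegular V) (ι : Cn n →L[ℝ] E) (u v : E) :
    Commuting (wd hV ι) (wdb hV ι) (der hV u v) :=
  ⟨fun _ _ _ => der_comm _ _ _ _ _ _, fun _ _ _ => der_comm _ _ _ _ _ _,
    fun _ _ _ => der_comm _ _ _ _ _ _, fun _ _ => der_comm _ _ _ _ _ _,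
    fun _ _ => der_comm _ _ _ _ _ _⟩

theorem conjHom_wd (hV : IsRegular V) (ι : Cn n →L[ℝ] E) (i : Fin n) (f : smoothFun V) :
    conjHom V (wd hV ι i f) = wdb hV ι i (conjHom V f) := by
  rw [wd, wdb, conjHom_der, neg_neg]

theorem conjHom_wdb (hV : IsRegular V) (ι : Cn n →L[ℝ] E) (i : Fin n) (f : smoothFun V) :
    conjHom V (wdb hV ι i f) = wd hV ι i (conjHom V f) := by
  rw [wd, wdb, conjHom_der]

variable {E' : Type*} [NormedAddCommGroup E'] [NormedSpace ℝ E'] {V' : Set E'}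

theorem wd_pullback (hV : IsRegular V) (hV' : IsRegular V') (ι : Cn n →L[ℝ] E)
    (ι' : Cn n →L[ℝ] E') {φ : E → E'} (hφ : ContDiffOn ℝ ∞ φ V) (hm : Set.MapsTo φ V V')
    {φ' : E →L[ℝ] E'} (h' : ∀ x ∈ V, HasFDerivWithinAt φ φ' V x) (hι : ∀ v, φ' (ι v) = ι' v)
    (i : Fin n) (f : smoothFun V') :
    wd hV ι i (pullback φ hφ hm f) = pullback φ hφ hm (wd hV' ι' i f) := by
  ext x
  rw [ev_pullback, ev_wd, ev_wd, diff_pullback hV hφ hm f x (h' x x.2)]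
  simp [hι]

theorem wdb_pullback (hV : IsRegular V) (hV' : IsRegular V') (ι : Cn n →L[ℝ] E)
    (ι' : Cn n →L[ℝ] E') {φ : E → E'} (hφ : ContDiffOn ℝ ∞ φ V) (hm : Set.MapsTo φ V V')
    {φ' : E →L[ℝ] E'} (h' : ∀ x ∈ V, HasFDerivWithinAt φ φ' V x) (hι : ∀ v, φ' (ι v) = ι' v)
    (i : Fin n) (f : smoothFun V') :
    wdb hV ι i (pullback φ hφ hm f) = pullback φ hφ hm (wdb hV' ι' i f) := by
  ext x
  rw [ev_pullback, ev_wdb, ev_wdb, diff_pullback hV hφ hm f x (h' x x.2)]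
  simp [hι]

section Holomorphic

variable {U U' : Set (Cn n)}

/-- Holomorphic functions are annihilated by the derivations `∂_j̄`. -/
theorem wdb_mk_eq_zero (hU : IsOpen U) {h : Cn n → ℂ} (hh : DifferentiableOn ℂ h U)
    (hs : ContDiffOn ℝ ∞ h U) (j : Fin n) :
    wdb (.of_isOpen hU) (.id ℝ (Cn n)) j (smoothFun.mk h hs) = 0 := by
  ext x
  have hd : diff (smoothFun.mk h hs) x = (fderiv ℂ h x).restrictScalars ℝ :=
    diff_eq (.of_isOpen hU) ((((hh x x.2).differentiableAt
      (hU.mem_nhds x.2)).hasFDerivAt.restrictScalars ℝ).hasFDerivWithinAt) fun y => rfl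
  have hI : EuclideanSpace.single j Complex.I =
      Complex.I • (EuclideanSpace.single j 1 : Cn n) := by
    ext k; simp
  rw [ev_wdb, hd]
  simp only [ContinuousLinearMap.coe_id', id_eq, ContinuousLinearMap.coe_restrictScalars', hI,
    map_smul, smul_eq_mul, map_zero]
  linear_combination (fderiv ℂ h x (EuclideanSpace.single j 1)) / 2 * Complex.I_mul_I

theorem wd_pullback_holomorphic (hU : IsOpen U) (hU' : IsOpen U') {φ : Cn n → Cn n}
    (hφ : ContDiffOn ℝ ∞ φ U) (hm : Set.MapsTo φ U U') (hd : DifferentiableOn ℂ φ U)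
    {J : Matrix (Fin n) (Fin n) (smoothFun U)}
    (hJ : ∀ i a x, ev x (J i a) = fderiv ℂ φ x (EuclideanSpace.single i 1) a)
    (i : Fin n) (f : smoothFun U') :
    wd (.of_isOpen hU) (.id ℝ (Cn n)) i (pullback φ hφ hm f) =
      ∑ a, J i a * pullback φ hφ hm (wd (.of_isOpen hU') (.id ℝ (Cn n)) a f) := by
  ext x
  have hI : EuclideanSpace.single i Complex.I =
      Complex.I • (EuclideanSpace.single i 1 : Cn n) := by
    ext k; simp
  have h' : HasFDerivWithinAt φ ((fderiv ℂ φ x).restrictScalars ℝ) U x :=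
    (((hd x x.2).differentiableAt
      (hU.mem_nhds x.2)).hasFDerivAt.restrictScalars ℝ).hasFDerivWithinAt
  rw [ev_wd, diff_pullback (.of_isOpen hU) hφ hm f x h', map_sum]
  simp only [map_mul, hJ, ev_pullback, ev_wd, ContinuousLinearMap.coe_id', id_eq,
    ContinuousLinearMap.comp_apply, ContinuousLinearMap.coe_restrictScalars', hI, map_smul]
  generalize fderiv ℂ φ x (EuclideanSpace.single i 1) = w
  generalize diff f ⟨φ x, hm x.2⟩ = ℓ
  rw [real_linear_eq_sum ℓ w, real_linear_eq_sum ℓ (Complex.I • w), Finset.mul_sum,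
    ← Finset.sum_sub_distrib, Finset.sum_div]
  refine Finset.sum_congr rfl fun a _ => ?_
  simp only [PiLp.smul_apply, smul_eq_mul, map_mul, Complex.conj_I]
  have hII := Complex.I_mul_I
  generalize (ℓ (EuclideanSpace.single a 1) - Complex.I * ℓ (EuclideanSpace.single a Complex.I))
    / 2 = α
  generalize (ℓ (EuclideanSpace.single a 1) + Complex.I * ℓ (EuclideanSpace.single a Complex.I))
    / 2 = β
  linear_combination (-(w a * α) + conj (w a) * β) / 2 * hII

theorem wdb_pullback_holomorphic (hU : IsOpen U) (hU' : IsOpen U') {φ : Cn n → Cn n}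
    (hφ : ContDiffOn ℝ ∞ φ U) (hm : Set.MapsTo φ U U') (hd : DifferentiableOn ℂ φ U)
    {J : Matrix (Fin n) (Fin n) (smoothFun U)}
    (hJ : ∀ i a x, ev x (J i a) = fderiv ℂ φ x (EuclideanSpace.single i 1) a)
    (i : Fin n) (f : smoothFun U') :
    wdb (.of_isOpen hU) (.id ℝ (Cn n)) i (pullback φ hφ hm f) =
      ∑ a, conjHom U (J i a) * pullback φ hφ hm (wdb (.of_isOpen hU') (.id ℝ (Cn n)) a f) := by
  have h := congrArg (conjHom U) (wd_pullback_holomorphic hU hU' hφ hm hd hJ i (conjHom U' f))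
  have hc : ∀ g : smoothFun U', conjHom U (pullback φ hφ hm g) = pullback φ hφ hm (conjHom U' g) :=
    fun g => rfl
  have hcc : ∀ g : smoothFun U', conjHom U' (conjHom U' g) = g :=
    fun g => by ext x; exact Complex.conj_conj _
  rw [conjHom_wd, hc, hcc, map_sum] at h
  simpa only [map_mul, hc, conjHom_wd, hcc] using h

end Holomorphic

/-! ### Matrices of smooth functions and the Chern curvature -/

/-- A matrix-valued smooth function as a matrix over the ring of smooth functions. -/
def matMk (G : E → Matrix (Fin n) (Fin n) ℂ)
    (hG : ∀ i j, ContDiffOn ℝ ∞ (fun z => G z i j) V) : Matrix (Fin n) (Fin n) (smoothFun V) :=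
  Matrix.of fun i j => smoothFun.mk _ (hG i j)

@[simp] theorem ev_matMk (G : E → Matrix (Fin n) (Fin n) ℂ)
    (hG : ∀ i j, ContDiffOn ℝ ∞ (fun z => G z i j) V) (x : V) :
    (ev x).mapMatrix (matMk G hG) = G x := by
  ext i j; rfl

theorem isUnit_det_of_ev {M : Matrix (Fin n) (Fin n) (smoothFun V)}
    (h : ∀ x, ((ev x).mapMatrix M).det ≠ 0) : IsUnit M.det :=
  isUnit_of_forall_ne_zero fun x => by
    rw [AlgHom.map_det]; exact h x

theorem ev_inv {M : Matrix (Fin n) (Fin n) (smoothFun V)} (h : IsUnit M.det) (x : V) :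
    (ev x).mapMatrix M⁻¹ = ((ev x).mapMatrix M)⁻¹ := by
  refine (Matrix.inv_eq_right_inv ?_).symm
  rw [← map_mul, Matrix.mul_nonsing_inv _ h, map_one]

section ChernFormulas

variable {U : Set (Cn n)} (hU : IsOpen U) {G : Cn n → Matrix (Fin n) (Fin n) ℂ}
  (hG : ∀ i j, ContDiffOn ℝ ∞ (fun z => G z i j) U) (hdet : ∀ z ∈ U, (G z).det ≠ 0)

theorem ev_wd_eq_dz {f : smoothFun U} {F : Cn n → ℂ} (h : ∀ y : U, F y = ev y f) (x : U)
    (i : Fin n) : ev x (wd (.of_isOpen hU) (.id ℝ (Cn n)) i f) = dz i F x := by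
  have hF : HasFDerivAt F (diff f x) x :=
    ((hasFDerivWithinAt f x).hasFDerivAt (hU.mem_nhds x.2)).congr_of_eventuallyEq <| by
      filter_upwards [hU.mem_nhds x.2] with y hy
      rw [h ⟨y, hy⟩, extZero_apply _ hy]; rfl
  rw [ev_wd, dz, hF.fderiv]; rfl

theorem ev_wdb_eq_dzbar {f : smoothFun U} {F : Cn n → ℂ} (h : ∀ y : U, F y = ev y f) (x : U)
    (i : Fin n) : ev x (wdb (.of_isOpen hU) (.id ℝ (Cn n)) i f) = dzbar i F x := by
  have hF : HasFDerivAt F (diff f x) x :=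
    ((hasFDerivWithinAt f x).hasFDerivAt (hU.mem_nhds x.2)).congr_of_eventuallyEq <| by
      filter_upwards [hU.mem_nhds x.2] with y hy
      rw [h ⟨y, hy⟩, extZero_apply _ hy]; rfl
  rw [ev_wdb, dzbar, hF.fderiv]; rfl

include hdet in
theorem isUnit_det_matMk : IsUnit (matMk G hG).det :=
  isUnit_det_of_ev fun x => by rw [ev_matMk]; exact hdet x x.2

include hdet in
/-- The curvature tensor in terms of the algebraic curvature of the matrix of components. -/
theorem chernCurv_eq_ev (x : U) (i j k l : Fin n) :
    chernCurv G i j k l x = ev x (curv (wd (.of_isOpen hU) (.id ℝ (Cn n)))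
      (wdb (.of_isOpen hU) (.id ℝ (Cn n))) (matMk G hG) (matMk G hG)⁻¹ i j k l) := by
  have hu := isUnit_det_matMk hG hdet
  have hΓ : ∀ (a b c : Fin n) (y : U), chernGamma G a b c y =
      ev y ((mder (wd (.of_isOpen hU) (.id ℝ (Cn n)) a) (matMk G hG) * (matMk G hG)⁻¹) b c) := by
    intro a b c y
    rw [chernGamma, Matrix.mul_apply, map_sum]
    refine Finset.sum_congr rfl fun p _ => ?_
    rw [map_mul, mder_apply, ev_wd_eq_dz hU (F := fun w => G w b p) (fun y => rfl), mul_comm,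
      gInv, ← ev_matMk G hG y, ← ev_inv hu]
    rfl
  rw [chernCurv, ← neg_mder_mul_eq_curv (commuting_wd _ _ 0 0).d_db
    (Matrix.mul_nonsing_inv _ hu), Matrix.mul_apply, map_sum]
  refine Finset.sum_congr rfl fun p _ => ?_
  rw [chernCurvUp, map_mul, mul_comm, Matrix.neg_apply, map_neg, mder_apply,
    ev_wdb_eq_dzbar hU (F := chernGamma G i k p) (fun y => hΓ i k p y)]
  rfl

end ChernFormulas

end Wirtinger

/-! ### Components of a Hermitian metric and changes of charts -/

section Components

variable {n : ℕ} {M : Type*} [TopologicalSpace M] [ChartedSpace (Cn n) M]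

theorem quad_eq_dotProduct (A : Matrix (Fin n) (Fin n) ℂ) (X Y : Fin n → ℂ) :
    quad A X Y = X ⬝ᵥ A *ᵥ Y := by
  simp only [quad, dotProduct, Matrix.mulVec, Finset.mul_sum, smul_eq_mul]
  exact Finset.sum_congr rfl fun i _ => Finset.sum_congr rfl fun j _ => by ring

namespace HermitianMetric

theorem form_congr (g : HermitianMetric n M) {p p' : M} (h : p = p') (u v : Cn n) :
    g.form p u v = g.form p' u v := by
  subst h; rfl

theorem conj_comp (g : HermitianMetric n M) (e : OpenPartialHomeomorph M (Cn n)) (z : Cn n)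
    (i j : Fin n) : conj (g.comp e z i j) = g.comp e z j i :=
  g.conj_symm _ _ _

theorem quad_comp (g : HermitianMetric n M) (e : OpenPartialHomeomorph M (Cn n)) (z : Cn n)
    (X Y : Cn n) : quad (g.comp e z) X (star (Y : Fin n → ℂ)) =
      g.form (e.symm z) (mfderiv 𝓘(ℂ, Cn n) 𝓘(ℂ, Cn n) e.symm z X)
        (mfderiv 𝓘(ℂ, Cn n) 𝓘(ℂ, Cn n) e.symm z Y) := by
  have h : ∀ X : Cn n, mfderiv 𝓘(ℂ, Cn n) 𝓘(ℂ, Cn n) e.symm z X =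
      ∑ i, X i • coordVec e z i := by
    intro X
    have hX : X = ∑ i, X i • (EuclideanSpace.single i (1 : ℂ) : Cn n) := by
      ext b; simp [Pi.single_apply]
    conv_lhs => rw [hX]
    erw [map_sum]
    refine Finset.sum_congr rfl fun i _ => ?_
    erw [map_smul]
    rfl
  rw [h, h, map_sum (g.form (e.symm z)), LinearMap.sum_apply, quad]
  refine Finset.sum_congr rfl fun i _ => ?_
  rw [map_sum]
  refine Finset.sum_congr rfl fun j _ => ?_
  rw [LinearMap.map_smulₛₗ, LinearMap.map_smul, LinearMap.smul_apply]
  simp only [smul_eq_mul, Pi.star_apply, comp, Matrix.of_apply]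
  rw [mul_comm (X i), mul_assoc]; rfl

theorem mdifferentiable_of_mem {e : OpenPartialHomeomorph M (Cn n)}
    [IsManifold 𝓘(ℂ, Cn n) ω M] (he : e ∈ holoCharts n M) :
    e.MDifferentiable 𝓘(ℂ, Cn n) 𝓘(ℂ, Cn n) :=
  ⟨(contMDiffOn_of_mem_maximalAtlas he).mdifferentiableOn (by simp),
    (contMDiffOn_symm_of_mem_maximalAtlas he).mdifferentiableOn (by simp)⟩

variable [IsManifold 𝓘(ℂ, Cn n) ω M]

theorem quad_comp_pos (g : HermitianMetric n M) {e : OpenPartialHomeomorph M (Cn n)}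
    (he : e ∈ holoCharts n M) {z : Cn n} (hz : z ∈ e.target) {X : Fin n → ℂ} (hX : X ≠ 0) :
    0 < (quad (g.comp e z) X (star X)).re := by
  have h := g.quad_comp e z (WithLp.toLp 2 X) (WithLp.toLp 2 X)
  simp only at h
  rw [h]
  refine g.pos _ _ fun h0 => hX ?_
  have hinj := (mdifferentiable_of_mem he).symm.mfderiv_injective hz
  have := hinj (h0.trans (map_zero _).symm)
  simpa using congrArg WithLp.ofLp (show WithLp.toLp 2 X = 0 from this)

theorem det_comp_ne_zero (g : HermitianMetric n M) {e : OpenPartialHomeomorph M (Cn n)}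
    (he : e ∈ holoCharts n M) {z : Cn n} (hz : z ∈ e.target) : (g.comp e z).det ≠ 0 := by
  intro h
  obtain ⟨v, hv, hv0⟩ := Matrix.exists_mulVec_eq_zero_iff.2 h
  have := g.quad_comp_pos he hz (X := star v) (by simpa using hv)
  rw [quad_eq_dotProduct, star_star, hv0, dotProduct_zero] at this
  exact lt_irrefl _ this

end HermitianMetric

/-- The domain of the transition map between two charts. -/
def overlap (e e' : OpenPartialHomeomorph M (Cn n)) : Set (Cn n) :=
  e.target ∩ e.symm ⁻¹' e'.source

omit [ChartedSpace (Cn n) M] in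
theorem isOpen_overlap (e e' : OpenPartialHomeomorph M (Cn n)) : IsOpen (overlap e e') :=
  e.isOpen_inter_preimage_symm e'.open_source

theorem contDiffOn_transition [IsManifold 𝓘(ℂ, Cn n) ω M]
    {e e' : OpenPartialHomeomorph M (Cn n)} (he : e ∈ holoCharts n M)
    (he' : e' ∈ holoCharts n M) : ContDiffOn ℂ ω (e' ∘ e.symm) (overlap e e') := by
  rw [← contMDiffOn_iff_contDiffOn]
  exact (contMDiffOn_of_mem_maximalAtlas he').comp
    ((contMDiffOn_symm_of_mem_maximalAtlas he).mono Set.inter_subset_left) fun z hz => hz.2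

/-- The Jacobian matrix of the transition map: `J i a = ∂φ^a/∂z^i`. -/
def jacobian (e e' : OpenPartialHomeomorph M (Cn n)) (z : Cn n) : Matrix (Fin n) (Fin n) ℂ :=
  Matrix.of fun i a => fderiv ℂ (e' ∘ e.symm) z (EuclideanSpace.single i 1) a

theorem HermitianMetric.comp_eq_jacobian [IsManifold 𝓘(ℂ, Cn n) ω M] (g : HermitianMetric n M)
    {e e' : OpenPartialHomeomorph M (Cn n)} (he : e ∈ holoCharts n M) (he' : e' ∈ holoCharts n M)
    {z : Cn n} (hz : z ∈ overlap e e') :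
    g.comp e z = jacobian e e' z * g.comp e' (e' (e.symm z)) * (jacobian e e' z)ᴴ := by
  have hφ : DifferentiableAt ℂ (e' ∘ e.symm) z :=
    ((contDiffOn_transition he he' z hz).contDiffAt
      ((isOpen_overlap e e').mem_nhds hz)).differentiableAt (by simp)
  have hs : MDifferentiableAt 𝓘(ℂ, Cn n) 𝓘(ℂ, Cn n) e'.symm ((e' ∘ e.symm) z) :=
    (mdifferentiable_of_mem he').mdifferentiableAt_symm (e'.map_source hz.2)
  have hcomp : HasMFDerivAt 𝓘(ℂ, Cn n) 𝓘(ℂ, Cn n) e.symm z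
      ((mfderiv 𝓘(ℂ, Cn n) 𝓘(ℂ, Cn n) e'.symm ((e' ∘ e.symm) z)).comp
        (fderiv ℂ (e' ∘ e.symm) z)) := by
    refine (hs.hasMFDerivAt.comp z hφ.hasFDerivAt.hasMFDerivAt).congr_of_eventuallyEq ?_
    filter_upwards [(isOpen_overlap e e').mem_nhds hz] with y hy
    exact (e'.left_inv hy.2).symm
  have hpt : e'.symm ((e' ∘ e.symm) z) = e.symm z := e'.left_inv hz.2
  ext i j
  have h1 : g.comp e z i j = g.form (e'.symm ((e' ∘ e.symm) z))
      (mfderiv 𝓘(ℂ, Cn n) 𝓘(ℂ, Cn n) e'.symm ((e' ∘ e.symm) z)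
        (fderiv ℂ (e' ∘ e.symm) z (EuclideanSpace.single i 1)))
      (mfderiv 𝓘(ℂ, Cn n) 𝓘(ℂ, Cn n) e'.symm ((e' ∘ e.symm) z)
        (fderiv ℂ (e' ∘ e.symm) z (EuclideanSpace.single j 1))) := by
    rw [HermitianMetric.comp, Matrix.of_apply, coordVec, coordVec, hcomp.mfderiv]
    exact g.form_congr hpt.symm _ _
  rw [h1, ← g.quad_comp, quad_eq_dotProduct, mul_assoc, Matrix.mul_apply]
  simp only [dotProduct, Matrix.mulVec, Matrix.mul_apply]
  rfl

/-- The transformation law of the Chern curvature tensor. -/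
theorem HermitianMetric.chernCurv_eq_jacobian [IsManifold 𝓘(ℂ, Cn n) ω M]
    (g : HermitianMetric n M)
    {e e' : OpenPartialHomeomorph M (Cn n)} (he : e ∈ holoCharts n M) (he' : e' ∈ holoCharts n M)
    {z : Cn n} (hz : z ∈ overlap e e') (i j : Fin n) :
    (Matrix.of fun k l => chernCurv (g.comp e) i j k l z) =
      ∑ a, ∑ b, (jacobian e e' z i a * star (jacobian e e' z j b)) •
        (jacobian e e' z *
          (Matrix.of fun k l => chernCurv (g.comp e') a b k l (e' (e.symm z))) *
          (jacobian e e' z)ᴴ) := by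
  have hΩ := isOpen_overlap e e'
  have hT := e'.open_target
  have hφ := contDiffOn_transition he he'
  have hφs : ContDiffOn ℝ ∞ (e' ∘ e.symm) (overlap e e') := (hφ.of_le le_top).restrict_scalars ℝ
  have hm : Set.MapsTo (e' ∘ e.symm) (overlap e e') e'.target := fun y hy => e'.map_source hy.2
  have hd : DifferentiableOn ℂ (e' ∘ e.symm) (overlap e e') := hφ.differentiableOn (by simp)
  have hJω : ∀ i a, ContDiffOn ℂ ω (fun y => jacobian e e' y i a) (overlap e e') := by
    intro i a
    have h := (hφ.fderiv_of_isOpen hΩ (m := ω) (by simp)).clm_apply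
      (contDiffOn_const (c := (EuclideanSpace.single i 1 : Cn n)))
    exact (contDiff_piLp_apply (p := 2) (i := a) (n := ω) (𝕜 := ℂ)).comp_contDiffOn h
  have hJs : ∀ i a, ContDiffOn ℝ ∞ (fun y => jacobian e e' y i a) (overlap e e') := fun i a =>
    ((hJω i a).of_le le_top).restrict_scalars ℝ
  have hGs : ∀ i j, ContDiffOn ℝ ∞ (fun y => g.comp e y i j) (overlap e e') := fun i j =>
    (g.smooth e he i j).mono Set.inter_subset_left
  have hG's : ∀ i j, ContDiffOn ℝ ∞ (fun y => g.comp e' y i j) e'.target := g.smooth e' he'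
  have hdet : ∀ y ∈ overlap e e', (g.comp e y).det ≠ 0 := fun y hy => g.det_comp_ne_zero he hy.1
  have hdet' : ∀ y ∈ e'.target, (g.comp e' y).det ≠ 0 := fun y hy => g.det_comp_ne_zero he' hy
  set J := matMk (jacobian e e') hJs with hJ
  set Q : Matrix (Fin n) (Fin n) (smoothFun (overlap e e')) :=
    Matrix.of fun a j => smoothFun.conjHom _ (J j a) with hQ
  have evJ : ∀ y : overlap e e', (smoothFun.ev y).mapMatrix J = jacobian e e' y :=
    fun y => ev_matMk _ _ y
  have evQ : ∀ y : overlap e e', (smoothFun.ev y).mapMatrix Q = (jacobian e e' y)ᴴ :=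
    fun y => by ext a b; rfl
  have hdetJ : ∀ y : overlap e e', (jacobian e e' y).det ≠ 0 := by
    intro y h
    apply hdet y y.2
    rw [g.comp_eq_jacobian he he' y.2, Matrix.det_mul, Matrix.det_mul, h, zero_mul, zero_mul]
  have uJ : IsUnit J.det := isUnit_det_of_ev fun y => by rw [evJ]; exact hdetJ y
  have uQ : IsUnit Q.det := isUnit_det_of_ev fun y => by
    rw [evQ, Matrix.det_conjTranspose]; exact star_ne_zero.2 (hdetJ y)
  have uG' := isUnit_det_matMk hG's hdet'
  set θ := smoothFun.pullback (e' ∘ e.symm) hφs hm with hθ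
  have hGJ : matMk (g.comp e) hGs = J * θ.mapMatrix (matMk (g.comp e') hG's) * Q := by
    have : ∀ y, (smoothFun.ev y).mapMatrix (matMk (g.comp e) hGs) =
        (smoothFun.ev y).mapMatrix (J * θ.mapMatrix (matMk (g.comp e') hG's) * Q) := by
      intro y
      rw [map_mul, map_mul, evJ, evQ, ev_matMk, g.comp_eq_jacobian he he' y.2]
      rfl
    ext i j y
    exact congrFun (congrFun (this y) i) j
  have hinv : (matMk (g.comp e) hGs)⁻¹ =
      Q⁻¹ * θ.mapMatrix (matMk (g.comp e') hG's)⁻¹ * J⁻¹ := by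
    refine Matrix.inv_eq_right_inv ?_
    rw [hGJ]
    calc J * θ.mapMatrix (matMk (g.comp e') hG's) * Q *
          (Q⁻¹ * θ.mapMatrix (matMk (g.comp e') hG's)⁻¹ * J⁻¹) =
        J * (θ.mapMatrix (matMk (g.comp e') hG's) * (Q * Q⁻¹) *
          θ.mapMatrix (matMk (g.comp e') hG's)⁻¹) * J⁻¹ := by noncomm_ring
      _ = 1 := by
        rw [Matrix.mul_nonsing_inv _ uQ, mul_one, ← map_mul, Matrix.mul_nonsing_inv _ uG',
          map_one, mul_one, Matrix.mul_nonsing_inv _ uJ]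
  have hJhol : ∀ j i a, wdb (.of_isOpen hΩ) (.id ℝ (Cn n)) j (J i a) = 0 := fun j i a =>
    wdb_mk_eq_zero hΩ ((hJω i a).differentiableOn (by simp)) (hJs i a) j
  have hJbar : ∀ j i a, wd (.of_isOpen hΩ) (.id ℝ (Cn n)) j
      (smoothFun.conjHom _ (J i a)) = 0 := fun j i a => by
    rw [← conjHom_wdb, hJhol, map_zero]
  have key := curv_transform θ (J := J)
    (Jc := Matrix.of fun j b => smoothFun.conjHom _ (J j b))
    (d := wd (.of_isOpen hΩ) (.id ℝ (Cn n))) (db := wdb (.of_isOpen hΩ) (.id ℝ (Cn n)))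
    (fun i f => wd_pullback_holomorphic hΩ hT hφs hm hd (fun _ _ _ => rfl) i f)
    (fun i f => wdb_pullback_holomorphic hΩ hT hφs hm hd (J := J) (fun _ _ _ => rfl) i f)
    (commuting_wd (.of_isOpen hΩ) _ 0 0).d_db (fun i j b => hJbar i j b) (P := J) (Q := Q)
    (fun j => by ext1 a b; exact hJhol j a b) (fun i => by ext1 a b; exact hJbar i b a)
    (Matrix.mul_nonsing_inv _ uJ) (Matrix.mul_nonsing_inv _ uQ)
    (Matrix.mul_nonsing_inv _ uG') i j
  rw [← hGJ, ← hinv] at key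
  have key' := congrArg (smoothFun.ev ⟨z, hz⟩).mapMatrix key
  have hl : (Matrix.of fun k l => chernCurv (g.comp e) i j k l z) =
      (smoothFun.ev ⟨z, hz⟩).mapMatrix (curv (wd (.of_isOpen hΩ) (.id ℝ (Cn n)))
        (wdb (.of_isOpen hΩ) (.id ℝ (Cn n))) (matMk (g.comp e) hGs)
        (matMk (g.comp e) hGs)⁻¹ i j) := by
    ext k l
    exact chernCurv_eq_ev hΩ hGs hdet ⟨z, hz⟩ i j k l
  rw [hl, key', map_sum]
  refine Finset.sum_congr rfl fun a _ => ?_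
  rw [map_sum]
  refine Finset.sum_congr rfl fun b _ => ?_
  have evs : ∀ (a : smoothFun (overlap e e'))
      (M : Matrix (Fin n) (Fin n) (smoothFun (overlap e e'))),
      (smoothFun.ev ⟨z, hz⟩).mapMatrix (a • M) =
        smoothFun.ev ⟨z, hz⟩ a • (smoothFun.ev ⟨z, hz⟩).mapMatrix M := by
    intro a M; ext k l; simp
  rw [evs, map_mul (smoothFun.ev ⟨z, hz⟩).mapMatrix, map_mul (smoothFun.ev ⟨z, hz⟩).mapMatrix,
    evJ, evQ]
  refine congrArg₂ (· • ·) rfl (congrArg (fun R => jacobian e e' z * R * (jacobian e e' z)ᴴ) ?_)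
  ext k l
  exact (chernCurv_eq_ev hT hG's hdet' ⟨e' (e.symm z), hm hz⟩ a b k l).symm

end Components

/-! ### Linear algebra of curvature tensors at a point -/

section Pointwise

variable {n : ℕ}

/-- The squared norm of a vector in the Hermitian form `G`. -/
def normSq (G : Matrix (Fin n) (Fin n) ℂ) (X : Fin n → ℂ) : ℝ := (quad G X (star X)).re

/-- The curvature tensor `R(X, Z̄, Y, Ȳ)`. -/
def curvVal (r : Fin n → Fin n → Matrix (Fin n) (Fin n) ℂ) (X Z Y : Fin n → ℂ) : ℂ :=
  quad (contract r X (star Z)) Y (star Y)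

/-- The first Ricci curvature `Ric(X, X̄)`. -/
def ricVal (G : Matrix (Fin n) (Fin n) ℂ) (r : Fin n → Fin n → Matrix (Fin n) (Fin n) ℂ)
    (X : Fin n → ℂ) : ℝ :=
  (contract r X (star X) * G⁻¹).trace.re

/-- The barrier at a point: `Ric(X, X̄)|Y|² + δ (s R(X, X̄, Y, Ȳ) + 2 Re R(X, Z̄, Y, Ȳ)) - B |Z|²|Y|²`. -/
def barrierVal (G : Matrix (Fin n) (Fin n) ℂ) (r : Fin n → Fin n → Matrix (Fin n) (Fin n) ℂ)
    (B δ s : ℝ) (X Z Y : Fin n → ℂ) : ℝ :=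
  ricVal G r X * normSq G Y + δ * (s * (curvVal r X X Y).re + 2 * (curvVal r X Z Y).re)
    - B * (normSq G Z * normSq G Y)

section Invariance

variable {G G' J : Matrix (Fin n) (Fin n) ℂ} {r r' : Fin n → Fin n → Matrix (Fin n) (Fin n) ℂ}

theorem quad_conj_mul (A J : Matrix (Fin n) (Fin n) ℂ) (X Y : Fin n → ℂ) :
    quad (J * A * Jᴴ) X (star Y) = quad A (X ᵥ* J) (star (Y ᵥ* J)) := by
  rw [quad_eq_dotProduct, quad_eq_dotProduct, ← Matrix.mulVec_mulVec, ← Matrix.mulVec_mulVec,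
    Matrix.dotProduct_mulVec, Matrix.star_vecMul]

theorem normSq_congr (hG : G = J * G' * Jᴴ) (X : Fin n → ℂ) :
    normSq G X = normSq G' (X ᵥ* J) := by
  rw [normSq, normSq, hG, quad_conj_mul]

theorem contract_congr (hr : ∀ i j, r i j = ∑ a, ∑ b, (J i a * star (J j b)) • (J * r' a b * Jᴴ))
    (X Z : Fin n → ℂ) :
    contract r X (star Z) = J * contract r' (X ᵥ* J) (star (Z ᵥ* J)) * Jᴴ := by
  have h1 : ∀ k l, (J * contract r' (X ᵥ* J) (star (Z ᵥ* J)) * Jᴴ) k l =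
      ∑ a, ∑ b, ∑ i, ∑ j, X i * star (Z j) * (J i a * star (J j b) * (J * r' a b * Jᴴ) k l) := by
    intro k l
    simp only [contract, Finset.mul_sum, Finset.sum_mul, Matrix.mul_smul, Matrix.smul_mul,
      Matrix.sum_apply, Matrix.smul_apply, smul_eq_mul]
    refine Finset.sum_congr rfl fun a _ => Finset.sum_congr rfl fun b _ => ?_
    rw [Matrix.vecMul, dotProduct, Pi.star_apply, Matrix.vecMul, dotProduct, star_sum,
      Finset.sum_mul_sum, Finset.sum_mul]
    refine Finset.sum_congr rfl fun i _ => ?_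
    rw [Finset.sum_mul]
    refine Finset.sum_congr rfl fun j _ => ?_
    rw [star_mul']
    ring
  ext k l
  rw [h1, contract_apply]
  simp only [hr, Matrix.sum_apply, Matrix.smul_apply, smul_eq_mul, Pi.star_apply, Finset.mul_sum]
  calc _ = ∑ i, ∑ a, ∑ j, ∑ b, X i * star (Z j) *
          (J i a * star (J j b) * (J * r' a b * Jᴴ) k l) :=
        Finset.sum_congr rfl fun i _ => Finset.sum_comm
    _ = ∑ a, ∑ i, ∑ b, ∑ j, X i * star (Z j) *
          (J i a * star (J j b) * (J * r' a b * Jᴴ) k l) := by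
        rw [Finset.sum_comm]
        exact Finset.sum_congr rfl fun a _ => Finset.sum_congr rfl fun i _ => Finset.sum_comm
    _ = _ := Finset.sum_congr rfl fun a _ => Finset.sum_comm

theorem ricVal_congr (hG : G = J * G' * Jᴴ) (hdet : G.det ≠ 0)
    (hr : ∀ i j, r i j = ∑ a, ∑ b, (J i a * star (J j b)) • (J * r' a b * Jᴴ))
    (X : Fin n → ℂ) : ricVal G r X = ricVal G' r' (X ᵥ* J) := by
  have hd := hdet
  rw [hG, Matrix.det_mul, Matrix.det_mul] at hd
  have uJ : IsUnit J.det := isUnit_iff_ne_zero.2 (left_ne_zero_of_mul (left_ne_zero_of_mul hd))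
  have uH : IsUnit Jᴴ.det := isUnit_iff_ne_zero.2 (right_ne_zero_of_mul hd)
  rw [ricVal, ricVal, contract_congr hr, hG, Matrix.mul_inv_rev, Matrix.mul_inv_rev]
  congr 1
  calc _ = (J * (contract r' (X ᵥ* J) (star (X ᵥ* J)) * (Jᴴ * Jᴴ⁻¹) * G'⁻¹ * J⁻¹)).trace := by
        congr 1; noncomm_ring
    _ = _ := by
        rw [Matrix.mul_nonsing_inv _ uH, mul_one, Matrix.trace_mul_comm, mul_assoc,
          Matrix.nonsing_inv_mul _ uJ, mul_one]

/-- The barrier does not depend on the chart. -/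
theorem barrierVal_congr (hG : G = J * G' * Jᴴ) (hdet : G.det ≠ 0)
    (hr : ∀ i j, r i j = ∑ a, ∑ b, (J i a * star (J j b)) • (J * r' a b * Jᴴ))
    (B δ s : ℝ) (X Z Y : Fin n → ℂ) :
    barrierVal G r B δ s X Z Y = barrierVal G' r' B δ s (X ᵥ* J) (Z ᵥ* J) (Y ᵥ* J) := by
  have hc : ∀ X Z, curvVal r X Z Y = curvVal r' (X ᵥ* J) (Z ᵥ* J) (Y ᵥ* J) := by
    intro X Z
    rw [curvVal, curvVal, contract_congr hr, quad_conj_mul]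
  rw [barrierVal, barrierVal, ricVal_congr hG hdet hr, normSq_congr hG, normSq_congr hG, hc, hc]

end Invariance

/-- A positive definite Hermitian form `G` and a tensor `r` with the symmetry of a Chern curvature
tensor. -/
structure IsCurvatureTensor (G : Matrix (Fin n) (Fin n) ℂ)
    (r : Fin n → Fin n → Matrix (Fin n) (Fin n) ℂ) : Prop where
  conj_form : ∀ i j, star (G i j) = G j i
  pos : ∀ X, X ≠ 0 → 0 < normSq G X
  conj_curv : ∀ i j k l, star (r i j k l) = r j i l k

theorem IsCurvatureTensor.posDef {G : Matrix (Fin n) (Fin n) ℂ}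
    {r : Fin n → Fin n → Matrix (Fin n) (Fin n) ℂ} (h : IsCurvatureTensor G r) : G.PosDef := by
  have hGh : G.IsHermitian := by ext i j; exact h.conj_form j i
  refine Matrix.PosDef.of_dotProduct_mulVec_pos hGh fun y hy => ?_
  rw [Complex.pos_iff]
  refine ⟨?_, (hGh.im_star_dotProduct_mulVec_self y).symm⟩
  have := h.pos (star y) (by simpa using hy)
  rwa [normSq, star_star, quad_eq_dotProduct] at this

theorem star_quad (M : Matrix (Fin n) (Fin n) ℂ) (X Y : Fin n → ℂ) :
    star (quad M X (star Y)) = quad Mᴴ Y (star X) := by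
  simp only [quad, star_sum, smul_eq_mul, star_mul', Pi.star_apply, star_star,
    Matrix.conjTranspose_apply]
  rw [Finset.sum_comm]
  exact Finset.sum_congr rfl fun i _ => Finset.sum_congr rfl fun j _ => by ring

theorem star_contract {G : Matrix (Fin n) (Fin n) ℂ}
    {r : Fin n → Fin n → Matrix (Fin n) (Fin n) ℂ} (h : IsCurvatureTensor G r)
    (X Z : Fin n → ℂ) : (contract r X (star Z))ᴴ = contract r Z (star X) := by
  ext k l
  simp only [Matrix.conjTranspose_apply, contract_apply, star_sum, star_mul', h.conj_curv,
    Pi.star_apply, star_star]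
  rw [Finset.sum_comm]
  exact Finset.sum_congr rfl fun i _ => Finset.sum_congr rfl fun j _ => by ring

theorem star_curvVal {G : Matrix (Fin n) (Fin n) ℂ}
    {r : Fin n → Fin n → Matrix (Fin n) (Fin n) ℂ} (h : IsCurvatureTensor G r)
    (X Z Y : Fin n → ℂ) : star (curvVal r X Z Y) = curvVal r Z X Y := by
  rw [curvVal, star_quad, star_contract h, curvVal]

theorem contract_add_left {r : Fin n → Fin n → Matrix (Fin n) (Fin n) ℂ} (X X' Z : Fin n → ℂ) :
    contract r (X + X') Z = contract r X Z + contract r X' Z := by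
  simp [contract, add_mul, add_smul, Finset.sum_add_distrib]

theorem contract_add_right {r : Fin n → Fin n → Matrix (Fin n) (Fin n) ℂ} (X Z Z' : Fin n → ℂ) :
    contract r X (Z + Z') = contract r X Z + contract r X Z' := by
  simp [contract, mul_add, add_smul, Finset.sum_add_distrib]

theorem quad_add (M N : Matrix (Fin n) (Fin n) ℂ) (Y Z : Fin n → ℂ) :
    quad (M + N) Y Z = quad M Y Z + quad N Y Z := by
  simp [quad, mul_add, Finset.sum_add_distrib]

open scoped MatrixOrder Matrix.Norms.L2Operator in
theorem exists_eq_conjTranspose_mul_self {P : Matrix (Fin n) (Fin n) ℂ} (hP : P.PosSemidef) :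
    ∃ C : Matrix (Fin n) (Fin n) ℂ, P = Cᴴ * C :=
  CStarAlgebra.nonneg_iff_eq_star_mul_self.1 hP.nonneg

/-- The trace of a positive semidefinite matrix dominates its values on unit vectors. -/
theorem quad_le_trace_mul {P : Matrix (Fin n) (Fin n) ℂ} (hP : P.PosSemidef) (y : Fin n → ℂ) :
    (star y ⬝ᵥ P *ᵥ y).re ≤ P.trace.re * ∑ i, ‖y i‖ ^ 2 := by
  obtain ⟨C, rfl⟩ := exists_eq_conjTranspose_mul_self hP
  have h1 : (star y ⬝ᵥ (Cᴴ * C) *ᵥ y).re = ∑ i, ‖(C *ᵥ y) i‖ ^ 2 := by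
    rw [← Matrix.mulVec_mulVec, Matrix.dotProduct_mulVec, ← Matrix.star_mulVec, dotProduct,
      Complex.re_sum]
    refine Finset.sum_congr rfl fun i _ => ?_
    rw [Pi.star_apply, ← Complex.normSq_eq_norm_sq, Complex.star_def, mul_comm, Complex.mul_conj,
      Complex.ofReal_re]
  have h2 : (Cᴴ * C).trace.re = ∑ i, ∑ j, ‖C i j‖ ^ 2 := by
    rw [Matrix.trace, Complex.re_sum, Finset.sum_comm]
    refine Finset.sum_congr rfl fun i _ => ?_
    rw [Matrix.diag_apply, Matrix.mul_apply, Complex.re_sum]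
    refine Finset.sum_congr rfl fun j _ => ?_
    rw [Matrix.conjTranspose_apply, ← Complex.normSq_eq_norm_sq, Complex.star_def, mul_comm,
      Complex.mul_conj, Complex.ofReal_re]
  rw [h1, h2, Finset.sum_mul]
  refine Finset.sum_le_sum fun i _ => ?_
  have h3 : ‖(C *ᵥ y) i‖ ≤ ∑ j, ‖C i j‖ * ‖y j‖ := by
    rw [Matrix.mulVec, dotProduct]
    exact (norm_sum_le _ _).trans_eq (Finset.sum_congr rfl fun j _ => norm_mul _ _)
  calc _ ≤ (∑ j, ‖C i j‖ * ‖y j‖) ^ 2 := by gcongr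
    _ ≤ _ := Finset.sum_mul_sq_le_sq_mul_sq _ _ _

variable {G : Matrix (Fin n) (Fin n) ℂ} {r : Fin n → Fin n → Matrix (Fin n) (Fin n) ℂ}

/-- If the bisectional curvature is non-positive, it dominates the Ricci curvature: the latter is a
trace of non-positive terms `R(X, X̄, Y, Ȳ)`, over an orthonormal basis of vectors `Y`. -/
theorem ricVal_mul_normSq_le (h : IsCurvatureTensor G r)
    (hr : ∀ X Y, (curvVal r X X Y).re ≤ 0) (X Y : Fin n → ℂ) :
    ricVal G r X * normSq G Y ≤ (curvVal r X X Y).re := by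
  have hquad : ∀ (M : Matrix (Fin n) (Fin n) ℂ) (y : Fin n → ℂ),
      quad M (star y) (star (star y)) = star y ⬝ᵥ M *ᵥ y := by
    intro M y; rw [star_star, quad_eq_dotProduct]
  have hreal : ∀ {M : Matrix (Fin n) (Fin n) ℂ}, M.IsHermitian → ∀ y : Fin n → ℂ,
      (star y ⬝ᵥ M *ᵥ y).im = 0 := fun hM y => hM.im_star_dotProduct_mulVec_self y
  have hG : G.PosDef := h.posDef
  set N := contract r X (star X) with hN
  -- in the frame `S⁻¹` the form `G` becomes the identity matrix
  have hNh : N.IsHermitian := star_contract h X X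
  obtain ⟨S, hS, rfl⟩ : ∃ S : Matrix (Fin n) (Fin n) ℂ, IsUnit S.det ∧ G = Sᴴ * S := by
    obtain ⟨S, hS⟩ := exists_eq_conjTranspose_mul_self hG.posSemidef
    refine ⟨S, isUnit_iff_ne_zero.2 fun h0 => hG.det_pos.ne' ?_, hS⟩
    rw [hS, Matrix.det_mul, h0, mul_zero]
  have hSH : IsUnit Sᴴ.det := by
    rw [Matrix.det_conjTranspose]; exact hS.star
  have hP : (-N).PosSemidef := by
    refine Matrix.PosSemidef.of_dotProduct_mulVec_nonneg hNh.neg fun y => ?_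
    rw [Complex.nonneg_iff]
    refine ⟨?_, (hreal hNh.neg y).symm⟩
    have := hr X (star y)
    rw [curvVal, hquad] at this
    rw [Matrix.neg_mulVec, dotProduct_neg, Complex.neg_re]
    linarith
  have hP' : ((S⁻¹)ᴴ * (-N) * S⁻¹).PosSemidef := hP.conjTranspose_mul_mul_same S⁻¹
  have key := quad_le_trace_mul hP' (S *ᵥ star Y)
  have e1 : star (S *ᵥ star Y) ⬝ᵥ ((S⁻¹)ᴴ * (-N) * S⁻¹) *ᵥ (S *ᵥ star Y) =
      -(curvVal r X X Y) := by
    rw [curvVal, quad_eq_dotProduct, Matrix.star_mulVec, star_star, ← Matrix.dotProduct_mulVec,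
      Matrix.mulVec_mulVec, Matrix.mulVec_mulVec, ← hN, ← dotProduct_neg, ← Matrix.neg_mulVec]
    congr 2
    rw [Matrix.conjTranspose_nonsing_inv]
    calc _ = (Sᴴ * Sᴴ⁻¹) * (-N) * (S⁻¹ * S) := by noncomm_ring
      _ = _ := by
        rw [Matrix.mul_nonsing_inv _ hSH, Matrix.nonsing_inv_mul _ hS, one_mul, mul_one]
  have e2 : ((S⁻¹)ᴴ * (-N) * S⁻¹).trace.re = -ricVal (Sᴴ * S) r X := by
    rw [ricVal, ← hN, Matrix.mul_inv_rev, mul_assoc, Matrix.trace_mul_comm, mul_assoc,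
      Matrix.conjTranspose_nonsing_inv, neg_mul, Matrix.trace_neg, Complex.neg_re]
  have e3 : ∑ i, ‖(S *ᵥ star Y) i‖ ^ 2 = normSq (Sᴴ * S) Y := by
    rw [normSq, quad_eq_dotProduct, ← Matrix.mulVec_mulVec, Matrix.dotProduct_mulVec,
      ← star_star Y, ← Matrix.star_mulVec, star_star, dotProduct, Complex.re_sum]
    refine Finset.sum_congr rfl fun i _ => ?_
    rw [Pi.star_apply, ← Complex.normSq_eq_norm_sq, Complex.star_def, mul_comm, Complex.mul_conj,
      Complex.ofReal_re]
  rw [e1, e2, e3, Complex.neg_re] at key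
  linarith

/-- The barrier is non-positive when the bisectional curvature is: up to `δ R(Z, Z̄, Y, Ȳ)`, which is
absorbed by `B |Z|²|Y|²`, it is `Ric(X, X̄)|Y|² + δ (s - 1) R(X, X̄, Y, Ȳ) + δ R(X + Z, X̄ + Z̄, Y, Ȳ)`,
where `δ (1 - s) ≤ 1`. -/
theorem barrierVal_nonpos (h : IsCurvatureTensor G r) (hr : ∀ X Y, (curvVal r X X Y).re ≤ 0)
    {B δ s : ℝ} (hδ : 0 ≤ δ) (hδ' : δ ≤ 1 / 2) (hs : -1 ≤ s) {X Z Y : Fin n → ℂ}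
    (hB : -(δ * (curvVal r Z Z Y).re) ≤ B * (normSq G Z * normSq G Y)) :
    barrierVal G r B δ s X Z Y ≤ 0 := by
  have h1 := ricVal_mul_normSq_le h hr X Y
  have h2 := hr X Y
  have h3 : (curvVal r X X Y).re + 2 * (curvVal r X Z Y).re + (curvVal r Z Z Y).re ≤ 0 := by
    have := hr (X + Z) Y
    have hzx : (curvVal r Z X Y).re = (curvVal r X Z Y).re := by
      rw [← star_curvVal h X Z Y]; simp
    have hsum : curvVal r (X + Z) (X + Z) Y = curvVal r X X Y + curvVal r X Z Y +
        (curvVal r Z X Y + curvVal r Z Z Y) := by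
      simp only [curvVal, star_add, contract_add_left, contract_add_right, quad_add]
      ring
    rw [hsum, Complex.add_re, Complex.add_re, Complex.add_re, hzx] at this
    linarith
  rw [barrierVal]
  nlinarith [mul_nonneg hδ (sub_nonneg.2 h3), mul_nonneg hδ (mul_nonneg (by linarith : 0 ≤ 1 + s)
    (sub_nonneg.2 h2)), mul_nonneg (by linarith : 0 ≤ 1 / 2 - δ) (sub_nonneg.2 h2)]

end Pointwise

/-! ### Estimates for the reaction terms -/

section Estimates

variable {n : ℕ}

/-- All entries of the matrix are bounded by `m`. -/
def EntryLE (M : Matrix (Fin n) (Fin n) ℂ) (m : ℝ) : Prop := ∀ k l, ‖M k l‖ ≤ m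

theorem norm_sum_sum_le {f : Fin n → Fin n → ℂ} {m : ℝ} (h : ∀ i j, ‖f i j‖ ≤ m) :
    ‖∑ i, ∑ j, f i j‖ ≤ n ^ 2 * m := by
  have h1 : ∀ i, ‖∑ j, f i j‖ ≤ n * m := fun i =>
    (norm_sum_le_of_le _ fun j _ => h i j).trans_eq (by simp)
  exact (norm_sum_le_of_le _ fun i _ => h1 i).trans_eq (by simp; ring)

theorem EntryLE.mul {M N : Matrix (Fin n) (Fin n) ℂ} {a b : ℝ} (ha : 0 ≤ a) (hM : EntryLE M a)
    (hN : EntryLE N b) : EntryLE (M * N) (n * (a * b)) := by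
  intro k l
  rw [Matrix.mul_apply]
  refine (norm_sum_le_of_le _ fun j _ => ?_).trans_eq
    (by rw [Finset.sum_const, Finset.card_univ, Fintype.card_fin, nsmul_eq_mul])
  rw [norm_mul]
  exact mul_le_mul (hM _ _) (hN _ _) (norm_nonneg _) ha

theorem EntryLE.sum_sum {F : Fin n → Fin n → Matrix (Fin n) (Fin n) ℂ} {m : ℝ}
    (h : ∀ p q, EntryLE (F p q) m) : EntryLE (∑ p, ∑ q, F p q) (n ^ 2 * m) := by
  intro k l
  simp only [Matrix.sum_apply]
  exact norm_sum_sum_le fun p q => h p q k l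

theorem EntryLE.sum_smul {F : Fin n → Matrix (Fin n) (Fin n) ℂ} {u : Fin n → ℂ} {m a : ℝ}
    (ha : 0 ≤ a) (hu : ∀ i, ‖u i‖ ≤ a) (h : ∀ p, EntryLE (F p) m) :
    EntryLE (∑ p, u p • F p) (n * (a * m)) := by
  intro k l
  simp only [Matrix.sum_apply]
  refine (norm_sum_le_of_le _ fun j _ => ?_).trans_eq
    (by rw [Finset.sum_const, Finset.card_univ, Fintype.card_fin, nsmul_eq_mul])
  rw [Matrix.smul_apply, smul_eq_mul, norm_mul]
  exact mul_le_mul (hu _) (h _ _ _) (norm_nonneg _) ha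

theorem EntryLE.norm_trace_mul_le {M N : Matrix (Fin n) (Fin n) ℂ} {a b : ℝ} (ha : 0 ≤ a)
    (hM : EntryLE M a) (hN : EntryLE N b) : ‖(M * N).trace‖ ≤ n ^ 2 * (a * b) := by
  simp only [Matrix.trace, Matrix.diag_apply, Matrix.mul_apply]
  refine norm_sum_sum_le fun p q => ?_
  rw [norm_mul]
  exact mul_le_mul (hM _ _) (hN _ _) (norm_nonneg _) ha

/-- Bounds on the metric, its inverse, its curvature, its first derivatives `dG`, `dbG`, and the
coordinates of vectors in terms of their norm, all by the same constant `C`. -/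
structure HasBounds (C : ℝ) (G : Matrix (Fin n) (Fin n) ℂ)
    (r : Fin n → Fin n → Matrix (Fin n) (Fin n) ℂ) (dG dbG : Fin n → Matrix (Fin n) (Fin n) ℂ) :
    Prop where
  form : EntryLE G C
  inv : EntryLE G⁻¹ C
  curv : ∀ i j, EntryLE (r i j) C
  d_form : ∀ p, EntryLE (dG p) C
  db_form : ∀ p, EntryLE (dbG p) C
  coord : ∀ X i, ‖X i‖ ≤ C * √(normSq G X)

variable {C : ℝ} {G : Matrix (Fin n) (Fin n) ℂ} {r : Fin n → Fin n → Matrix (Fin n) (Fin n) ℂ}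
  {dG dbG : Fin n → Matrix (Fin n) (Fin n) ℂ}

theorem IsCurvatureTensor.normSq_nonneg (h : IsCurvatureTensor G r) (X : Fin n → ℂ) :
    0 ≤ normSq G X := by
  by_cases hX : X = 0
  · simp [hX, normSq, quad]
  · exact (h.pos X hX).le

theorem EntryLE.norm_quad_le {M : Matrix (Fin n) (Fin n) ℂ} {m : ℝ} (hC : 0 ≤ C)
    (hM : EntryLE M m) (h : IsCurvatureTensor G r) (hb : HasBounds C G r dG dbG)
    (Y : Fin n → ℂ) : ‖quad M Y (star Y)‖ ≤ n ^ 2 * C ^ 2 * m * normSq G Y := by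
  rw [quad]
  refine (norm_sum_sum_le (m := C ^ 2 * normSq G Y * m) fun k l => ?_).trans_eq (by ring)
  rw [smul_eq_mul, norm_mul, norm_mul, Pi.star_apply, norm_star]
  have h1 := hb.coord Y k
  have h2 := hb.coord Y l
  have h3 := Real.mul_self_sqrt (h.normSq_nonneg Y)
  have h4 := Real.sqrt_nonneg (normSq G Y)
  calc _ ≤ (C * √(normSq G Y)) * (C * √(normSq G Y)) * m := by
        gcongr
        exact hM k l
    _ = C ^ 2 * (√(normSq G Y) * √(normSq G Y)) * m := by ring
    _ = _ := by rw [h3]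

/-- Polarization: a sesquilinear form is bounded by its values on the diagonal. -/
theorem EntryLE.of_quad {M : Matrix (Fin n) (Fin n) ℂ} {K : ℝ} (hK : 0 ≤ K)
    (hG : EntryLE G C) (hM : ∀ Y, ‖quad M Y (star Y)‖ ≤ K * normSq G Y) :
    EntryLE M (4 * C * K) := by
  intro k l
  have hq : ∀ (N : Matrix (Fin n) (Fin n) ℂ) (ε : ℂ),
      quad N (Pi.single k 1 + ε • Pi.single l 1) (star (Pi.single k 1 + ε • Pi.single l 1)) =
        N k k + star ε * N k l + ε * N l k + ε * star ε * N l l := by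
    intro N ε
    rw [quad_eq_dotProduct, star_add, star_smul, Pi.star_single, Pi.star_single, star_one]
    simp only [Matrix.mulVec_add, Matrix.mulVec_smul, Matrix.mulVec_single_one, add_dotProduct,
      smul_dotProduct, single_dotProduct, Pi.add_apply, Pi.smul_apply, smul_eq_mul, one_mul,
      Matrix.col_apply]
    ring
  have hb : ∀ ε : ℂ, ‖ε‖ = 1 →
      ‖M k k + star ε * M k l + ε * M l k + ε * star ε * M l l‖ ≤ 4 * C * K := by
    intro ε hε
    rw [← hq]
    refine (hM _).trans ?_
    rw [mul_comm (4 * C)]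
    refine mul_le_mul_of_nonneg_left ?_ hK
    rw [normSq, hq]
    refine (Complex.re_le_norm _).trans ?_
    have e1 : ‖star ε * G k l‖ ≤ C := by rw [norm_mul, norm_star, hε, one_mul]; exact hG _ _
    have e2 : ‖ε * G l k‖ ≤ C := by rw [norm_mul, hε, one_mul]; exact hG _ _
    have e3 : ‖ε * star ε * G l l‖ ≤ C := by
      rw [norm_mul, norm_mul, norm_star, hε, one_mul, one_mul]; exact hG _ _
    have e4 := norm_add_le (G k k + star ε * G k l + ε * G l k) (ε * star ε * G l l)
    have e5 := norm_add_le (G k k + star ε * G k l) (ε * G l k)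
    have e6 := norm_add_le (G k k) (star ε * G k l)
    have e7 := hG k k
    linarith
  have h1 := hb 1 (by simp)
  have h2 := hb (-1) (by simp)
  have h3 := hb Complex.I (by simp)
  have h4 := hb (-Complex.I) (by simp)
  have key : 4 * M k l = (M k k + star (1:ℂ) * M k l + 1 * M l k + 1 * star (1:ℂ) * M l l)
      - (M k k + star (-1:ℂ) * M k l + (-1) * M l k + (-1) * star (-1:ℂ) * M l l)
      + Complex.I * (M k k + star Complex.I * M k l + Complex.I * M l k
        + Complex.I * star Complex.I * M l l)
      - Complex.I * (M k k + star (-Complex.I) * M k l + (-Complex.I) * M l k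
        + (-Complex.I) * star (-Complex.I) * M l l) := by
    simp only [star_neg, star_one, Complex.star_def, Complex.conj_I]
    linear_combination (2 * M k l - 2 * M l k) * Complex.I_mul_I
  have hn : ‖4 * M k l‖ ≤ 4 * C * K + 4 * C * K + 4 * C * K + 4 * C * K := by
    rw [key]
    refine (norm_sub_le _ _).trans (add_le_add ((norm_add_le _ _).trans
      (add_le_add ((norm_sub_le _ _).trans (add_le_add h1 h2)) ?_)) ?_)
    · rw [norm_mul, Complex.norm_I, one_mul]; exact h3
    · rw [norm_mul, Complex.norm_I, one_mul]; exact h4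
  rw [norm_mul] at hn
  norm_num at hn
  linarith

theorem IsCurvatureTensor.conj_contract_single (h : IsCurvatureTensor G r) (X : Fin n → ℂ)
    (p : Fin n) : ∑ j, star X j • r p j = (∑ i, X i • r i p)ᴴ := by
  ext k l
  simp only [Matrix.sum_apply, Matrix.smul_apply, Matrix.conjTranspose_apply, star_sum,
    smul_eq_mul, star_mul', h.conj_curv, Pi.star_apply]

theorem EntryLE.conjTranspose {M : Matrix (Fin n) (Fin n) ℂ} {m : ℝ} (hM : EntryLE M m) :
    EntryLE Mᴴ m := fun k l => by
  rw [Matrix.conjTranspose_apply, norm_star]; exact hM l k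

theorem reaction_entry {u v : Fin n → ℂ} {a b b' : ℝ} (ha : 0 ≤ a) (hb0 : 0 ≤ b) (hb0' : 0 ≤ b')
    (hC : 0 ≤ C) {gi : Matrix (Fin n) (Fin n) ℂ} (hgi : EntryLE gi C)
    (hr : ∀ i j, EntryLE (r i j) C) (huv : EntryLE (contract r u v) a)
    (hu : ∀ q, EntryLE (∑ i, u i • r i q) b) (hv : ∀ p, EntryLE (∑ j, v j • r p j) b') :
    EntryLE (reaction gi r u v) (n ^ 4 * C ^ 3 * a + 2 * n ^ 4 * C ^ 2 * (b * b')) := by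
  have hn : (0 : ℝ) ≤ n := Nat.cast_nonneg n
  rw [reaction]
  have key : ∀ p q, EntryLE ((gi * contract r u v * gi) q p • r p q + gi q p •
      ((∑ j, v j • r p j) * gi * (∑ i, u i • r i q) -
        (∑ i, u i • r i q) * gi * ∑ j, v j • r p j))
      (n * (n * (C * a) * C) * C + C * (n * (n * (b' * C) * b) + n * (n * (b * C) * b'))) := by
    intro p q k l
    have h1 := (EntryLE.mul (by positivity) (hgi.mul hC huv) hgi) q p
    have h2 := (EntryLE.mul (by positivity) ((hv p).mul hb0' hgi) (hu q)) k l
    have h3 := (EntryLE.mul (by positivity) ((hu q).mul hb0 hgi) (hv p)) k l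
    rw [Matrix.add_apply, Matrix.smul_apply, Matrix.smul_apply, Matrix.sub_apply, smul_eq_mul,
      smul_eq_mul]
    refine (norm_add_le _ _).trans ?_
    rw [norm_mul, norm_mul]
    exact add_le_add (mul_le_mul h1 (hr p q k l) (norm_nonneg _) (by positivity))
      (mul_le_mul (hgi q p) ((norm_sub_le _ _).trans (add_le_add h2 h3)) (norm_nonneg _) hC)
  intro k l
  exact (EntryLE.sum_sum key k l).trans_eq (by ring)

theorem contract_eq_sum_left (X Z : Fin n → ℂ) :
    contract r X Z = ∑ q, Z q • ∑ i, X i • r i q := by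
  rw [contract, Finset.sum_comm]
  simp only [Finset.smul_sum, smul_smul, mul_comm]

/-- Bounds for the reaction terms when the curvature is small in the directions that involve `X`:
every term of `reaction` in the directions `X`, `X̄` contains either `R(X, X̄)`, which `a` bounds, or
a product of `R(X, ·)` with its conjugate, and `b` bounds `R(X, ·)`; in the mixed directions of `X` and
`Z` every term contains `R(X, ·)` or its conjugate. -/
theorem exists_reaction_bound (n : ℕ) {C : ℝ} (hC : 0 ≤ C) : ∃ c : ℝ, 0 ≤ c ∧
    ∀ {G : Matrix (Fin n) (Fin n) ℂ} {r : Fin n → Fin n → Matrix (Fin n) (Fin n) ℂ}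
      {dG dbG : Fin n → Matrix (Fin n) (Fin n) ℂ}, IsCurvatureTensor G r →
      HasBounds C G r dG dbG → ∀ (X Z Y : Fin n → ℂ) (a b : ℝ), 0 ≤ a → 0 ≤ b →
      (∀ Y', ‖curvVal r X X Y'‖ ≤ a * normSq G Y') →
      (∀ q Y', ‖quad (∑ i, X i • r i q) Y' (star Y')‖ ≤ b * normSq G Y') →
      ‖(reaction G⁻¹ r X (star X) * G⁻¹).trace‖ ≤ c * (a + b ^ 2) ∧
      ‖quad (reaction G⁻¹ r X (star X)) Y (star Y)‖ ≤ c * (a + b ^ 2) * normSq G Y ∧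
      ‖quad (reaction G⁻¹ r X (star Z)) Y (star Y)‖ ≤ c * (√(normSq G Z) * b) * normSq G Y ∧
      ‖quad (reaction G⁻¹ r Z (star X)) Y (star Y)‖ ≤ c * (√(normSq G Z) * b) * normSq G Y := by
  set c₁ : ℝ := n ^ 2 * (n ^ 4 * C ^ 3 * (4 * C) + 2 * n ^ 4 * C ^ 2 * (4 * C) ^ 2) with hc₁
  set c₂ : ℝ := n ^ 2 * (n ^ 4 * C ^ 3 * (n * (C * (4 * C)))
    + 2 * n ^ 4 * C ^ 2 * (4 * C * (n * (C * C)))) with hc₂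
  have hn : (0 : ℝ) ≤ n := Nat.cast_nonneg n
  have hc₁0 : 0 ≤ c₁ := by positivity
  have hc₂0 : 0 ≤ c₂ := by positivity
  refine ⟨c₁ * C + c₁ * C ^ 2 + c₂ * C ^ 2, by positivity, ?_⟩
  intro G r dG dbG h hb X Z Y a b ha hb0 hXX hXq
  set ζ := √(normSq G Z) with hζ
  have hζ0 : 0 ≤ ζ := Real.sqrt_nonneg _
  have hy := h.normSq_nonneg Y
  have eXX : EntryLE (contract r X (star X)) (4 * C * a) := EntryLE.of_quad ha hb.form hXX
  have eX : ∀ q, EntryLE (∑ i, X i • r i q) (4 * C * b) := fun q =>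
    EntryLE.of_quad hb0 hb.form (hXq q)
  have eX' : ∀ q, EntryLE (∑ j, star X j • r q j) (4 * C * b) := fun q => by
    rw [h.conj_contract_single]; exact (eX q).conjTranspose
  have hZ : ∀ i, ‖Z i‖ ≤ C * ζ := hb.coord Z
  have eZ : ∀ q, EntryLE (∑ i, Z i • r i q) (n * (C * ζ * C)) := fun q =>
    EntryLE.sum_smul (by positivity) hZ fun p => hb.curv p q
  have eZ' : ∀ q, EntryLE (∑ j, star Z j • r q j) (n * (C * ζ * C)) := fun q => by
    rw [h.conj_contract_single]; exact (eZ q).conjTranspose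
  have eXZ : EntryLE (contract r X (star Z)) (n * (C * ζ * (4 * C * b))) := by
    rw [contract_eq_sum_left]
    exact EntryLE.sum_smul (by positivity) (fun i => by rw [Pi.star_apply, norm_star]; exact hZ i)
      eX
  have eZX : EntryLE (contract r Z (star X)) (n * (C * ζ * (4 * C * b))) := by
    rw [← star_contract h]
    exact eXZ.conjTranspose
  have RXX := reaction_entry (by positivity) (by positivity) (by positivity) hC hb.inv hb.curv
    eXX eX eX'
  have RXZ := reaction_entry (by positivity) (by positivity) (by positivity) hC hb.inv hb.curv
    eXZ eX eZ'
  have RZX := reaction_entry (by positivity) (by positivity) (by positivity) hC hb.inv hb.curv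
    eZX eZ eX'
  have b1 : (n : ℝ) ^ 2 * (n ^ 4 * C ^ 3 * (4 * C * a) + 2 * n ^ 4 * C ^ 2 *
      (4 * C * b * (4 * C * b))) ≤ c₁ * (a + b ^ 2) := by
    have : c₁ * (a + b ^ 2) - n ^ 2 * (n ^ 4 * C ^ 3 * (4 * C * a) + 2 * n ^ 4 * C ^ 2 *
      (4 * C * b * (4 * C * b))) = n ^ 2 * (n ^ 4 * C ^ 3 * (4 * C) * b ^ 2 +
        2 * n ^ 4 * C ^ 2 * (4 * C) ^ 2 * a) := by rw [hc₁]; ring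
    have h0 : (0 : ℝ) ≤ n ^ 2 * (n ^ 4 * C ^ 3 * (4 * C) * b ^ 2 +
        2 * n ^ 4 * C ^ 2 * (4 * C) ^ 2 * a) := by positivity
    linarith
  have hab : 0 ≤ a + b ^ 2 := by positivity
  refine ⟨?_, ?_, ?_, ?_⟩
  · refine (EntryLE.norm_trace_mul_le (by positivity) RXX hb.inv).trans ?_
    calc _ = (n : ℝ) ^ 2 * (n ^ 4 * C ^ 3 * (4 * C * a) + 2 * n ^ 4 * C ^ 2 *
          (4 * C * b * (4 * C * b))) * C := by ring
      _ ≤ c₁ * (a + b ^ 2) * C := by gcongr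
      _ = c₁ * C * (a + b ^ 2) := by ring
      _ ≤ _ := by gcongr; nlinarith [mul_nonneg hc₁0 (sq_nonneg C), mul_nonneg hc₂0 (sq_nonneg C)]
  · refine (EntryLE.norm_quad_le hC RXX h hb Y).trans ?_
    calc _ = (n : ℝ) ^ 2 * (n ^ 4 * C ^ 3 * (4 * C * a) + 2 * n ^ 4 * C ^ 2 *
          (4 * C * b * (4 * C * b))) * C ^ 2 * normSq G Y := by ring
      _ ≤ c₁ * (a + b ^ 2) * C ^ 2 * normSq G Y := by gcongr
      _ = c₁ * C ^ 2 * (a + b ^ 2) * normSq G Y := by ring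
      _ ≤ _ := by gcongr; nlinarith [mul_nonneg hc₁0 hC, mul_nonneg hc₂0 (sq_nonneg C)]
  · refine (EntryLE.norm_quad_le hC RXZ h hb Y).trans ?_
    calc _ = c₂ * C ^ 2 * (ζ * b) * normSq G Y := by rw [hc₂]; ring
      _ ≤ _ := by gcongr; nlinarith [mul_nonneg hc₁0 hC, mul_nonneg hc₁0 (sq_nonneg C)]
  · refine (EntryLE.norm_quad_le hC RZX h hb Y).trans ?_
    calc _ = c₂ * C ^ 2 * (ζ * b) * normSq G Y := by rw [hc₂]; ring
      _ ≤ _ := by gcongr; nlinarith [mul_nonneg hc₁0 hC, mul_nonneg hc₁0 (sq_nonneg C)]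

/-- The heat operator applied to the squared norm of an adapted vector field with value `X`, in terms
of the form `G` and its derivatives `dG`, `dbG`: minus the squared norm of a contraction of `X` with
the torsion. -/
def torsionTerm (G : Matrix (Fin n) (Fin n) ℂ) (dG dbG : Fin n → Matrix (Fin n) (Fin n) ℂ)
    (X : Fin n → ℂ) : ℂ :=
  -∑ p, ∑ q, G⁻¹ q p *
    (((fun r => -∑ i, X i * (dG i * G⁻¹) p r) + X ᵥ* (dG p * G⁻¹)) ⬝ᵥ
      G *ᵥ ((fun s => -∑ j, star X j * (G⁻¹ * dbG j) s q) + (G⁻¹ * dbG q) *ᵥ star X))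

/-- A bound for the torsion term in the heat operator applied to `|X|²`. -/
theorem exists_torsion_bound (n : ℕ) {C : ℝ} (hC : 0 ≤ C) : ∃ c : ℝ, 0 ≤ c ∧
    ∀ {G : Matrix (Fin n) (Fin n) ℂ} {r : Fin n → Fin n → Matrix (Fin n) (Fin n) ℂ}
      {dG dbG : Fin n → Matrix (Fin n) (Fin n) ℂ}, IsCurvatureTensor G r →
      HasBounds C G r dG dbG → ∀ X : Fin n → ℂ,
      ‖torsionTerm G dG dbG X‖ ≤ c * normSq G X := by
  set m : ℝ := 2 * (n * (C * (n * (C * C)))) with hm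
  have hn : (0 : ℝ) ≤ n := Nat.cast_nonneg n
  have hm0 : 0 ≤ m := by positivity
  refine ⟨n ^ 2 * (C * (n ^ 2 * (m * m * C))), by positivity, ?_⟩
  intro G r dG dbG h hb X
  set ξ := √(normSq G X) with hξ
  have hξ0 : 0 ≤ ξ := Real.sqrt_nonneg _
  have hX : ∀ i, ‖X i‖ ≤ C * ξ := hb.coord X
  have hs : ∀ f : Fin n → ℂ, (∀ i, ‖f i‖ ≤ n * (C * C)) → ∀ x : Fin n → ℂ,
      (∀ i, ‖x i‖ ≤ C * ξ) → ‖∑ i, x i * f i‖ ≤ n * (C * ξ * (n * (C * C))) := by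
    intro f hf x hx
    refine (norm_sum_le_of_le _ fun j _ => ?_).trans_eq
      (by rw [Finset.sum_const, Finset.card_univ, Fintype.card_fin, nsmul_eq_mul])
    rw [norm_mul]
    exact mul_le_mul (hx _) (hf _) (norm_nonneg _) (by positivity)
  have hΓ : ∀ i, EntryLE (dG i * G⁻¹) (n * (C * C)) := fun i => (hb.d_form i).mul hC hb.inv
  have hΓ' : ∀ i, EntryLE (G⁻¹ * dbG i) (n * (C * C)) := fun i => hb.inv.mul hC (hb.db_form i)
  have hX' : ∀ i, ‖star X i‖ ≤ C * ξ := fun i => by rw [Pi.star_apply, norm_star]; exact hX i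
  have hu : ∀ p s, ‖((fun r => -∑ i, X i * (dG i * G⁻¹) p r) + X ᵥ* (dG p * G⁻¹)) s‖ ≤ m * ξ := by
    intro p s
    refine (norm_add_le _ _).trans ?_
    rw [norm_neg, Matrix.vecMul, dotProduct]
    exact (add_le_add (hs _ (fun i => hΓ i p s) X hX) (hs _ (fun i => hΓ p i s) X hX)).trans_eq
      (by rw [hm]; ring)
  have hv : ∀ q s, ‖((fun s => -∑ j, star X j * (G⁻¹ * dbG j) s q) +
      (G⁻¹ * dbG q) *ᵥ star X) s‖ ≤ m * ξ := by
    intro q s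
    refine (norm_add_le _ _).trans ?_
    have e : ((G⁻¹ * dbG q) *ᵥ star X) s = ∑ j, star X j * (G⁻¹ * dbG q) s j := by
      rw [Matrix.mulVec, dotProduct]
      exact Finset.sum_congr rfl fun j _ => mul_comm _ _
    rw [norm_neg, e]
    exact (add_le_add (hs _ (fun i => hΓ' i s q) _ hX') (hs _ (fun i => hΓ' q s i) _ hX')).trans_eq
      (by rw [hm]; ring)
  rw [torsionTerm, norm_neg]
  refine (norm_sum_sum_le (m := C * (n ^ 2 * (m * ξ * (m * ξ) * C))) fun p q => ?_).trans_eq ?_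
  · rw [norm_mul]
    refine mul_le_mul (hb.inv q p) ?_ (norm_nonneg _) hC
    rw [← quad_eq_dotProduct, quad]
    refine norm_sum_sum_le fun k l => ?_
    rw [smul_eq_mul, norm_mul, norm_mul]
    exact mul_le_mul (mul_le_mul (hu p k) (hv q l) (norm_nonneg _) (by positivity))
      (hb.form k l) (norm_nonneg _) (by positivity)
  · have h3 := Real.mul_self_sqrt (h.normSq_nonneg X)
    rw [← h3]
    ring

/-- Bounds for the curvature and for the barrier. The bound for the barrier does not depend on `B`,
so that `B` can be chosen before `L`. -/
theorem exists_curvature_bound (n : ℕ) {C : ℝ} (hC : 0 ≤ C) : ∃ c : ℝ, 0 ≤ c ∧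
    ∀ {G : Matrix (Fin n) (Fin n) ℂ} {r : Fin n → Fin n → Matrix (Fin n) (Fin n) ℂ}
      {dG dbG : Fin n → Matrix (Fin n) (Fin n) ℂ}, IsCurvatureTensor G r →
      HasBounds C G r dG dbG → ∀ X Z Y : Fin n → ℂ,
      ‖curvVal r Z Z Y‖ ≤ c * (normSq G Z * normSq G Y) ∧
      ∀ B δ s : ℝ, 0 ≤ B → 0 ≤ δ → δ ≤ 1 → -1 ≤ s → s ≤ 1 →
        barrierVal G r B δ s X Z Y ≤ c * ((normSq G X + normSq G Z) * normSq G Y) := by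
  have hn : (0 : ℝ) ≤ n := Nat.cast_nonneg n
  set m : ℝ := n * (C * (n * (C * C))) with hm
  have hm0 : 0 ≤ m := by positivity
  set c₁ : ℝ := n ^ 2 * (m * C) with hc₁
  set c₂ : ℝ := n ^ 2 * C ^ 2 * m with hc₂
  have hc₁0 : 0 ≤ c₁ := by positivity
  have hc₂0 : 0 ≤ c₂ := by positivity
  refine ⟨c₁ + 2 * c₂, by positivity, ?_⟩
  intro G r dG dbG h hb X Z Y
  have hx := h.normSq_nonneg X
  have hz := h.normSq_nonneg Z
  have hy := h.normSq_nonneg Y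
  have hcon : ∀ X Z : Fin n → ℂ, EntryLE (contract r X (star Z))
      (m * (√(normSq G X) * √(normSq G Z))) := by
    intro X Z
    have := Real.sqrt_nonneg (normSq G X)
    have := Real.sqrt_nonneg (normSq G Z)
    rw [contract_eq_sum_left]
    have h1 := EntryLE.sum_smul (a := C * √(normSq G Z)) (by positivity)
      (fun i => by rw [Pi.star_apply, norm_star]; exact hb.coord Z i)
      (fun q => EntryLE.sum_smul (by positivity) (hb.coord X) fun p => hb.curv p q)
      (u := star Z)
    intro k l
    exact (h1 k l).trans_eq (by rw [hm]; ring)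
  have hval : ∀ X Z : Fin n → ℂ,
      ‖curvVal r X Z Y‖ ≤ c₂ * (√(normSq G X) * √(normSq G Z)) * normSq G Y := by
    intro X Z
    refine ((hcon X Z).norm_quad_le hC h hb Y).trans_eq ?_
    rw [hc₂]; ring
  have hdiag : ∀ X, ‖curvVal r X X Y‖ ≤ c₂ * (normSq G X * normSq G Y) := by
    intro X
    refine (hval X X).trans_eq ?_
    rw [Real.mul_self_sqrt (h.normSq_nonneg X), mul_assoc]
  refine ⟨(hdiag Z).trans ?_, ?_⟩
  · gcongr
    linarith
  intro B δ s hB hδ hδ1 hs hs1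
  have hric : ricVal G r X ≤ c₁ * normSq G X := by
    refine (Complex.re_le_norm _).trans
      ((EntryLE.norm_trace_mul_le (by positivity) (hcon X X) hb.inv).trans_eq ?_)
    rw [Real.mul_self_sqrt hx, hc₁]; ring
  have h1 : |(curvVal r X X Y).re| ≤ c₂ * (normSq G X * normSq G Y) :=
    (Complex.abs_re_le_norm _).trans (hdiag X)
  have h2 : |(curvVal r X Z Y).re| ≤ c₂ * ((normSq G X + normSq G Z) / 2) * normSq G Y := by
    refine (Complex.abs_re_le_norm _).trans ((hval X Z).trans ?_)
    have := sq_nonneg (√(normSq G X) - √(normSq G Z))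
    have e1 := Real.sq_sqrt hx
    have e2 := Real.sq_sqrt hz
    gcongr
    nlinarith
  have h3 : s * (curvVal r X X Y).re ≤ c₂ * (normSq G X * normSq G Y) := by
    refine (le_abs_self _).trans ?_
    rw [abs_mul]
    have : |s| ≤ 1 := abs_le.2 ⟨hs, hs1⟩
    exact (mul_le_of_le_one_left (abs_nonneg _) this).trans h1
  have h4 : δ * (s * (curvVal r X X Y).re + 2 * (curvVal r X Z Y).re) ≤
      2 * c₂ * ((normSq G X + normSq G Z) * normSq G Y) := by
    have h5 : s * (curvVal r X X Y).re + 2 * (curvVal r X Z Y).re ≤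
        2 * c₂ * ((normSq G X + normSq G Z) * normSq G Y) := by
      have := le_of_abs_le h2
      nlinarith [mul_nonneg hc₂0 (mul_nonneg hz hy)]
    have h6 : 0 ≤ 2 * c₂ * ((normSq G X + normSq G Z) * normSq G Y) := by positivity
    nlinarith
  have h7 := mul_le_mul_of_nonneg_right hric hy
  have h8 : 0 ≤ B * (normSq G Z * normSq G Y) := by positivity
  have h9 : 0 ≤ c₁ * (normSq G Z * normSq G Y) := by positivity
  rw [barrierVal]
  nlinarith

/-- If the barrier with first argument `X` is bounded by `w` times the norms for all values of the
other arguments, then the defect `w|X|² - Ric(X, X̄)` controls all the curvature components that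
involve `X`. The parameter `s` takes both signs, which gives a two-sided bound on `R(X, X̄, Y, Ȳ)`,
and the discriminant of a quadratic polynomial in `Z` bounds `R(X, Z̄, Y, Ȳ)`. -/
theorem curvature_bound_of_max (h : IsCurvatureTensor G r) (hG : EntryLE G C)
    {B δ w : ℝ} (hB : 0 ≤ B) (hw : 0 ≤ w) (hδ : 1 / 4 ≤ δ) {X Y : Fin n → ℂ} (hY : Y ≠ 0)
    (hmax : ∀ s, -1 ≤ s → s ≤ 1 → ∀ Z Y, barrierVal G r B δ s X Z Y ≤
      w * ((normSq G X + normSq G Z) * normSq G Y)) :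
    0 ≤ w * normSq G X - ricVal G r X ∧
    (∀ Y', ‖curvVal r X X Y'‖ ≤ 4 * (w * normSq G X - ricVal G r X) * normSq G Y') ∧
    ∀ q Y', ‖quad (∑ i, X i • r i q) Y' (star Y')‖ ≤
      4 * √((w * normSq G X - ricVal G r X) * ((w + B) * C)) * normSq G Y' := by
  have n0 : normSq G 0 = 0 := by simp [normSq, quad]
  have c0 : ∀ Y, curvVal r X 0 Y = 0 := by
    intro Y; simp [curvVal, contract, quad]
  have hbase : 0 ≤ w * normSq G X - ricVal G r X := by
    have h1 := hmax 0 (by norm_num) (by norm_num) 0 Y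
    rw [barrierVal, n0, c0] at h1
    simp only [zero_mul, Complex.zero_re, mul_zero, add_zero, sub_zero] at h1
    have := h.pos Y hY
    nlinarith
  set a := w * normSq G X - ricVal G r X with ha
  refine ⟨hbase, fun Y' => ?_, fun q Y' => ?_⟩
  · have h1 := hmax 1 (by norm_num) (by norm_num) 0 Y'
    have h2 := hmax (-1) (by norm_num) (by norm_num) 0 Y'
    rw [barrierVal, n0, c0] at h1 h2
    simp only [one_mul, zero_mul, Complex.zero_re, mul_zero, add_zero, sub_zero] at h1 h2
    have him : (curvVal r X X Y').im = 0 := by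
      have := congrArg Complex.im (star_curvVal h X X Y')
      simp only [Complex.star_def, Complex.conj_im] at this
      linarith
    have hre : ‖curvVal r X X Y'‖ = |(curvVal r X X Y').re| := by
      rw [← Complex.re_add_im (curvVal r X X Y'), him]
      simp
    have hy := h.normSq_nonneg Y'
    have h3 : |(curvVal r X X Y').re| * δ ≤ a * normSq G Y' := by
      rcases abs_cases (curvVal r X X Y').re with ⟨e, -⟩ | ⟨e, -⟩ <;> rw [e, ha] <;> nlinarith
    rw [hre]
    nlinarith [abs_nonneg (curvVal r X X Y').re]
  · set ρ := quad (∑ i, X i • r i q) Y' (star Y') with hρ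
    have hy := h.normSq_nonneg Y'
    have hC : 0 ≤ C := (norm_nonneg _).trans (hG q q)
    obtain ⟨u, hu, hu'⟩ : ∃ u : ℂ, ‖u‖ = 1 ∧ star u * ρ = ‖ρ‖ := by
      by_cases h0 : ρ = 0
      · exact ⟨1, by simp, by simp [h0]⟩
      · refine ⟨ρ / ‖ρ‖, by simp [h0], ?_⟩
        have hn : (‖ρ‖ : ℂ) ≠ 0 := by simpa using h0
        rw [star_div₀, Complex.star_def, Complex.conj_ofReal, div_mul_eq_mul_div,
          mul_comm, Complex.mul_conj, Complex.normSq_eq_norm_sq, div_eq_iff hn]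
        push_cast
        ring
    -- the barrier at `Z = t u ∂_q`, where the phase `u` makes `R(X, Z̄, Y, Ȳ)` real
    have hquad : ∀ t : ℝ, 0 ≤ ((w + B) * C * normSq G Y') * (t * t) + (-(2 * δ * ‖ρ‖)) * t
        + a * normSq G Y' := by
      intro t
      have h1 := hmax 0 (by norm_num) (by norm_num) (Pi.single q (t * u)) Y'
      have hZ : normSq G (Pi.single q (t * u)) = t * t * (G q q).re := by
        rw [normSq, quad_eq_dotProduct, Pi.star_single, single_dotProduct, Matrix.mulVec_single]
        simp only [Pi.smul_apply, Matrix.col_apply, MulOpposite.smul_eq_mul_unop,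
          MulOpposite.unop_op]
        have : (t : ℂ) * u * (G q q * star (t * u)) = ((t * t * ‖u‖ ^ 2 : ℝ) : ℂ) * G q q := by
          have hh : u * star u = ((‖u‖ ^ 2 : ℝ) : ℂ) := by
            rw [Complex.star_def, Complex.mul_conj, Complex.normSq_eq_norm_sq]
          rw [star_mul', Complex.star_def, Complex.conj_ofReal]
          rw [Complex.star_def] at hh
          push_cast at hh ⊢
          linear_combination (t : ℂ) * t * G q q * hh
        rw [this, Complex.re_ofReal_mul, hu]
        ring
      have hR : (curvVal r X (Pi.single q (t * u)) Y').re = t * ‖ρ‖ := by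
        have : curvVal r X (Pi.single q (t * u)) Y' = ((t * ‖ρ‖ : ℝ) : ℂ) := by
          rw [curvVal, contract_eq_sum_left, Pi.star_single, Finset.sum_eq_single q, Pi.single_eq_same]
          · have : quad (star (t * u) • ∑ i, X i • r i q) Y' (star Y') = star (t * u) * ρ := by
              rw [hρ, quad, quad, Finset.mul_sum]
              refine Finset.sum_congr rfl fun k _ => ?_
              rw [Finset.mul_sum]
              refine Finset.sum_congr rfl fun l _ => ?_
              rw [Matrix.smul_apply, smul_eq_mul, smul_eq_mul, smul_eq_mul]
              ring
            rw [this, star_mul', mul_assoc, hu', Complex.star_def, Complex.conj_ofReal]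
            push_cast
            ring
          · intro b _ hbq
            rw [Pi.single_eq_of_ne hbq, zero_smul]
          · simp
        rw [this, Complex.ofReal_re]
      rw [barrierVal, hZ, hR] at h1
      have hg : (G q q).re ≤ C := (Complex.re_le_norm _).trans (hG q q)
      have h2 : (w + B) * (t * t * (G q q).re) * normSq G Y' ≤
          (w + B) * (t * t * C) * normSq G Y' := by
        have := mul_self_nonneg t
        gcongr
      rw [ha]
      nlinarith
    have hd := discrim_le_zero hquad
    rw [discrim] at hd
    have hD : 0 ≤ a * ((w + B) * C) := by positivity
    have h3 : (‖ρ‖) ^ 2 ≤ (4 * √(a * ((w + B) * C)) * normSq G Y') ^ 2 := by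
      rw [mul_pow, mul_pow, Real.sq_sqrt hD]
      have h4 : (δ * ‖ρ‖) ^ 2 ≤ a * ((w + B) * C) * normSq G Y' ^ 2 := by nlinarith
      have h5 : (1 / 4 * ‖ρ‖) ^ 2 ≤ (δ * ‖ρ‖) ^ 2 := by
        gcongr
      nlinarith
    exact (pow_le_pow_iff_left₀ (norm_nonneg _) (by positivity) two_ne_zero).1 h3

/-- The numerical inequality behind the choice of the constants. Here `x`, `z`, `y` are the squared
norms of `X`, `Z`, `Y`, and `a` is the defect `w|X|² - Ric(X, X̄)`. The quadratic reaction terms are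
bounded by multiples of `a` and `z`, the torsion terms by multiples of `z` and `w (x + z)`. By `hQ`
the decay of `δ` contributes `-L (a + (w + B) z) y`, which absorbs the multiples of `a` and `z`, and
the growth of the multiple `w` contributes `-K w (x + z) y`, which absorbs the rest. -/
theorem reaction_sum_neg {c C B L K a w x z y t q₁ q₂ q₃ hX hZ s δ Q Λ : ℝ} (hc : 0 ≤ c)
    (hC : 0 ≤ C) (hB : 1 ≤ B) (ha : 0 ≤ a) (hw : 0 < w) (hwΛ : w ≤ Λ) (hz : 0 ≤ z)
    (hxz : 0 < x + z) (hy : 0 < y) (hs : |s| ≤ 1) (hδ : 0 ≤ δ) (hδ' : δ ≤ 1 / 2)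
    (hK : K = c + 1) (hL : L = c * (6 + 32 * ((Λ + B) * C)) + 2 * c)
    (ht : |t| ≤ c * (4 * a + (4 * √(a * ((w + B) * C))) ^ 2))
    (h₁ : |q₁| ≤ c * (4 * a + (4 * √(a * ((w + B) * C))) ^ 2) * y)
    (h₂ : |q₂| ≤ c * (√z * (4 * √(a * ((w + B) * C)))) * y)
    (h₃ : |q₃| ≤ c * (√z * (4 * √(a * ((w + B) * C)))) * y)
    (hhX : |hX| ≤ c * x) (hhZ : |hZ| ≤ c * z) (hQ : δ * Q = (a + (w + B) * z) * y) :
    t * y + -(L * δ) * Q + δ * (s * q₁ + q₂ + q₃) - B * (hZ * y) - K * w * ((x + z) * y)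
      - w * ((hX + hZ) * y) < 0 := by
  have hD : 0 ≤ a * ((w + B) * C) := by positivity
  set b := 4 * √(a * ((w + B) * C)) with hb
  have hb2 : b ^ 2 = 16 * (a * ((w + B) * C)) := by rw [hb, mul_pow, Real.sq_sqrt hD]; norm_num
  have hb2' : b ^ 2 ≤ 16 * (a * ((Λ + B) * C)) := by
    rw [hb2]; gcongr
  have hzb : √z * b ≤ (z + b ^ 2) / 2 := by
    nlinarith [sq_nonneg (√z - b), Real.sq_sqrt hz]
  have e1 : t * y ≤ c * (4 * a + b ^ 2) * y := by
    have := (le_abs_self t).trans ht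
    gcongr
  have e2 : s * q₁ ≤ c * (4 * a + b ^ 2) * y := by
    refine (le_abs_self _).trans ?_
    rw [abs_mul]
    exact (mul_le_of_le_one_left (abs_nonneg _) hs).trans h₁
  have e3 : q₂ ≤ c * ((z + b ^ 2) / 2) * y :=
    (le_abs_self _).trans (h₂.trans (by gcongr))
  have e4 : q₃ ≤ c * ((z + b ^ 2) / 2) * y :=
    (le_abs_self _).trans (h₃.trans (by gcongr))
  have e5 : δ * (s * q₁ + q₂ + q₃) ≤
      1 / 2 * (c * (4 * a + b ^ 2) * y + 2 * (c * ((z + b ^ 2) / 2) * y)) := by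
    have p : 0 ≤ c * (4 * a + b ^ 2) * y + 2 * (c * ((z + b ^ 2) / 2) * y) := by positivity
    exact (mul_le_mul_of_nonneg_left (by linarith) hδ).trans (mul_le_mul_of_nonneg_right hδ' p)
  have e6 : -(B * (hZ * y)) ≤ B * (c * z * y) := by
    have : -hZ ≤ c * z := (neg_le_abs _).trans hhZ
    calc _ = B * (-hZ * y) := by ring
      _ ≤ _ := by gcongr
  have e7 : -(w * ((hX + hZ) * y)) ≤ w * (c * (x + z) * y) := by
    have h1 : -hZ ≤ c * z := (neg_le_abs _).trans hhZ
    have h2 : -hX ≤ c * x := (neg_le_abs _).trans hhX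
    calc _ = w * ((-hZ + -hX) * y) := by ring
      _ ≤ w * ((c * z + c * x) * y) := by gcongr
      _ = _ := by ring
  have e8 : -(L * δ) * Q = -L * (a + (w + B) * z) * y := by linear_combination -L * hQ
  have hL0 : 0 ≤ L := by
    have hΛ : 0 ≤ Λ := hw.le.trans hwΛ
    rw [hL]; positivity
  have hpos : 0 < w * (x + z) * y := by positivity
  have e9 : c * (4 * a + b ^ 2) + 1 / 2 * (c * (4 * a + b ^ 2) + 2 * (c * ((z + b ^ 2) / 2)))
      + B * (c * z) ≤ L * (a + (w + B) * z) := by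
    have f1 : L * (a + (w + B) * z) ≥ L * a + (2 * c) * (B * z) := by
      have g1 : 2 * c ≤ L := by
        have hΛ : 0 ≤ Λ := hw.le.trans hwΛ
        rw [hL]
        have : 0 ≤ c * (6 + 32 * ((Λ + B) * C)) := by positivity
        linarith
      have g2 : 0 ≤ L * (w * z) := by positivity
      have g3 : (2 * c) * (B * z) ≤ L * (B * z) := by gcongr
      linarith
    have f2 : L * a ≥ c * (6 * a) + c * (2 * b ^ 2) := by
      have : c * (2 * b ^ 2) ≤ c * (2 * (16 * (a * ((Λ + B) * C)))) := by gcongr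
      have g1 := mul_nonneg hc ha
      rw [hL]
      linarith
    have f3 : c * z ≤ c * (B * z) := by
      gcongr
      exact le_mul_of_one_le_left hz hB
    linarith [mul_nonneg hc hz]
  have e10 := mul_le_mul_of_nonneg_right e9 hy.le
  rw [e8, hK]
  linarith

/-- The reaction terms that appear when the heat operator is applied to the barrier at a maximum
point have negative sum, if the constants are chosen appropriately. -/
theorem exists_barrier_constants (n : ℕ) {C : ℝ} (hC : 0 ≤ C) : ∃ B L K : ℝ, 0 ≤ B ∧ 0 ≤ L ∧
    ∀ {G : Matrix (Fin n) (Fin n) ℂ} {r : Fin n → Fin n → Matrix (Fin n) (Fin n) ℂ}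
      {dG dbG : Fin n → Matrix (Fin n) (Fin n) ℂ}, IsCurvatureTensor G r →
      HasBounds C G r dG dbG → ∀ X Z Y : Fin n → ℂ,
      (∀ δ, 0 ≤ δ → δ ≤ 1 → -(δ * (curvVal r Z Z Y).re) ≤ B * (normSq G Z * normSq G Y)) ∧
      ∀ s δ w : ℝ, Y ≠ 0 → 0 < normSq G X + normSq G Z → -1 ≤ s → s ≤ 1 → 1 / 4 ≤ δ →
        δ ≤ 1 / 2 → 0 < w →
        (∀ s, -1 ≤ s → s ≤ 1 → ∀ Z Y, barrierVal G r B δ s X Z Y ≤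
          w * ((normSq G X + normSq G Z) * normSq G Y)) →
        barrierVal G r B δ s X Z Y = w * ((normSq G X + normSq G Z) * normSq G Y) →
        ((reaction G⁻¹ r X (star X) * G⁻¹).trace * (normSq G Y : ℂ)
          + ((-(L * δ) : ℝ) : ℂ) * ((s : ℂ) * curvVal r X X Y + curvVal r X Z Y + curvVal r Z X Y)
          + (δ : ℂ) * ((s : ℂ) * quad (reaction G⁻¹ r X (star X)) Y (star Y)
            + quad (reaction G⁻¹ r X (star Z)) Y (star Y)
            + quad (reaction G⁻¹ r Z (star X)) Y (star Y))
          - (B : ℂ) * (torsionTerm G dG dbG Z * (normSq G Y : ℂ))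
          - ((K * w : ℝ) : ℂ) * (((normSq G X : ℂ) + (normSq G Z : ℂ)) * (normSq G Y : ℂ))
          - (w : ℂ) * ((torsionTerm G dG dbG X + torsionTerm G dG dbG Z) *
              (normSq G Y : ℂ))).re < 0 := by
  obtain ⟨c₁, hc₁, H₁⟩ := exists_reaction_bound n hC
  obtain ⟨c₂, hc₂, H₂⟩ := exists_torsion_bound n hC
  obtain ⟨c₃, hc₃, H₃⟩ := exists_curvature_bound n hC
  set c := c₁ + c₂ with hc
  have hc0 : 0 ≤ c := by positivity
  refine ⟨c₃ + 1, c * (6 + 32 * ((c₃ + (c₃ + 1)) * C)) + 2 * c, c + 1, by positivity, by positivity,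
    ?_⟩
  intro G r dG dbG h hb X Z Y
  have hx := h.normSq_nonneg X
  have hz := h.normSq_nonneg Z
  have hy := h.normSq_nonneg Y
  refine ⟨fun δ hδ hδ1 => ?_, ?_⟩
  · have h1 : -(curvVal r Z Z Y).re ≤ c₃ * (normSq G Z * normSq G Y) :=
      (neg_le_abs _).trans ((Complex.abs_re_le_norm _).trans (H₃ h hb X Z Y).1)
    have h2 : 0 ≤ c₃ * (normSq G Z * normSq G Y) := by positivity
    have h3 : 0 ≤ normSq G Z * normSq G Y := by positivity
    nlinarith
  intro s δ w hY hxz hs hs' hδ hδ' hw hmax heq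
  have hyp : 0 < normSq G Y := h.pos Y hY
  obtain ⟨ha, hXX, hXq⟩ := curvature_bound_of_max h hb.form (by positivity) hw.le hδ hY hmax
  have hb0 : 0 ≤ 4 * √((w * normSq G X - ricVal G r X) * ((w + (c₃ + 1)) * C)) := by positivity
  obtain ⟨r1, r2, r3, r4⟩ := H₁ h hb X Z Y _ _ (by positivity) hb0 hXX hXq
  have hwΛ : w ≤ c₃ := by
    have := (H₃ h hb X Z Y).2 (c₃ + 1) δ s (by positivity) (by linarith) (by linarith) hs hs'
    rw [heq] at this
    exact le_of_mul_le_mul_right this (by positivity)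
  have hle : c₁ ≤ c := by rw [hc]; linarith
  have hle' : c₂ ≤ c := by rw [hc]; linarith
  have hZX : (curvVal r Z X Y).re = (curvVal r X Z Y).re := by
    rw [← star_curvVal h X Z Y]; simp
  have key := reaction_sum_neg (s := s) (K := c + 1) (Q := s * (curvVal r X X Y).re +
      (curvVal r X Z Y).re + (curvVal r Z X Y).re) hc0 hC (by linarith : 1 ≤ c₃ + 1) ha hw hwΛ
    hz hxz hyp (abs_le.2 ⟨hs, hs'⟩) (by linarith) hδ' rfl rfl
    ((Complex.abs_re_le_norm _).trans (r1.trans (by gcongr)))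
    ((Complex.abs_re_le_norm _).trans (r2.trans (by gcongr)))
    ((Complex.abs_re_le_norm _).trans (r3.trans (by gcongr)))
    ((Complex.abs_re_le_norm _).trans (r4.trans (by gcongr)))
    ((Complex.abs_re_le_norm _).trans ((H₂ h hb X).trans (by gcongr)))
    ((Complex.abs_re_le_norm _).trans ((H₂ h hb Z).trans (by gcongr)))
    (by rw [barrierVal] at heq; rw [hZX]; linear_combination heq)
  refine lt_of_eq_of_lt ?_ key
  simp only [Complex.add_re, Complex.sub_re, Complex.re_mul_ofReal, Complex.re_ofReal_mul,
    ← Complex.ofReal_add, ← Complex.ofReal_mul, Complex.ofReal_re]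

end Estimates

/-! ### The maximum principle for the heat operator -/

section MaximumPrinciple

open smoothFun

theorem second_deriv_nonpos_of_isLocalMax {g : ℝ → ℝ} {a : ℝ} (h : IsLocalMax g a)
    (hc : ContinuousAt g a) : deriv (deriv g) a ≤ 0 := by
  by_contra! hpos
  have hmin := isLocalMin_of_deriv_deriv_pos hpos h.deriv_eq_zero hc
  have hconst : g =ᶠ[nhds a] fun _ => g a := by
    filter_upwards [h, hmin] with x h1 h2 using le_antisymm h1 h2
  have h1 := hconst.deriv.deriv_eq
  simp at h1
  exact hpos.ne' h1

variable {n : ℕ} {T : ℝ} {U : Set (Cn n)}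

theorem sum_wd_add_sum_wdb {E : Type*} [NormedAddCommGroup E] [NormedSpace ℝ E] {V : Set E}
    (hV : IsRegular V) (ι : Cn n →L[ℝ] E) (v : Cn n) (f : smoothFun V) :
    (∑ a, v a • wd hV ι a f) + ∑ a, conj (v a) • wdb hV ι a f = der hV (ι v) 0 f := by
  ext x
  rw [ev_der, map_zero, mul_zero, add_zero, map_add, map_sum, map_sum]
  simp only [map_smul, smul_eq_mul, ev_wd, ev_wdb, ← Finset.sum_add_distrib]
  exact (real_linear_eq_sum ((diff f x).comp ι) v).symm

/-- The operator `∑ vᵖ v̄^q ∂_p ∂_q̄` is a quarter of the Laplacian of the complex line spanned by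
`v`. -/
theorem sum_wd_wdb {E : Type*} [NormedAddCommGroup E] [NormedSpace ℝ E] {V : Set E}
    (hV : IsRegular V) (ι : Cn n →L[ℝ] E) (v : Cn n) (f : smoothFun V) :
    (4 : ℂ) • ∑ p, ∑ q, (v p * conj (v q)) • wd hV ι p (wdb hV ι q f) =
      der hV (ι v) 0 (der hV (ι v) 0 f)
        + der hV (ι (Complex.I • v)) 0 (der hV (ι (Complex.I • v)) 0 f) := by
  set A : smoothFun V →ₗ[ℂ] smoothFun V :=
    ∑ a, v a • (wd hV ι a : smoothFun V →ₗ[ℂ] smoothFun V) with hA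
  set B : smoothFun V →ₗ[ℂ] smoothFun V :=
    ∑ a, conj (v a) • (wdb hV ι a : smoothFun V →ₗ[ℂ] smoothFun V) with hB
  have hAf : ∀ f, A f = ∑ a, v a • wd hV ι a f := fun f => by simp [hA, LinearMap.sum_apply]
  have hBf : ∀ f, B f = ∑ a, conj (v a) • wdb hV ι a f := fun f => by
    simp [hB, LinearMap.sum_apply]
  have hAB : ∀ f, A (B f) = ∑ p, ∑ q, (v p * conj (v q)) • wd hV ι p (wdb hV ι q f) := by
    intro f
    rw [hAf, hBf]
    simp only [map_sum, Derivation.map_smul, Finset.smul_sum, smul_smul]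
  have hBA : ∀ f, B (A f) = A (B f) := by
    intro f
    rw [hAB, hBf, hAf, Finset.sum_comm]
    simp only [map_sum, Derivation.map_smul, Finset.smul_sum, smul_smul,
      (commuting_wd hV ι 0 0).d_db, mul_comm]
  have h1 : ∀ f, der hV (ι v) 0 f = A f + B f := fun f => by
    rw [← sum_wd_add_sum_wdb, hAf, hBf]
  have h2 : ∀ f, der hV (ι (Complex.I • v)) 0 f = Complex.I • (A f - B f) := fun f => by
    rw [← sum_wd_add_sum_wdb, hAf, hBf, smul_sub, Finset.smul_sum, Finset.smul_sum, sub_eq_add_neg,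
      ← Finset.sum_neg_distrib]
    congr 1
    · exact Finset.sum_congr rfl fun a _ => by rw [smul_smul]; rfl
    · refine Finset.sum_congr rfl fun a _ => ?_
      rw [smul_smul, ← neg_smul]
      congr 1
      simp
  rw [h1, h1, h2, h2, ← hAB]
  simp only [map_add, map_sub, map_smul, hBA, smul_smul, smul_sub, Complex.I_mul_I]
  module

/-- The second derivative test in a spatial direction. -/
theorem re_ev_der_der_nonpos (hT : 0 < T) (hU : IsOpen U)
    {f : smoothFun (Set.Icc 0 T ×ˢ U)} {x : (Set.Icc 0 T ×ˢ U : Set (ℝ × Cn n))}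
    (hf : ∀ y : (Set.Icc 0 T ×ˢ U : Set (ℝ × Cn n)), y.1.1 ≤ x.1.1 → (ev y f).re ≤ 0)
    (h0 : (ev x f).re = 0) (v : Cn n) :
    (ev x (der (.Icc_prod hT hU) (0, v) 0 (der (.Icc_prod hT hU) (0, v) 0 f))).re ≤ 0 := by
  set hV := IsRegular.Icc_prod hT hU
  obtain ⟨⟨t, z⟩, ht, hz⟩ := x
  set L : ℝ → Cn n := fun s => z + s • v with hL
  have hLc : Continuous L := by fun_prop
  have hLU : ∀ᶠ s in nhds (0 : ℝ), L s ∈ U :=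
    hLc.continuousAt.eventually_mem (hU.mem_nhds (by simpa [hL] using hz))
  have hLU' : ∀ᶠ s in nhds (0 : ℝ), ∀ᶠ s' in nhds s, L s' ∈ U := hLU.eventually_nhds
  -- the derivative of a smooth function along the line through the point
  have hder : ∀ (f : smoothFun (Set.Icc 0 T ×ˢ U)) (s : ℝ) (hs : L s ∈ U),
      HasDerivAt (fun s => (extZero f.1 (t, L s)).re)
        (ev (V := Set.Icc 0 T ×ˢ U) ⟨(t, L s), ht, hs⟩ (der hV (0, v) 0 f)).re s := by
    intro f s hs
    have h1 : HasDerivAt (fun s => (t, L s)) (0, v) s := by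
      refine (hasDerivAt_const s t).prodMk ?_
      simpa [hL] using ((hasDerivAt_id s).smul_const v).const_add z
    have h2 := (hasFDerivWithinAt f ⟨(t, L s), ht, hs⟩).comp_hasDerivAt_of_eq s h1
      (by filter_upwards [hLc.continuousAt.eventually_mem (hU.mem_nhds hs)] with s' hs'
            using ⟨ht, hs'⟩) rfl
    have h3 := Complex.reCLM.hasFDerivAt.comp_hasDerivAt s h2
    rw [ev_der, map_zero, mul_zero, add_zero]
    exact h3
  have hL0 : L 0 = z := by simp [hL]
  have hev : ∀ (f : smoothFun (Set.Icc 0 T ×ˢ U)) (s : ℝ) (hs : L s ∈ U),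
      extZero f.1 (t, L s) = ev (V := Set.Icc 0 T ×ˢ U) ⟨(t, L s), ht, hs⟩ f := fun f s hs =>
    extZero_apply _ _
  have hz0 : L 0 ∈ U := by rw [hL0]; exact hz
  have hmax : IsLocalMax (fun s => (extZero f.1 (t, L s)).re) 0 := by
    filter_upwards [hLU] with s hs
    rw [hev f s hs, hev f 0 hz0]
    refine (hf ⟨(t, L s), ht, hs⟩ le_rfl).trans (le_of_eq ?_)
    simp only [hL0]
    exact h0.symm
  have hd1 : deriv (fun s => (extZero f.1 (t, L s)).re) =ᶠ[nhds 0]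
      fun s => (extZero (der hV (0, v) 0 f).1 (t, L s)).re := by
    filter_upwards [hLU] with s hs
    rw [(hder f s hs).deriv, hev _ s hs]
  have key := second_deriv_nonpos_of_isLocalMax hmax (hder f 0 hz0).continuousAt
  rw [hd1.deriv_eq, (hder _ 0 hz0).deriv] at key
  simpa only [hL0] using key

/-- The derivative in time at a maximum over earlier times. -/
theorem re_ev_der_time_nonneg (hT : 0 < T) (hU : IsOpen U)
    {f : smoothFun (Set.Icc 0 T ×ˢ U)} {x : (Set.Icc 0 T ×ˢ U : Set (ℝ × Cn n))}
    (hx : 0 < x.1.1)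
    (hf : ∀ y : (Set.Icc 0 T ×ˢ U : Set (ℝ × Cn n)), y.1.1 ≤ x.1.1 → (ev y f).re ≤ 0)
    (h0 : (ev x f).re = 0) :
    0 ≤ (ev x (der (.Icc_prod hT hU) (1, 0) 0 f)).re := by
  obtain ⟨⟨t, z⟩, ht, hz⟩ := x
  have hsub : segment ℝ (t, z) (0, z) ⊆ Set.Icc 0 t ×ˢ {z} := by
    refine (convex_Icc 0 t |>.prod (convex_singleton z)).segment_subset ?_ ?_
    · exact ⟨⟨ht.1, le_rfl⟩, rfl⟩
    · exact ⟨⟨le_rfl, ht.1⟩, rfl⟩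
  have hsub' : Set.Icc 0 t ×ˢ {z} ⊆ Set.Icc 0 T ×ˢ U := by
    rintro ⟨s, y⟩ ⟨hs, hy⟩
    have hy' : y = z := hy
    exact ⟨⟨hs.1, hs.2.trans ht.2⟩, hy' ▸ hz⟩
  have hd : HasFDerivWithinAt (fun y => (extZero f.1 y).re)
      (Complex.reCLM.comp (diff f ⟨(t, z), ht, hz⟩)) (Set.Icc 0 t ×ˢ {z}) (t, z) :=
    Complex.reCLM.hasFDerivAt.comp_hasFDerivWithinAt _
      ((hasFDerivWithinAt f ⟨(t, z), ht, hz⟩).mono hsub')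
  have hmax : IsLocalMaxOn (fun y => (extZero f.1 y).re) (Set.Icc 0 t ×ˢ {z}) (t, z) := by
    filter_upwards [self_mem_nhdsWithin] with y hy
    rw [extZero_apply (V := Set.Icc 0 T ×ˢ U) _ (hsub' hy), extZero_apply (V := Set.Icc 0 T ×ˢ U) _ ⟨ht, hz⟩]
    exact (hf ⟨y, hsub' hy⟩ hy.1.2).trans (le_of_eq h0.symm)
  have key := hmax.hasFDerivWithinAt_nonpos hd (sub_mem_posTangentConeAt_of_segment_subset hsub)
  rw [ev_der, map_zero, mul_zero, add_zero]
  have e : ((0, z) - (t, z) : ℝ × Cn n) = (-t) • (1, 0) := by simp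
  rw [e, map_smul, smul_eq_mul] at key
  have key' : 0 ≤ t * (diff f ⟨(t, z), ht, hz⟩ (1, 0)).re := by
    simp only [ContinuousLinearMap.comp_apply, Complex.reCLM_apply] at key
    linarith
  exact nonneg_of_mul_nonneg_right key' hx

/-- The maximum principle: at a point where a function attains its maximum among earlier times, the
heat operator is non-negative. -/
theorem re_ev_heat_nonneg (hT : 0 < T) (hU : IsOpen U)
    {f : smoothFun (Set.Icc 0 T ×ˢ U)} {x : (Set.Icc 0 T ×ˢ U : Set (ℝ × Cn n))}
    (hx : 0 < x.1.1)
    (hf : ∀ y : (Set.Icc 0 T ×ˢ U : Set (ℝ × Cn n)), y.1.1 ≤ x.1.1 → (ev y f).re ≤ 0)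
    (h0 : (ev x f).re = 0) {w : Matrix (Fin n) (Fin n) (smoothFun (Set.Icc 0 T ×ˢ U))}
    (hw : ((ev x).mapMatrix w).PosSemidef) :
    0 ≤ (ev x (heat (wd (.Icc_prod hT hU) (.inr ℝ ℝ (Cn n))) (wdb (.Icc_prod hT hU) (.inr ℝ ℝ (Cn n)))
      (der (.Icc_prod hT hU) (1, 0) 0) (fun p q => w q p) f)).re := by
  -- `∑ w^{p q̄} ∂_p ∂_q̄` is a sum of Laplacians of complex lines, spanned by the rows of `S`
  obtain ⟨S, hS⟩ := exists_eq_conjTranspose_mul_self hw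
  have hw' : ∀ p q, ev x (w q p) = ∑ a, S a p * conj (S a q) := by
    intro p q
    have := congrFun (congrFun hS q) p
    rw [AlgHom.mapMatrix_apply, Matrix.map_apply, Matrix.mul_apply] at this
    rw [this]
    exact Finset.sum_congr rfl fun a _ => mul_comm _ _
  set hV := IsRegular.Icc_prod hT hU
  set ι := ContinuousLinearMap.inr ℝ ℝ (Cn n)
  have hlap : ∀ a, (∑ p, ∑ q, S a p * conj (S a q) * ev x (wd hV ι p (wdb hV ι q f))).re ≤ 0 := by
    intro a
    have h1 := congrArg (ev x) (sum_wd_wdb hV ι (WithLp.toLp 2 (S a)) f)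
    rw [map_smul, map_add, smul_eq_mul] at h1
    simp only [map_sum, map_smul, smul_eq_mul] at h1
    have h2 := congrArg Complex.re h1
    have h3 := re_ev_der_der_nonpos hT hU hf h0 (WithLp.toLp 2 (S a))
    have h4 := re_ev_der_der_nonpos hT hU hf h0 (Complex.I • WithLp.toLp 2 (S a))
    rw [Complex.add_re, show (4 : ℂ) = ((4 : ℝ) : ℂ) by norm_num, Complex.re_ofReal_mul] at h2
    simp only [ι, ContinuousLinearMap.inr_apply] at h2
    linarith
  have htime := re_ev_der_time_nonneg hT hU hx hf h0
  rw [heat_apply, map_sub, Complex.sub_re]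
  have e : ev x (∑ p, ∑ q, w q p * wd hV ι p (wdb hV ι q f)) =
      ∑ a, ∑ p, ∑ q, S a p * conj (S a q) * ev x (wd hV ι p (wdb hV ι q f)) := by
    simp only [map_sum, map_mul, hw', Finset.sum_mul]
    rw [Finset.sum_comm' (t' := Finset.univ) (s' := fun _ => Finset.univ) (by simp)]
    calc _ = ∑ q, ∑ a, ∑ p, S a p * conj (S a q) * ev x (wd hV ι p (wdb hV ι q f)) :=
          Finset.sum_congr rfl fun q _ => Finset.sum_comm
      _ = _ := by
        rw [Finset.sum_comm]
        exact Finset.sum_congr rfl fun a _ => Finset.sum_comm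
  rw [e, Complex.re_sum]
  have := Finset.sum_nonpos fun a (_ : a ∈ Finset.univ) => hlap a
  linarith

end MaximumPrinciple

/-! ### The flow in a chart -/

section LocalFlow

open smoothFun

variable {n : ℕ}

theorem curv_map {A A' : Type*} [CommRing A] [Algebra ℂ A] [CommRing A'] [Algebra ℂ A']
    {d db : Fin n → Derivation ℂ A A} {d' db' : Fin n → Derivation ℂ A' A'} (θ : A →ₐ[ℂ] A')
    (hd : ∀ i f, d' i (θ f) = θ (d i f)) (hdb : ∀ i f, db' i (θ f) = θ (db i f))
    (G Gi : Matrix (Fin n) (Fin n) A) (i j : Fin n) :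
    curv d' db' (θ.mapMatrix G) (θ.mapMatrix Gi) i j = θ.mapMatrix (curv d db G Gi i j) := by
  have h : ∀ i (M : Matrix (Fin n) (Fin n) A), mder (d' i) (θ.mapMatrix M) = θ.mapMatrix (mder (d i) M) := fun i M => by
    ext k l; exact hd i _
  have hb : ∀ i (M : Matrix (Fin n) (Fin n) A), mder (db' i) (θ.mapMatrix M) = θ.mapMatrix (mder (db i) M) := fun i M => by
    ext k l; exact hdb i _
  simp only [curv, h, hb, map_add, map_neg, map_mul]

/-- The matrix `(R_{i j̄ k l̄})_{k l}` of the Chern curvature tensor at `z`. -/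
def curvMat (G : Cn n → Matrix (Fin n) (Fin n) ℂ) (z : Cn n) (i j : Fin n) :
    Matrix (Fin n) (Fin n) ℂ :=
  Matrix.of fun k l => chernCurv G i j k l z

/-- A solution of the flow `∂_t G = -S(G)` on `[0, T] × U`, for an open subset `U` of `ℂⁿ`. -/
structure IsLocalFlow (T : ℝ) (U : Set (Cn n)) (G : ℝ → Cn n → Matrix (Fin n) (Fin n) ℂ) :
    Prop where
  isOpen : IsOpen U
  smooth : ∀ i j, ContDiffOn ℝ ∞ (fun q : ℝ × Cn n => G q.1 q.2 i j) (Set.Icc 0 T ×ˢ U)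
  conj_symm : ∀ t z i j, star (G t z i j) = G t z j i
  pos : ∀ t, ∀ z ∈ U, ∀ X, X ≠ 0 → 0 < normSq (G t z) X
  flow : ∀ z ∈ U, ∀ i j, ∀ t ∈ Set.Icc 0 T,
    HasDerivWithinAt (fun s => G s z i j) (-secondRicci (G t) i j z) (Set.Icc 0 T) t

theorem IsHermitianCurvatureFlow.isLocalFlow {M : Type*} [TopologicalSpace M]
    [ChartedSpace (Cn n) M] [IsManifold 𝓘(ℂ, Cn n) ω M] {g : ℝ → HermitianMetric n M} {T : ℝ}
    (hg : IsHermitianCurvatureFlow g T) {e : OpenPartialHomeomorph M (Cn n)}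
    (he : e ∈ holoCharts n M) : IsLocalFlow T e.target fun t => (g t).comp e :=
  ⟨e.open_target, hg.smooth e he, fun t z i j => (g t).conj_comp e z i j,
    fun t _ hz _ hX => (g t).quad_comp_pos he hz hX, hg.flow e he⟩

/-- The derivations `∂_i` of the ring of smooth functions on `[0, T] × U`. -/
abbrev dSpace {T : ℝ} (hT : 0 < T) {U : Set (Cn n)} (hU : IsOpen U) (i : Fin n) :
    Derivation ℂ (smoothFun (Set.Icc 0 T ×ˢ U)) (smoothFun (Set.Icc 0 T ×ˢ U)) :=
  wd (.Icc_prod hT hU) (.inr ℝ ℝ (Cn n)) i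

/-- The derivations `∂_ī` of the ring of smooth functions on `[0, T] × U`. -/
abbrev dSpaceBar {T : ℝ} (hT : 0 < T) {U : Set (Cn n)} (hU : IsOpen U) (i : Fin n) :
    Derivation ℂ (smoothFun (Set.Icc 0 T ×ˢ U)) (smoothFun (Set.Icc 0 T ×ˢ U)) :=
  wdb (.Icc_prod hT hU) (.inr ℝ ℝ (Cn n)) i

/-- The derivation `∂_t` of the ring of smooth functions on `[0, T] × U`. -/
abbrev dTime {T : ℝ} (hT : 0 < T) {U : Set (Cn n)} (hU : IsOpen U) :
    Derivation ℂ (smoothFun (Set.Icc 0 T ×ˢ U)) (smoothFun (Set.Icc 0 T ×ˢ U)) :=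
  der (.Icc_prod hT hU) (1, 0) 0

namespace IsLocalFlow

variable {T : ℝ} {U : Set (Cn n)} {G : ℝ → Cn n → Matrix (Fin n) (Fin n) ℂ}

theorem mono (h : IsLocalFlow T U G) {U' : Set (Cn n)} (hU' : IsOpen U') (hU : U' ⊆ U) :
    IsLocalFlow T U' G :=
  ⟨hU', fun i j => (h.smooth i j).mono (Set.prod_mono le_rfl hU), h.conj_symm,
    fun t z hz => h.pos t z (hU hz), fun z hz => h.flow z (hU hz)⟩

/-- The matrix of the metric over the ring of smooth functions. -/
def mat (h : IsLocalFlow T U G) : Matrix (Fin n) (Fin n) (smoothFun (Set.Icc 0 T ×ˢ U)) :=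
  matMk (fun q : ℝ × Cn n => G q.1 q.2) h.smooth

theorem ev_mat (h : IsLocalFlow T U G) (x : (Set.Icc 0 T ×ˢ U : Set (ℝ × Cn n))) :
    (ev x).mapMatrix h.mat = G x.1.1 x.1.2 := ev_matMk _ _ x

theorem det_ne_zero (h : IsLocalFlow T U G) {t : ℝ} {z : Cn n} (hz : z ∈ U) :
    (G t z).det ≠ 0 := by
  intro h0
  obtain ⟨v, hv, hv0⟩ := Matrix.exists_mulVec_eq_zero_iff.2 h0
  have := h.pos t z hz (star v) (by simpa using hv)
  rw [normSq, quad_eq_dotProduct, star_star, hv0, dotProduct_zero] at this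
  exact lt_irrefl _ this

theorem isUnit_det (h : IsLocalFlow T U G) : IsUnit h.mat.det :=
  isUnit_det_of_ev fun x => by rw [h.ev_mat]; exact h.det_ne_zero x.2.2

theorem mul_inv (h : IsLocalFlow T U G) : h.mat * h.mat⁻¹ = 1 :=
  Matrix.mul_nonsing_inv _ h.isUnit_det

theorem ev_mat_inv (h : IsLocalFlow T U G) (x : (Set.Icc 0 T ×ˢ U : Set (ℝ × Cn n))) :
    (ev x).mapMatrix h.mat⁻¹ = (G x.1.1 x.1.2)⁻¹ := by
  rw [ev_inv h.isUnit_det, h.ev_mat]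

section Slice

variable (hT : 0 < T) (h : IsLocalFlow T U G) {t : ℝ} (ht : t ∈ Set.Icc 0 T)

include ht in
theorem mapsTo_slice : Set.MapsTo (fun z : Cn n => (t, z)) U (Set.Icc 0 T ×ˢ U) :=
  fun _ hz => ⟨ht, hz⟩

/-- The restriction of functions on `[0, T] × U` to the time `t`. -/
def slice {t : ℝ} (ht : t ∈ Set.Icc 0 T) :
    smoothFun (Set.Icc 0 T ×ˢ U) →ₐ[ℂ] smoothFun U :=
  pullback (fun z : Cn n => (t, z)) (by fun_prop) (mapsTo_slice ht)

theorem wd_slice (hU : IsOpen U) (i : Fin n) (f : smoothFun (Set.Icc 0 T ×ˢ U)) :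
    wd (.of_isOpen hU) (.id ℝ (Cn n)) i (slice ht f) = slice ht (dSpace hT hU i f) :=
  wd_pullback (.of_isOpen hU) (.Icc_prod hT hU) _ _ _ (mapsTo_slice ht)
    (φ' := ContinuousLinearMap.inr ℝ ℝ (Cn n))
    (fun x _ => (hasFDerivAt_prodMk_right t x).hasFDerivWithinAt) (fun _ => rfl) i f

theorem wdb_slice (hU : IsOpen U) (i : Fin n) (f : smoothFun (Set.Icc 0 T ×ˢ U)) :
    wdb (.of_isOpen hU) (.id ℝ (Cn n)) i (slice ht f) = slice ht (dSpaceBar hT hU i f) :=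
  wdb_pullback (.of_isOpen hU) (.Icc_prod hT hU) _ _ _ (mapsTo_slice ht)
    (φ' := ContinuousLinearMap.inr ℝ ℝ (Cn n))
    (fun x _ => (hasFDerivAt_prodMk_right t x).hasFDerivWithinAt) (fun _ => rfl) i f

include ht in
theorem smooth_slice (h : IsLocalFlow T U G) (i j : Fin n) :
    ContDiffOn ℝ ∞ (fun z => G t z i j) U :=
  (h.smooth i j).comp (f := fun z : Cn n => (t, z)) (by fun_prop) (mapsTo_slice ht)

/-- The Chern curvature of `G t` in terms of the matrix over the ring of smooth functions. -/
theorem ev_curv (x : (Set.Icc 0 T ×ˢ U : Set (ℝ × Cn n))) (i j : Fin n) :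
    (ev x).mapMatrix (curv (dSpace hT h.isOpen) (dSpaceBar hT h.isOpen) h.mat h.mat⁻¹ i j) =
      curvMat (G x.1.1) x.1.2 i j := by
  obtain ⟨⟨t, z⟩, ht, hz⟩ := x
  set s := slice (U := U) ht with hs
  have hm : matMk (G t) (h.smooth_slice ht) = s.mapMatrix h.mat := by ext1 a b; rfl
  have hinv : (matMk (G t) (h.smooth_slice ht))⁻¹ = s.mapMatrix h.mat⁻¹ := by
    refine Matrix.inv_eq_right_inv ?_
    rw [hm, ← map_mul, h.mul_inv, map_one]
  have key := curv_map s (fun i f => wd_slice hT ht h.isOpen i f)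
    (fun i f => wdb_slice hT ht h.isOpen i f) h.mat h.mat⁻¹ i j
  rw [← hinv, ← hm] at key
  ext k l
  rw [curvMat, Matrix.of_apply, chernCurv_eq_ev h.isOpen (h.smooth_slice ht)
    (fun z hz => h.det_ne_zero hz) ⟨z, hz⟩, key]
  rfl

theorem ev_dSpace (x : (Set.Icc 0 T ×ˢ U : Set (ℝ × Cn n))) (i k l : Fin n) :
    ev x (dSpace hT h.isOpen i (h.mat k l)) = dz i (fun w => G x.1.1 w k l) x.1.2 := by
  obtain ⟨⟨t, z⟩, ht, hz⟩ := x
  have h1 := congrArg (ev ⟨z, hz⟩) (wd_slice hT ht h.isOpen i (h.mat k l))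
  rw [ev_wd_eq_dz h.isOpen (F := fun w => G t w k l) (fun y => rfl)] at h1
  exact h1.symm

theorem ev_dSpaceBar (x : (Set.Icc 0 T ×ˢ U : Set (ℝ × Cn n))) (i k l : Fin n) :
    ev x (dSpaceBar hT h.isOpen i (h.mat k l)) = dzbar i (fun w => G x.1.1 w k l) x.1.2 := by
  obtain ⟨⟨t, z⟩, ht, hz⟩ := x
  have h1 := congrArg (ev ⟨z, hz⟩) (wdb_slice hT ht h.isOpen i (h.mat k l))
  rw [ev_wdb_eq_dzbar h.isOpen (F := fun w => G t w k l) (fun y => rfl)] at h1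
  exact h1.symm

theorem mder_dTime : mder (dTime hT h.isOpen) h.mat = -∑ p, ∑ q, h.mat⁻¹ q p •
    curv (dSpace hT h.isOpen) (dSpaceBar hT h.isOpen) h.mat h.mat⁻¹ p q := by
  ext k l x
  obtain ⟨⟨t, z⟩, ht, hz⟩ := x
  set x : (Set.Icc 0 T ×ˢ U : Set (ℝ × Cn n)) := ⟨(t, z), ht, hz⟩
  have hd : HasDerivWithinAt (fun s => extZero (h.mat k l).1 (s, z))
      (diff (h.mat k l) x (1, 0)) (Set.Icc 0 T) t := by
    have h1 : HasDerivWithinAt (fun s : ℝ => (s, z)) ((1, 0) : ℝ × Cn n) (Set.Icc 0 T) t :=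
      ((hasDerivAt_id t).prodMk (hasDerivAt_const t z)).hasDerivWithinAt
    exact (hasFDerivWithinAt (h.mat k l) x).comp_hasDerivWithinAt_of_eq t h1
      (t := Set.Icc 0 T ×ˢ U) (fun s (hs : s ∈ Set.Icc 0 T) => Set.mk_mem_prod hs hz) rfl
  have hd' : HasDerivWithinAt (fun s => extZero (h.mat k l).1 (s, z))
      (-secondRicci (G t) k l z) (Set.Icc 0 T) t := by
    refine (h.flow z hz k l t ht).congr (fun s hs => ?_) ?_
    · exact extZero_apply (V := Set.Icc 0 T ×ˢ U) (x := (s, z)) _ ⟨hs, hz⟩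
    · exact extZero_apply (V := Set.Icc 0 T ×ˢ U) (x := (t, z)) _ ⟨ht, hz⟩
  have e1 := ((uniqueDiffOn_Icc hT) t ht).eq_deriv _ hd hd'
  rw [mder_apply, ev_der, map_zero, mul_zero, add_zero, e1, secondRicci]
  simp only [Matrix.neg_apply, Matrix.sum_apply, Matrix.smul_apply, map_neg, map_sum, smul_eq_mul,
    map_mul]
  refine congrArg _ (Finset.sum_congr rfl fun p _ => Finset.sum_congr rfl fun q _ => ?_)
  have e2 := congrFun (congrFun (h.ev_mat_inv x) q) p
  have e3 := congrFun (congrFun (h.ev_curv hT x p q) k) l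
  rw [AlgHom.mapMatrix_apply, Matrix.map_apply] at e2 e3
  rw [e2, e3]
  rfl

end Slice

theorem conjHom_mat (h : IsLocalFlow T U G) (k l : Fin n) :
    conjHom _ (h.mat k l) = h.mat l k := by
  ext x
  exact h.conj_symm _ _ _ _

theorem conjHom_mat_inv (h : IsLocalFlow T U G) (k l : Fin n) :
    conjHom _ (h.mat⁻¹ k l) = h.mat⁻¹ l k := by
  have e : h.mat⁻¹ = ((conjHom _).mapMatrix h.mat⁻¹)ᵀ := by
    refine Matrix.inv_eq_left_inv ?_
    have e1 : h.mat = ((conjHom _).mapMatrix h.mat)ᵀ := by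
      ext1 k l; exact (h.conjHom_mat l k).symm
    conv_lhs => enter [2]; rw [e1]
    rw [← Matrix.transpose_mul, ← map_mul, h.mul_inv, map_one, Matrix.transpose_one]
  conv_rhs => rw [e]
  rfl

theorem conjHom_curv (hT : 0 < T) (h : IsLocalFlow T U G) (i j k l : Fin n) :
    conjHom _ (curv (dSpace hT h.isOpen) (dSpaceBar hT h.isOpen) h.mat h.mat⁻¹ i j k l) =
      curv (dSpace hT h.isOpen) (dSpaceBar hT h.isOpen) h.mat h.mat⁻¹ j i l k := by
  simp only [curv, Matrix.add_apply, Matrix.neg_apply, Matrix.mul_apply, mder_apply, map_add,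
    map_neg, map_sum, map_mul, conjHom_wd, conjHom_wdb, h.conjHom_mat, h.conjHom_mat_inv,
    Finset.sum_mul]
  congr 1
  · rw [(commuting_wd (.Icc_prod hT h.isOpen) (.inr ℝ ℝ (Cn n)) 0 0).d_db]
  · rw [Finset.sum_comm]
    exact Finset.sum_congr rfl fun a _ => Finset.sum_congr rfl fun b _ => by ring

theorem isCurvatureTensor (hT : 0 < T) (h : IsLocalFlow T U G) {t : ℝ} (ht : t ∈ Set.Icc 0 T)
    {z : Cn n} (hz : z ∈ U) : IsCurvatureTensor (G t z) (curvMat (G t) z) := by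
  refine ⟨h.conj_symm t z, h.pos t z hz, fun i j k l => ?_⟩
  set x : (Set.Icc 0 T ×ˢ U : Set (ℝ × Cn n)) := ⟨(t, z), ht, hz⟩
  have e := fun i j k l => congrFun (congrFun (h.ev_curv hT x i j) k) l
  have := congrArg (ev x) (h.conjHom_curv hT i j k l)
  rw [ev_conjHom] at this
  rw [← e, ← e]
  exact this

theorem normSq_eq (h : IsLocalFlow T U G) (t : ℝ) (z : Cn n) (X : Fin n → ℂ) :
    quad (G t z) X (star X) = normSq (G t z) X := by
  have h1 : star (quad (G t z) X (star X)) = quad (G t z) X (star X) := by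
    rw [star_quad, show (G t z)ᴴ = G t z by ext i j; exact h.conj_symm t z j i]
  rw [normSq]
  exact (Complex.conj_eq_iff_re.1 h1).symm

end IsLocalFlow

end LocalFlow

/-! ### Normal frames and adapted vector fields -/

section Frames

variable {n : ℕ} {A : Type*} [CommRing A] [Algebra ℂ A]
  {d db : Fin n → Derivation ℂ A A} {dt : Derivation ℂ A A}
  {G Gi P Pi Q Qi : Matrix (Fin n) (Fin n) A} {ev : A →ₐ[ℂ] ℂ}

theorem curv_frame (comm : ∀ i j f, d i (db j f) = db j (d i f)) (hP : ∀ j, mder (db j) P = 0)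
    (hQ : ∀ i, mder (d i) Q = 0) (hPP : P * Pi = 1) (hQQ : Q * Qi = 1) (hG : G * Gi = 1)
    (i j : Fin n) :
    curv d db (P * G * Q) (Qi * Gi * Pi) i j = P * curv d db G Gi i j * Q := by
  have hid : ∀ M : Matrix (Fin n) (Fin n) A, (AlgHom.id ℂ A).mapMatrix M = M := fun M => by
    ext k l; rfl
  have key := curv_transform (d := d) (db := db) (d' := d) (db' := db) (AlgHom.id ℂ A)
    (J := 1) (Jc := 1) (fun i f => by simp [Matrix.one_apply])
    (fun i f => by simp [Matrix.one_apply]) comm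
    (fun i j b => by rw [Matrix.one_apply]; split_ifs <;> simp) hP hQ hPP hQQ hG i j
  simp only [hid] at key
  rw [key, Finset.sum_eq_single i, Finset.sum_eq_single j]
  · simp
  · intro b _ hb; rw [Matrix.one_apply_ne' hb]; simp
  · simp
  · intro a _ ha; rw [Matrix.one_apply_ne' ha]; simp
  · simp

/-- A change of frame whose first derivatives cancel the connection coefficients gives a normal
frame. -/
theorem IsNormalFrame.of_frame (comm : ∀ i j f, d i (db j f) = db j (d i f))
    (hP : ∀ j, mder (db j) P = 0) (hQ : ∀ i, mder (d i) Q = 0) (hPP : P * Pi = 1)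
    (hQQ : Q * Qi = 1) (hG : G * Gi = 1) (eP : ev.mapMatrix P = 1) (eQ : ev.mapMatrix Q = 1)
    (edP : ∀ i, ev.mapMatrix (mder (d i) P) = -ev.mapMatrix (mder (d i) G * Gi))
    (edQ : ∀ i, ev.mapMatrix (mder (db i) Q) = -ev.mapMatrix (Gi * mder (db i) G)) :
    IsNormalFrame d db G Gi (P * G * Q) (Qi * Gi * Pi) ev := by
  have ePi : ev.mapMatrix Pi = 1 := by
    have := congrArg ev.mapMatrix hPP
    rwa [map_mul, eP, one_mul, map_one] at this
  have eQi : ev.mapMatrix Qi = 1 := by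
    have := congrArg ev.mapMatrix hQQ
    rwa [map_mul, eQ, one_mul, map_one] at this
  have hGi : ev.mapMatrix Gi * ev.mapMatrix G = 1 := by
    rw [← map_mul, mul_eq_one_comm.1 hG, map_one]
  have hGi' : ev.mapMatrix G * ev.mapMatrix Gi = 1 := by rw [← map_mul, hG, map_one]
  refine ⟨?_, ?_, fun i j => ?_, fun i => ?_, fun i => ?_⟩
  · calc _ = P * (G * (Q * Qi) * Gi) * Pi := by noncomm_ring
      _ = 1 := by rw [hQQ, mul_one, hG, mul_one, hPP]
  · rw [map_mul, map_mul, ePi, eQi, one_mul, mul_one]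
  · rw [curv_frame comm hP hQ hPP hQQ hG, map_mul, map_mul, eP, eQ, one_mul, mul_one]
  · rw [mder_mul, mder_mul, hQ, mul_zero, add_zero, map_mul, map_add, map_mul, map_mul, eP, eQ,
      edP, map_mul, neg_mul, mul_assoc, hGi]
    simp
  · rw [mder_mul, mder_mul, hP, zero_mul, zero_add, map_add, map_mul, map_mul, map_mul, map_mul,
      eP, eQ, edQ, map_mul, one_mul, one_mul, mul_neg, ← mul_assoc, hGi']
    simp

/-- The flow equation holds in every holomorphic frame that is independent of time. -/
theorem mder_frame (comm : ∀ i j f, d i (db j f) = db j (d i f)) (hP : ∀ j, mder (db j) P = 0)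
    (hQ : ∀ i, mder (d i) Q = 0) (hPP : P * Pi = 1) (hQQ : Q * Qi = 1) (hG : G * Gi = 1)
    (hPt : mder dt P = 0) (hQt : mder dt Q = 0)
    (flow : mder dt G = -∑ p, ∑ q, Gi q p • curv d db G Gi p q) :
    mder dt (P * G * Q) =
      -∑ p, ∑ q, Gi q p • curv d db (P * G * Q) (Qi * Gi * Pi) p q := by
  rw [mder_mul, mder_mul, hPt, hQt, flow]
  simp only [curv_frame comm hP hQ hPP hQQ hG, zero_mul, mul_zero, add_zero, zero_add, mul_neg,
    neg_mul, Finset.mul_sum, Finset.sum_mul, Matrix.mul_smul, Matrix.smul_mul]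

/-- The value of the barrier in the frame `P` at an arbitrary point is its value in the given frame,
where `Y` is replaced by the vector with the components `Y` in the frame `P`. -/
theorem re_ev_barrier (comm : ∀ i j f, d i (db j f) = db j (d i f)) (hP : ∀ j, mder (db j) P = 0)
    (hQ : ∀ i, mder (d i) Q = 0) (hPP : P * Pi = 1) (hQQ : Q * Qi = 1) (hG : G * Gi = 1)
    {U Ub V Vb : Fin n → A} {δ κ : A} {g P' : Matrix (Fin n) (Fin n) ℂ}
    {r : Fin n → Fin n → Matrix (Fin n) (Fin n) ℂ} {u v : Fin n → ℂ} {δ' κ' : ℝ}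
    (hg : ev.mapMatrix G = g) (hgi : ev.mapMatrix Gi = g⁻¹) (hP' : ev.mapMatrix P = P')
    (hQ' : ev.mapMatrix Q = P'ᴴ) (hr : ∀ i j, ev.mapMatrix (curv d db G Gi i j) = r i j)
    (hu : ∀ i, ev (U i) = u i) (hub : ∀ i, ev (Ub i) = star (u i))
    (hv : ∀ i, ev (V i) = v i) (hvb : ∀ i, ev (Vb i) = star (v i)) (hδ : ev δ = δ')
    (hκ : ev κ = κ') (hnorm : ∀ X, quad g X (star X) = normSq g X) (h : IsCurvatureTensor g r)
    (Y : Fin n → ℂ) (s B : ℝ) :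
    (ev (barrier d db G (P * G * Q) (Qi * Gi * Pi) U Ub V Vb Y (star Y) s B δ κ)).re =
      barrierVal g r B δ' s u v (Y ᵥ* P') -
        κ' * ((normSq g u + normSq g v) * normSq g (Y ᵥ* P')) := by
  have hPP' : ev.mapMatrix Pi * ev.mapMatrix P = 1 := by
    rw [← map_mul, mul_eq_one_comm.1 hPP, map_one]
  have hQQ' : ev.mapMatrix Q * ev.mapMatrix Qi = 1 := by rw [← map_mul, hQQ, map_one]
  have hnorm' : ∀ {U Ub : Fin n → A} {u : Fin n → ℂ}, (∀ i, ev (U i) = u i) →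
      (∀ i, ev (Ub i) = star (u i)) → ev (∑ i, ∑ j, U i * Ub j * G i j) = normSq g u := by
    intro U Ub u hu hub
    rw [← hnorm, quad]
    simp only [map_sum, map_mul, hu, hub, ← hg]
    rfl
  have hy : ev (quad (P * G * Q) Y (star Y)) = normSq g (Y ᵥ* P') := by
    rw [ev_quad, map_mul, map_mul, hg, hP', hQ', quad_conj_mul, hnorm]
  have hcon : ∀ {U Vb : Fin n → A} {u v : Fin n → ℂ}, (∀ i, ev (U i) = u i) →
      (∀ i, ev (Vb i) = star (v i)) →
      ev.mapMatrix (contract (curv d db (P * G * Q) (Qi * Gi * Pi)) U Vb) =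
        ev.mapMatrix P * contract r u (star v) * ev.mapMatrix Q := by
    intro U Vb u v hu hv
    have e : contract (curv d db (P * G * Q) (Qi * Gi * Pi)) U Vb =
        P * contract (curv d db G Gi) U Vb * Q := by
      simp only [contract, curv_frame comm hP hQ hPP hQQ hG, Finset.mul_sum, Finset.sum_mul,
        Matrix.mul_smul, Matrix.smul_mul]
    rw [e, map_mul, map_mul]
    congr 2
    ext k l
    simp only [AlgHom.mapMatrix_apply, Matrix.map_apply, contract_apply, map_sum, map_mul, hu, hv,
      show ∀ j, (star v) j = star (v j) from fun _ => rfl]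
    refine Finset.sum_congr rfl fun i _ => Finset.sum_congr rfl fun j _ => ?_
    rw [← hr]
    rfl
  have hcv : ∀ {U Vb : Fin n → A} {u v : Fin n → ℂ}, (∀ i, ev (U i) = u i) →
      (∀ i, ev (Vb i) = star (v i)) →
      ev (quad (contract (curv d db (P * G * Q) (Qi * Gi * Pi)) U Vb) Y (star Y)) =
        curvVal r u v (Y ᵥ* P') := by
    intro U Vb u v hu hv
    rw [ev_quad, hcon hu hv, hP', hQ', quad_conj_mul, curvVal]
  have htr : ev (contract (curv d db (P * G * Q) (Qi * Gi * Pi)) U Ub * (Qi * Gi * Pi)).trace =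
      (contract r u (star u) * g⁻¹).trace := by
    have e : ∀ M : Matrix (Fin n) (Fin n) A, ev M.trace = (ev.mapMatrix M).trace := fun M => by
      simp [Matrix.trace]
    rw [e, map_mul, map_mul, map_mul, hcon hu hub, hgi]
    calc _ = (ev.mapMatrix P * (contract r u (star u) * (ev.mapMatrix Q * ev.mapMatrix Qi) * g⁻¹ *
          ev.mapMatrix Pi)).trace := by congr 1; noncomm_ring
      _ = _ := by
        rw [hQQ', mul_one, Matrix.trace_mul_comm, mul_assoc, hPP', mul_one]
  have hvu : (curvVal r v u (Y ᵥ* P')).re = (curvVal r u v (Y ᵥ* P')).re := by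
    rw [← star_curvVal h u v]; simp
  rw [barrier]
  simp only [map_sub, map_add, map_mul, map_smul, htr, hcv hu hub, hcv hu hvb, hcv hv hub,
    hnorm' hu hub, hnorm' hv hvb, hy, hδ, hκ, smul_eq_mul]
  simp only [Complex.add_re, Complex.sub_re, Complex.re_mul_ofReal, Complex.re_ofReal_mul,
    ← Complex.ofReal_add, ← Complex.ofReal_mul, Complex.ofReal_re, hvu]
  rw [barrierVal, ricVal]
  ring

end Frames

section Extensions

open smoothFun

variable {n : ℕ} {T : ℝ} {U : Set (Cn n)}

/-- The function `a - ∑ c_p (z - z₀)^p` on `[0, T] × U`. -/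
def affine (T : ℝ) (U : Set (Cn n)) (z₀ : Cn n) (a : ℂ) (c : Fin n → ℂ) :
    smoothFun (Set.Icc 0 T ×ˢ U) :=
  smoothFun.mk (fun q : ℝ × Cn n => a - ∑ p, c p * (q.2 p - z₀ p)) (by fun_prop)

theorem ev_affine (z₀ : Cn n) (a : ℂ) (c : Fin n → ℂ)
    (x : (Set.Icc 0 T ×ˢ U : Set (ℝ × Cn n))) :
    ev x (affine T U z₀ a c) = a - ∑ p, c p * (x.1.2 p - z₀ p) := rfl

theorem diff_affine (hV : IsRegular (Set.Icc 0 T ×ˢ U)) (z₀ : Cn n) (a : ℂ) (c : Fin n → ℂ)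
    (x : (Set.Icc 0 T ×ˢ U : Set (ℝ × Cn n))) (v : ℝ × Cn n) :
    diff (affine T U z₀ a c) x v = -∑ p, c p * v.2 p := by
  have hp : ∀ p, HasFDerivAt (fun q : ℝ × Cn n => c p * (q.2 p - z₀ p))
      (c p • ((EuclideanSpace.proj p : Cn n →L[ℂ] ℂ).restrictScalars ℝ ∘L
        ContinuousLinearMap.snd ℝ ℝ (Cn n))) x.1 := fun p =>
    ((((EuclideanSpace.proj p : Cn n →L[ℂ] ℂ).restrictScalars ℝ ∘L
      ContinuousLinearMap.snd ℝ ℝ (Cn n)).hasFDerivAt.sub_const (z₀ p)).const_mul (c p))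
  have h := (HasFDerivAt.fun_sum (u := Finset.univ) fun p _ => hp p).const_sub a
  rw [diff_eq hV h.hasFDerivWithinAt fun y => rfl]
  simp

variable (hT : 0 < T) (hU : IsOpen U)

theorem dSpace_affine (z₀ : Cn n) (a : ℂ) (c : Fin n → ℂ) (i : Fin n) :
    dSpace hT hU i (affine T U z₀ a c) = algebraMap ℂ _ (-c i) := by
  ext x
  rw [ev_wd, diff_affine (.Icc_prod hT hU), diff_affine (.Icc_prod hT hU), AlgHom.commutes]
  simp
  linear_combination c i / 2 * Complex.I_mul_I

theorem dSpaceBar_affine (z₀ : Cn n) (a : ℂ) (c : Fin n → ℂ) (i : Fin n) :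
    dSpaceBar hT hU i (affine T U z₀ a c) = 0 := by
  ext x
  rw [ev_wdb, diff_affine (.Icc_prod hT hU), diff_affine (.Icc_prod hT hU), map_zero]
  simp
  linear_combination -c i * Complex.I_mul_I

theorem dTime_affine (z₀ : Cn n) (a : ℂ) (c : Fin n → ℂ) :
    dTime hT hU (affine T U z₀ a c) = 0 := by
  ext x
  rw [ev_der, diff_affine (.Icc_prod hT hU), map_zero, map_zero]
  simp

theorem conjHom_dTime (f : smoothFun (Set.Icc 0 T ×ˢ U)) :
    conjHom _ (dTime hT hU f) = dTime hT hU (conjHom _ f) := by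
  rw [conjHom_der, neg_zero]

/-- A function of time as a function on `[0, T] × U`. -/
def timeFun (T : ℝ) (U : Set (Cn n)) (φ : ℝ → ℝ) (hφ : ContDiff ℝ ∞ φ) :
    smoothFun (Set.Icc 0 T ×ˢ U) :=
  smoothFun.mk (fun q : ℝ × Cn n => (φ q.1 : ℂ))
    (Complex.ofRealCLM.contDiff.comp (hφ.comp contDiff_fst)).contDiffOn

theorem diff_timeFun (hV : IsRegular (Set.Icc 0 T ×ˢ U)) {φ : ℝ → ℝ} (hφ : ContDiff ℝ ∞ φ)
    (x : (Set.Icc 0 T ×ˢ U : Set (ℝ × Cn n))) (v : ℝ × Cn n) :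
    diff (timeFun T U φ hφ) x v = v.1 * deriv φ x.1.1 := by
  have h1 : HasFDerivAt φ _ x.1.1 :=
    ((hφ.differentiable (by simp)) x.1.1).hasDerivAt.hasFDerivAt
  have h := Complex.ofRealCLM.hasFDerivAt.comp x.1
    (h1.comp x.1 (hasFDerivAt_fst (𝕜 := ℝ) (E := ℝ) (F := Cn n)))
  rw [diff_eq hV h.hasFDerivWithinAt fun y => rfl]
  simp

theorem dSpace_timeFun {φ : ℝ → ℝ} (hφ : ContDiff ℝ ∞ φ) (i : Fin n) :
    dSpace hT hU i (timeFun T U φ hφ) = 0 := by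
  ext x
  rw [ev_wd, diff_timeFun (.Icc_prod hT hU), diff_timeFun (.Icc_prod hT hU)]
  simp

theorem dSpaceBar_timeFun {φ : ℝ → ℝ} (hφ : ContDiff ℝ ∞ φ) (i : Fin n) :
    dSpaceBar hT hU i (timeFun T U φ hφ) = 0 := by
  ext x
  rw [ev_wdb, diff_timeFun (.Icc_prod hT hU), diff_timeFun (.Icc_prod hT hU)]
  simp

theorem ev_dTime_timeFun {φ : ℝ → ℝ} (hφ : ContDiff ℝ ∞ φ)
    (x : (Set.Icc 0 T ×ˢ U : Set (ℝ × Cn n))) :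
    ev x (dTime hT hU (timeFun T U φ hφ)) = deriv φ x.1.1 := by
  rw [ev_der, diff_timeFun (.Icc_prod hT hU), map_zero]
  simp

/-- The matrix function `1 - ∑ (z - z₀)^p Γ_p`. -/
def frame (T : ℝ) (U : Set (Cn n)) (z₀ : Cn n) (Γ : Fin n → Matrix (Fin n) (Fin n) ℂ) :
    Matrix (Fin n) (Fin n) (smoothFun (Set.Icc 0 T ×ˢ U)) :=
  Matrix.of fun k l => affine T U z₀ ((1 : Matrix (Fin n) (Fin n) ℂ) k l) fun p => Γ p k l

/-- The conjugate transpose of `frame`. -/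
def frameBar (T : ℝ) (U : Set (Cn n)) (z₀ : Cn n) (Γ : Fin n → Matrix (Fin n) (Fin n) ℂ) :
    Matrix (Fin n) (Fin n) (smoothFun (Set.Icc 0 T ×ˢ U)) :=
  Matrix.of fun k l => conjHom _ (frame T U z₀ Γ l k)

/-- The vector field with value `X` at `z₀` and components affine in `z`, parallel at `z₀` for the
connection with coefficients `Γ_{ip}^r`. -/
def adaptedField (T : ℝ) (U : Set (Cn n)) (z₀ : Cn n) (Γ : Fin n → Matrix (Fin n) (Fin n) ℂ)
    (X : Fin n → ℂ) (r : Fin n) : smoothFun (Set.Icc 0 T ×ˢ U) :=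
  affine T U z₀ (X r) fun p => ∑ i, X i * Γ i p r

/-- The value of `frame` at a point. -/
def frameAt (z₀ : Cn n) (Γ : Fin n → Matrix (Fin n) (Fin n) ℂ) (z : Cn n) :
    Matrix (Fin n) (Fin n) ℂ :=
  Matrix.of fun k l => (1 : Matrix (Fin n) (Fin n) ℂ) k l - ∑ p, Γ p k l * (z p - z₀ p)

theorem frameAt_self (z₀ : Cn n) (Γ : Fin n → Matrix (Fin n) (Fin n) ℂ) :
    frameAt z₀ Γ z₀ = 1 := by
  ext k l; simp [frameAt]

theorem continuous_frameAt (z₀ : Cn n) (Γ : Fin n → Matrix (Fin n) (Fin n) ℂ) :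
    Continuous (frameAt z₀ Γ) := by
  refine continuous_pi fun k => continuous_pi fun l => ?_
  simp only [frameAt, Matrix.of_apply]
  fun_prop

theorem ev_frame (z₀ : Cn n) (Γ : Fin n → Matrix (Fin n) (Fin n) ℂ)
    (x : (Set.Icc 0 T ×ˢ U : Set (ℝ × Cn n))) :
    (ev x).mapMatrix (frame T U z₀ Γ) = frameAt z₀ Γ x.1.2 := by
  ext k l; rfl

theorem ev_frameBar (z₀ : Cn n) (Γ : Fin n → Matrix (Fin n) (Fin n) ℂ)
    (x : (Set.Icc 0 T ×ˢ U : Set (ℝ × Cn n))) :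
    (ev x).mapMatrix (frameBar T U z₀ Γ) = (frameAt z₀ Γ x.1.2)ᴴ := by
  ext k l; rfl

theorem mder_dSpaceBar_frame (z₀ : Cn n) (Γ : Fin n → Matrix (Fin n) (Fin n) ℂ) (j : Fin n) :
    mder (dSpaceBar hT hU j) (frame T U z₀ Γ) = 0 := by
  ext1 k l; exact dSpaceBar_affine hT hU _ _ _ j

theorem mder_dSpace_frameBar (z₀ : Cn n) (Γ : Fin n → Matrix (Fin n) (Fin n) ℂ) (j : Fin n) :
    mder (dSpace hT hU j) (frameBar T U z₀ Γ) = 0 := by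
  ext1 k l
  rw [mder_apply, frameBar, Matrix.of_apply, ← conjHom_wdb, frame, Matrix.of_apply,
    dSpaceBar_affine hT hU, map_zero, Matrix.zero_apply]

theorem mder_dTime_frame (z₀ : Cn n) (Γ : Fin n → Matrix (Fin n) (Fin n) ℂ) :
    mder (dTime hT hU) (frame T U z₀ Γ) = 0 := by
  ext1 k l; exact dTime_affine hT hU _ _ _

theorem mder_dTime_frameBar (z₀ : Cn n) (Γ : Fin n → Matrix (Fin n) (Fin n) ℂ) :
    mder (dTime hT hU) (frameBar T U z₀ Γ) = 0 := by
  ext1 k l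
  rw [mder_apply, frameBar, Matrix.of_apply, ← conjHom_dTime, frame, Matrix.of_apply,
    dTime_affine, map_zero, Matrix.zero_apply]

variable {G : ℝ → Cn n → Matrix (Fin n) (Fin n) ℂ}

theorem isNormalFrame_frame (h : IsLocalFlow T U G) (x : (Set.Icc 0 T ×ˢ U : Set (ℝ × Cn n)))
    {Γ : Fin n → Matrix (Fin n) (Fin n) ℂ}
    (hΓ : ∀ p, (ev x).mapMatrix (mder (dSpace hT h.isOpen p) h.mat * h.mat⁻¹) = Γ p)
    (hΓ' : ∀ p, (ev x).mapMatrix (h.mat⁻¹ * mder (dSpaceBar hT h.isOpen p) h.mat) = (Γ p)ᴴ)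
    (hdet : IsUnit (frame T U x.1.2 Γ).det) (hdet' : IsUnit (frameBar T U x.1.2 Γ).det) :
    IsNormalFrame (dSpace hT h.isOpen) (dSpaceBar hT h.isOpen) h.mat h.mat⁻¹
      (frame T U x.1.2 Γ * h.mat * frameBar T U x.1.2 Γ)
      ((frameBar T U x.1.2 Γ)⁻¹ * h.mat⁻¹ * (frame T U x.1.2 Γ)⁻¹) (ev x) := by
  refine .of_frame (commuting_wd _ _ 0 0).d_db (fun j => ?_) (fun j => ?_)
    (Matrix.mul_nonsing_inv _ hdet) (Matrix.mul_nonsing_inv _ hdet') h.mul_inv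
    (by rw [ev_frame, frameAt_self])
    (by rw [ev_frameBar, frameAt_self, Matrix.conjTranspose_one]) (fun i => ?_) (fun i => ?_)
  · exact mder_dSpaceBar_frame hT h.isOpen _ Γ j
  · exact mder_dSpace_frameBar hT h.isOpen _ Γ j
  · rw [hΓ]
    ext k l
    rw [AlgHom.mapMatrix_apply, Matrix.map_apply, mder_apply, frame, Matrix.of_apply,
      dSpace_affine, AlgHom.commutes]
    rfl
  · rw [hΓ']
    ext k l
    rw [AlgHom.mapMatrix_apply, Matrix.map_apply, mder_apply, frameBar, Matrix.of_apply, frame,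
      Matrix.of_apply, ← conjHom_wd, dSpace_affine hT h.isOpen, ev_conjHom, AlgHom.commutes]
    simp

theorem isAdapted_adaptedField (h : IsLocalFlow T U G)
    (x : (Set.Icc 0 T ×ˢ U : Set (ℝ × Cn n))) {Γ : Fin n → Matrix (Fin n) (Fin n) ℂ}
    (hΓ : ∀ p, (ev x).mapMatrix (mder (dSpace hT h.isOpen p) h.mat * h.mat⁻¹) = Γ p)
    (hΓ' : ∀ p, (ev x).mapMatrix (h.mat⁻¹ * mder (dSpaceBar hT h.isOpen p) h.mat) = (Γ p)ᴴ)
    (X : Fin n → ℂ) :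
    IsAdapted (dSpace hT h.isOpen) (dSpaceBar hT h.isOpen) (dTime hT h.isOpen) h.mat h.mat⁻¹ (ev x)
      (adaptedField T U x.1.2 Γ X) fun r => conjHom _ (adaptedField T U x.1.2 Γ X r) := by
  have e : ∀ i, ev x (adaptedField T U x.1.2 Γ X i) = X i := fun i => by
    rw [adaptedField, ev_affine]; simp
  have hΓ₁ := fun i p r => congrFun (congrFun (hΓ i) p) r
  have hΓ₂ := fun i p r => congrFun (congrFun (hΓ' i) p) r
  simp only [AlgHom.mapMatrix_apply, Matrix.map_apply] at hΓ₁ hΓ₂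
  refine ⟨fun q r => dSpaceBar_affine hT h.isOpen _ _ _ q, fun p r => ?_,
    fun r => dTime_affine hT h.isOpen _ _ _, fun r => ?_, fun p r => ?_, fun q s => ?_⟩
  · rw [← conjHom_wdb, adaptedField, dSpaceBar_affine hT h.isOpen, map_zero]
  · rw [← conjHom_dTime hT h.isOpen, adaptedField, dTime_affine, map_zero]
  · rw [adaptedField, dSpace_affine, AlgHom.commutes]
    simp only [hΓ₁]
    exact congrArg Neg.neg (Finset.sum_congr rfl fun i _ => by rw [← e i])
  · rw [← conjHom_wd, adaptedField, dSpace_affine hT h.isOpen, ev_conjHom, AlgHom.commutes]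
    simp only [hΓ₂, ev_conjHom, e]
    simp [Matrix.conjTranspose_apply]

end Extensions

/-! ### The barrier at a maximum point -/

section LocalMaximum

open smoothFun

variable {n : ℕ}

theorem ev_heat_norm_eq_torsionTerm {A : Type*} [CommRing A] [Algebra ℂ A]
    {d db : Fin n → Derivation ℂ A A} {dt : Derivation ℂ A A}
    {G Gi : Matrix (Fin n) (Fin n) A} {ev : A →ₐ[ℂ] ℂ} {U Ub : Fin n → A} (hG : G * Gi = 1)
    (flow : mder dt G = -∑ p, ∑ q, Gi q p • curv d db G Gi p q)
    (hc : Commuting d db dt) (hU : IsAdapted d db dt G Gi ev U Ub)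
    {g : Matrix (Fin n) (Fin n) ℂ} {dG dbG : Fin n → Matrix (Fin n) (Fin n) ℂ} {u : Fin n → ℂ}
    (hg : ev.mapMatrix G = g) (hgi : ev.mapMatrix Gi = g⁻¹)
    (hd : ∀ p, ev.mapMatrix (mder (d p) G) = dG p)
    (hdb : ∀ p, ev.mapMatrix (mder (db p) G) = dbG p)
    (hu : ∀ i, ev (U i) = u i) (hub : ∀ i, ev (Ub i) = star u i) :
    ev (heat d db dt (fun p q => Gi q p) (∑ i, ∑ j, U i * Ub j * G i j)) =
      torsionTerm g dG dbG u := by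
  have hgi' : ∀ q p, ev (Gi q p) = g⁻¹ q p := fun q p => congrFun (congrFun hgi q) p
  have h1 : ∀ i p r, ev ((mder (d i) G * Gi) p r) = (dG i * g⁻¹) p r := fun i p r => by
    rw [← hd, ← hgi, ← map_mul]; rfl
  have h2 : ∀ j s q, ev ((Gi * mder (db j) G) s q) = (g⁻¹ * dbG j) s q := fun j s q => by
    rw [← hdb, ← hgi, ← map_mul]; rfl
  rw [ev_heat_norm hG flow hc hU, torsionTerm]
  simp only [hU.ev_d, hU.ev_db, h1, h2, hg, hgi, hd, hdb, hu, hub, hgi']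

/-- The matrices `(∂_p g_{k l̄})_{k l}`. -/
def dMat (G : Cn n → Matrix (Fin n) (Fin n) ℂ) (z : Cn n) (p : Fin n) : Matrix (Fin n) (Fin n) ℂ :=
  Matrix.of fun k l => dz p (fun w => G w k l) z

/-- The matrices `(∂_p̄ g_{k l̄})_{k l}`. -/
def dbarMat (G : Cn n → Matrix (Fin n) (Fin n) ℂ) (z : Cn n) (p : Fin n) :
    Matrix (Fin n) (Fin n) ℂ :=
  Matrix.of fun k l => dzbar p (fun w => G w k l) z

namespace IsLocalFlow

variable {T : ℝ} {U : Set (Cn n)} {G : ℝ → Cn n → Matrix (Fin n) (Fin n) ℂ}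

theorem ev_mder_dSpace (hT : 0 < T) (h : IsLocalFlow T U G)
    (x : (Set.Icc 0 T ×ˢ U : Set (ℝ × Cn n))) (p : Fin n) :
    (ev x).mapMatrix (mder (dSpace hT h.isOpen p) h.mat) = dMat (G x.1.1) x.1.2 p := by
  ext k l; exact h.ev_dSpace hT x p k l

theorem ev_mder_dSpaceBar (hT : 0 < T) (h : IsLocalFlow T U G)
    (x : (Set.Icc 0 T ×ˢ U : Set (ℝ × Cn n))) (p : Fin n) :
    (ev x).mapMatrix (mder (dSpaceBar hT h.isOpen p) h.mat) = dbarMat (G x.1.1) x.1.2 p := by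
  ext k l; exact h.ev_dSpaceBar hT x p k l

theorem conjHom_mder_mul_inv (hT : 0 < T) (h : IsLocalFlow T U G) (p k l : Fin n) :
    conjHom _ ((mder (dSpace hT h.isOpen p) h.mat * h.mat⁻¹) l k) =
      (h.mat⁻¹ * mder (dSpaceBar hT h.isOpen p) h.mat) k l := by
  simp only [Matrix.mul_apply, mder_apply, map_sum, map_mul, conjHom_wd, h.conjHom_mat,
    h.conjHom_mat_inv]
  exact Finset.sum_congr rfl fun a _ => mul_comm _ _

theorem hasDerivAt_half_exp (L t : ℝ) :
    HasDerivAt (fun t => Real.exp (-L * t) / 2) (-(L * (Real.exp (-L * t) / 2))) t :=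
  ((((hasDerivAt_id' t).const_mul (-L)).exp).div_const 2).congr_deriv (by ring)

theorem hasDerivAt_mul_exp (K w t : ℝ) :
    HasDerivAt (fun t => w * Real.exp (K * t)) (K * (w * Real.exp (K * t))) t :=
  ((((hasDerivAt_id' t).const_mul K).exp).const_mul w).congr_deriv (by ring)

set_option maxHeartbeats 1000000 in
/-- The maximum principle applied to the barrier: at a point where the quotient of the barrier by
`e^{Kt} (|X|² + |Z|²)|Y|²` attains its maximum `w` among all earlier times, the sum of the reaction
terms is non-negative. -/
theorem reaction_sum_nonneg_of_max (hT : 0 < T) (h : IsLocalFlow T U G) {t₀ : ℝ} (ht₀ : 0 < t₀)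
    (ht₀' : t₀ ≤ T) {z₀ : Cn n} (hz₀ : z₀ ∈ U) {B L K w s : ℝ} (hs : -1 ≤ s) (hs' : s ≤ 1)
    (X Z Y : Fin n → ℂ)
    (hmax : ∀ t, 0 ≤ t → t ≤ t₀ → ∀ z ∈ U, ∀ s, -1 ≤ s → s ≤ 1 → ∀ X Z Y,
      barrierVal (G t z) (curvMat (G t) z) B (Real.exp (-L * t) / 2) s X Z Y ≤
        w * Real.exp (K * t) * ((normSq (G t z) X + normSq (G t z) Z) * normSq (G t z) Y))
    (heq : barrierVal (G t₀ z₀) (curvMat (G t₀) z₀) B (Real.exp (-L * t₀) / 2) s X Z Y =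
        w * Real.exp (K * t₀) *
          ((normSq (G t₀ z₀) X + normSq (G t₀ z₀) Z) * normSq (G t₀ z₀) Y))
    {g : Matrix (Fin n) (Fin n) ℂ} (hg : G t₀ z₀ = g)
    {r : Fin n → Fin n → Matrix (Fin n) (Fin n) ℂ} (hr : curvMat (G t₀) z₀ = r)
    {δ w' : ℝ} (hδ : Real.exp (-L * t₀) / 2 = δ) (hw' : w * Real.exp (K * t₀) = w') :
    0 ≤ ((reaction g⁻¹ r X (star X) * g⁻¹).trace * (normSq g Y : ℂ)
          + ((-(L * δ) : ℝ) : ℂ) * ((s : ℂ) * curvVal r X X Y + curvVal r X Z Y + curvVal r Z X Y)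
          + (δ : ℂ) * ((s : ℂ) * quad (reaction g⁻¹ r X (star X)) Y (star Y)
            + quad (reaction g⁻¹ r X (star Z)) Y (star Y)
            + quad (reaction g⁻¹ r Z (star X)) Y (star Y))
          - (B : ℂ) * (torsionTerm g (dMat (G t₀) z₀) (dbarMat (G t₀) z₀) Z * (normSq g Y : ℂ))
          - ((K * w' : ℝ) : ℂ) * (((normSq g X : ℂ) + (normSq g Z : ℂ)) * (normSq g Y : ℂ))
          - (w' : ℂ) * ((torsionTerm g (dMat (G t₀) z₀) (dbarMat (G t₀) z₀) X +
              torsionTerm g (dMat (G t₀) z₀) (dbarMat (G t₀) z₀) Z) * (normSq g Y : ℂ))).re := by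
  -- shrink `U` so that the affine frame is invertible
  set Γ : Fin n → Matrix (Fin n) (Fin n) ℂ := fun p => dMat (G t₀) z₀ p * (G t₀ z₀)⁻¹ with hΓdef
  set U' : Set (Cn n) := U ∩ {z | (frameAt z₀ Γ z).det ≠ 0} with hU'def
  have hU' : IsOpen U' := h.isOpen.inter
    (isOpen_ne_fun (continuous_frameAt z₀ Γ).matrix_det continuous_const)
  have hz₀' : z₀ ∈ U' := ⟨hz₀, by
    rw [Set.mem_ofPred_eq, frameAt_self, Matrix.det_one]; exact one_ne_zero⟩
  have hsub : U' ⊆ U := Set.inter_subset_left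
  replace h := h.mono hU' hsub
  have htm : t₀ ∈ Set.Icc 0 T := ⟨ht₀.le, ht₀'⟩
  obtain ⟨x, hx1, hx2⟩ : ∃ x : (Set.Icc 0 T ×ˢ U' : Set (ℝ × Cn n)), x.1.1 = t₀ ∧ x.1.2 = z₀ :=
    ⟨⟨(t₀, z₀), htm, hz₀'⟩, rfl, rfl⟩
  have hΓ : ∀ p, (ev x).mapMatrix (mder (dSpace hT h.isOpen p) h.mat * h.mat⁻¹) = Γ p := by
    intro p
    rw [map_mul, h.ev_mder_dSpace, h.ev_mat_inv, hx1, hx2]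
  have hΓ' : ∀ p, (ev x).mapMatrix (h.mat⁻¹ * mder (dSpaceBar hT h.isOpen p) h.mat) =
      (Γ p)ᴴ := by
    intro p
    ext k l
    rw [← hΓ, AlgHom.mapMatrix_apply, Matrix.map_apply, ← h.conjHom_mder_mul_inv hT, ev_conjHom]
    rfl
  have uP : IsUnit (frame T U' x.1.2 Γ).det := isUnit_det_of_ev fun y => by
    rw [ev_frame, hx2]; exact y.2.2.2
  have uQ : IsUnit (frameBar T U' x.1.2 Γ).det := isUnit_det_of_ev fun y => by
    rw [ev_frameBar, hx2, Matrix.det_conjTranspose]; exact star_ne_zero.2 y.2.2.2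
  have hP := mder_dSpaceBar_frame hT h.isOpen x.1.2 Γ
  have hQ := mder_dSpace_frameBar hT h.isOpen x.1.2 Γ
  have hPP := Matrix.mul_nonsing_inv _ uP
  have hQQ := Matrix.mul_nonsing_inv _ uQ
  have hc := commuting_wd (.Icc_prod hT h.isOpen) (.inr ℝ ℝ (Cn n)) (1, 0) 0
  have hH := isNormalFrame_frame hT h x hΓ hΓ' uP uQ
  have flow := h.mder_dTime hT
  have flowH := mder_frame hc.d_db hP hQ hPP hQQ h.mul_inv (mder_dTime_frame hT h.isOpen x.1.2 Γ)
    (mder_dTime_frameBar hT h.isOpen x.1.2 Γ) flow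
  have hX := isAdapted_adaptedField hT h x hΓ hΓ' X
  have hZ := isAdapted_adaptedField hT h x hΓ hΓ' Z
  have hδs : ContDiff ℝ ∞ fun t => Real.exp (-L * t) / 2 := by fun_prop
  have hκs : ContDiff ℝ ∞ fun t => w * Real.exp (K * t) := by fun_prop
  have evX : ∀ X i, ev x (adaptedField T U' x.1.2 Γ X i) = X i := fun X i => by
    rw [adaptedField, ev_affine]; simp
  have evXb : ∀ X i, ev x (conjHom _ (adaptedField T U' x.1.2 Γ X i)) = star (X i) := fun X i => by
    rw [ev_conjHom, evX]; rfl
  set f := barrier (dSpace hT h.isOpen) (dSpaceBar hT h.isOpen) h.mat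
    (frame T U' x.1.2 Γ * h.mat * frameBar T U' x.1.2 Γ)
    ((frameBar T U' x.1.2 Γ)⁻¹ * h.mat⁻¹ * (frame T U' x.1.2 Γ)⁻¹)
    (adaptedField T U' x.1.2 Γ X) (fun r => conjHom _ (adaptedField T U' x.1.2 Γ X r))
    (adaptedField T U' x.1.2 Γ Z) (fun r => conjHom _ (adaptedField T U' x.1.2 Γ Z r))
    Y (star Y) s B (timeFun T U' _ hδs) (timeFun T U' _ hκs) with hf
  have hval : ∀ y : (Set.Icc 0 T ×ˢ U' : Set (ℝ × Cn n)), (ev y f).re =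
      barrierVal (G y.1.1 y.1.2) (curvMat (G y.1.1) y.1.2) B (Real.exp (-L * y.1.1) / 2) s
        (fun i => ev y (adaptedField T U' x.1.2 Γ X i))
        (fun i => ev y (adaptedField T U' x.1.2 Γ Z i)) (Y ᵥ* frameAt x.1.2 Γ y.1.2) -
      w * Real.exp (K * y.1.1) * ((normSq (G y.1.1 y.1.2)
          (fun i => ev y (adaptedField T U' x.1.2 Γ X i)) +
        normSq (G y.1.1 y.1.2) (fun i => ev y (adaptedField T U' x.1.2 Γ Z i))) *
        normSq (G y.1.1 y.1.2) (Y ᵥ* frameAt x.1.2 Γ y.1.2)) := by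
    intro y
    exact re_ev_barrier hc.d_db hP hQ hPP hQQ h.mul_inv (h.ev_mat y) (h.ev_mat_inv y)
      (ev_frame _ _ y) (ev_frameBar _ _ y) (h.ev_curv hT y) (fun i => rfl) (fun i => rfl)
      (fun i => rfl) (fun i => rfl) rfl rfl (h.normSq_eq _ _)
      (h.isCurvatureTensor hT y.2.1 y.2.2) Y s B
  have hle : ∀ y : (Set.Icc 0 T ×ˢ U' : Set (ℝ × Cn n)), y.1.1 ≤ x.1.1 → (ev y f).re ≤ 0 := by
    intro y hy
    rw [hval]
    exact sub_nonpos.2 (hmax _ y.2.1.1 (hy.trans hx1.le) _ (hsub y.2.2) s hs hs' _ _ _)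
  have h0 : (ev x f).re = 0 := by
    rw [hval, frameAt_self, Matrix.vecMul_one]
    simp only [evX]
    rw [hx1, hx2, heq, sub_self]
  have hpos : ((ev x).mapMatrix h.mat⁻¹).PosSemidef := by
    rw [h.ev_mat_inv]
    exact (h.isCurvatureTensor hT x.2.1 x.2.2).posDef.inv.posSemidef
  have key := re_ev_heat_nonneg hT h.isOpen (hx1 ▸ ht₀) hle h0 hpos
  have eG : (ev x).mapMatrix h.mat = g := by rw [h.ev_mat, hx1, hx2, hg]
  have eGi : (ev x).mapMatrix h.mat⁻¹ = g⁻¹ := by rw [h.ev_mat_inv, hx1, hx2, hg]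
  have er : ∀ i j, (ev x).mapMatrix (curv (dSpace hT h.isOpen) (dSpaceBar hT h.isOpen) h.mat
      h.mat⁻¹ i j) = r i j := fun i j => by rw [h.ev_curv hT, hx1, hx2, hr]
  have hnorm : ∀ X : Fin n → ℂ, quad g X (star X) = normSq g X := fun X => by
    rw [← hg]; exact h.normSq_eq _ _ X
  have ey : ev x (quad (frame T U' x.1.2 Γ * h.mat * frameBar T U' x.1.2 Γ) Y (star Y)) =
      (normSq g Y : ℂ) := by
    rw [ev_quad, map_mul, map_mul, ev_frame, ev_frameBar, frameAt_self, Matrix.conjTranspose_one,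
      one_mul, mul_one, eG, hnorm]
  have eN : ∀ X : Fin n → ℂ, ev x (∑ i, ∑ j, adaptedField T U' x.1.2 Γ X i *
      conjHom _ (adaptedField T U' x.1.2 Γ X j) * h.mat i j) = (normSq g X : ℂ) := by
    intro X
    rw [← hnorm, ← eG, quad]
    simp only [map_sum, map_mul, evX, evXb]
    rfl
  have eT : ∀ X : Fin n → ℂ, ev x (heat (dSpace hT h.isOpen) (dSpaceBar hT h.isOpen)
      (dTime hT h.isOpen) (fun p q => h.mat⁻¹ q p) (∑ i, ∑ j, adaptedField T U' x.1.2 Γ X i *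
      conjHom _ (adaptedField T U' x.1.2 Γ X j) * h.mat i j)) =
      torsionTerm g (dMat (G t₀) z₀) (dbarMat (G t₀) z₀) X := by
    intro X
    exact ev_heat_norm_eq_torsionTerm h.mul_inv flow hc (isAdapted_adaptedField hT h x hΓ hΓ' X)
      eG eGi (fun p => by rw [h.ev_mder_dSpace, hx1, hx2])
      (fun p => by rw [h.ev_mder_dSpaceBar, hx1, hx2]) (evX X) (evXb X)
  have hub : ∀ X i, ev x (conjHom _ (adaptedField T U' x.1.2 Γ X i)) = star X i := evXb
  rw [hf, ev_heat_barrier hc h.mul_inv hH flowH hX hZ Y (star Y) s B (dSpace_timeFun hT h.isOpen _)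
    (dSpaceBar_timeFun hT h.isOpen _) (dSpace_timeFun hT h.isOpen _)
    (dSpaceBar_timeFun hT h.isOpen _) er eGi (evX X) (hub X) (evX Z) (hub Z) ey, eN, eN, eT, eT,
    ev_dTime_timeFun hT h.isOpen, ev_dTime_timeFun hT h.isOpen, (hasDerivAt_half_exp L _).deriv,
    (hasDerivAt_mul_exp K w _).deriv] at key
  have eδ : ev x (timeFun T U' _ hδs) = (δ : ℂ) := by rw [← hδ, ← hx1]; rfl
  have eκ : ev x (timeFun T U' _ hκs) = (w' : ℂ) := by rw [← hw', ← hx1]; rfl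
  rw [eδ, eκ, hx1, hδ, hw'] at key
  exact key

end IsLocalFlow

end LocalMaximum

/-! ### Uniform bounds on compact sets -/

section Bounds

open smoothFun

variable {n : ℕ}

theorem HasBounds.mono {C C' : ℝ} {G : Matrix (Fin n) (Fin n) ℂ}
    {r : Fin n → Fin n → Matrix (Fin n) (Fin n) ℂ} {dG dbG : Fin n → Matrix (Fin n) (Fin n) ℂ}
    (h : HasBounds C G r dG dbG) (hC : C ≤ C') : HasBounds C' G r dG dbG :=
  ⟨fun k l => (h.form k l).trans hC, fun k l => (h.inv k l).trans hC,
    fun i j k l => (h.curv i j k l).trans hC, fun p k l => (h.d_form p k l).trans hC,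
    fun p k l => (h.db_form p k l).trans hC,
    fun X i => (h.coord X i).trans (mul_le_mul_of_nonneg_right hC (Real.sqrt_nonneg _))⟩

/-- The trace of the inverse bounds the coordinates of a vector in terms of its norm. -/
theorem IsCurvatureTensor.norm_coord_sq_le {G : Matrix (Fin n) (Fin n) ℂ}
    {r : Fin n → Fin n → Matrix (Fin n) (Fin n) ℂ} (h : IsCurvatureTensor G r) (X : Fin n → ℂ)
    (i : Fin n) : ‖X i‖ ^ 2 ≤ G⁻¹.trace.re * normSq G X := by
  obtain ⟨S, hS⟩ := exists_eq_conjTranspose_mul_self h.posDef.posSemidef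
  have uS : IsUnit S.det := isUnit_iff_ne_zero.2 fun h0 => h.posDef.det_pos.ne' <| by
    rw [hS, Matrix.det_mul, h0, mul_zero]
  have key := quad_le_trace_mul (Matrix.posSemidef_conjTranspose_mul_self S⁻¹) (S *ᵥ star X)
  have hsq : ∀ y : Fin n → ℂ, (star y ⬝ᵥ y).re = ∑ i, ‖y i‖ ^ 2 := by
    intro y
    rw [dotProduct, Complex.re_sum]
    refine Finset.sum_congr rfl fun i _ => ?_
    rw [Pi.star_apply, ← Complex.normSq_eq_norm_sq, Complex.star_def, mul_comm, Complex.mul_conj,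
      Complex.ofReal_re]
  have e1 : star (S *ᵥ star X) ⬝ᵥ ((S⁻¹)ᴴ * S⁻¹) *ᵥ (S *ᵥ star X) = star (star X) ⬝ᵥ star X := by
    rw [← Matrix.mulVec_mulVec, Matrix.dotProduct_mulVec, ← Matrix.star_mulVec,
      Matrix.mulVec_mulVec, Matrix.nonsing_inv_mul _ uS, Matrix.one_mulVec]
  have e2 : ((S⁻¹)ᴴ * S⁻¹).trace = G⁻¹.trace := by
    rw [hS, Matrix.mul_inv_rev, Matrix.trace_mul_comm, Matrix.conjTranspose_nonsing_inv]
  have e3 : ∑ i, ‖(S *ᵥ star X) i‖ ^ 2 = normSq G X := by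
    rw [← hsq, normSq, quad_eq_dotProduct, hS, ← Matrix.mulVec_mulVec, Matrix.dotProduct_mulVec X,
      Matrix.star_mulVec, star_star]
  rw [e1, e2, e3, hsq] at key
  refine le_trans ?_ key
  have := Finset.single_le_sum (f := fun i => ‖(star X) i‖ ^ 2) (fun i _ => sq_nonneg _)
    (Finset.mem_univ i)
  simpa using this

theorem exists_norm_ev_le {T : ℝ} {U K : Set (Cn n)} (hK : IsCompact K) (hKU : K ⊆ U) {ι : Type*}
    [Fintype ι] (f : ι → smoothFun (Set.Icc 0 T ×ˢ U)) : ∃ C : ℝ, 0 ≤ C ∧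
    ∀ i, ∀ x : (Set.Icc 0 T ×ˢ U : Set (ℝ × Cn n)), x.1.2 ∈ K → ‖ev x (f i)‖ ≤ C := by
  have h1 : ∀ i, ∃ C, ∀ q ∈ Set.Icc 0 T ×ˢ K, ‖extZero (f i).1 q‖ ≤ C := fun i =>
    (isCompact_Icc.prod hK).exists_bound_of_continuousOn
      ((contDiffOn (f i)).continuousOn.mono (Set.prod_mono le_rfl hKU))
  choose C hC using h1
  refine ⟨∑ i, |C i|, Finset.sum_nonneg fun i _ => abs_nonneg _, fun i x hx => ?_⟩
  have h2 := hC i x.1 ⟨x.2.1, hx⟩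
  rw [extZero_coe] at h2
  exact h2.trans ((le_abs_self _).trans
    (Finset.single_le_sum (f := fun i => |C i|) (fun i _ => abs_nonneg _) (Finset.mem_univ i)))

theorem IsLocalFlow.exists_hasBounds {T : ℝ} (hT : 0 < T) {U K : Set (Cn n)}
    {G : ℝ → Cn n → Matrix (Fin n) (Fin n) ℂ} (h : IsLocalFlow T U G) (hK : IsCompact K)
    (hKU : K ⊆ U) : ∃ C : ℝ, 0 ≤ C ∧ ∀ t ∈ Set.Icc 0 T, ∀ z ∈ K,
      HasBounds C (G t z) (curvMat (G t) z) (dMat (G t) z) (dbarMat (G t) z) := by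
  obtain ⟨C₁, h₁, H₁⟩ := exists_norm_ev_le hK hKU fun i : Fin n × Fin n => h.mat i.1 i.2
  obtain ⟨C₂, h₂, H₂⟩ := exists_norm_ev_le hK hKU fun i : Fin n × Fin n => h.mat⁻¹ i.1 i.2
  obtain ⟨C₃, h₃, H₃⟩ := exists_norm_ev_le hK hKU fun i : (Fin n × Fin n) × Fin n × Fin n =>
    curv (dSpace hT h.isOpen) (dSpaceBar hT h.isOpen) h.mat h.mat⁻¹ i.1.1 i.1.2 i.2.1 i.2.2
  obtain ⟨C₄, h₄, H₄⟩ := exists_norm_ev_le hK hKU fun i : Fin n × Fin n × Fin n =>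
    dSpace hT h.isOpen i.1 (h.mat i.2.1 i.2.2)
  obtain ⟨C₅, h₅, H₅⟩ := exists_norm_ev_le hK hKU fun i : Fin n × Fin n × Fin n =>
    dSpaceBar hT h.isOpen i.1 (h.mat i.2.1 i.2.2)
  have h₆ := Real.sqrt_nonneg (n * C₂)
  refine ⟨C₁ + C₂ + C₃ + C₄ + C₅ + √(n * C₂), by positivity, fun t ht z hz => ?_⟩
  set x : (Set.Icc 0 T ×ˢ U : Set (ℝ × Cn n)) := ⟨(t, z), ht, hKU hz⟩ with hx
  have hinv : ∀ k l, ‖(G t z)⁻¹ k l‖ ≤ C₂ := fun k l => by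
    have h1 := H₂ (k, l) x hz
    have h2 := congrFun (congrFun (h.ev_mat_inv x) k) l
    rw [AlgHom.mapMatrix_apply, Matrix.map_apply] at h2
    rwa [h2] at h1
  refine ⟨fun k l => ?_, fun k l => (hinv k l).trans (by linarith), fun i j k l => ?_,
    fun p k l => ?_, fun p k l => ?_, fun X i => ?_⟩
  · exact (H₁ (k, l) x hz).trans (by linarith)
  · have h1 := H₃ ((i, j), k, l) x hz
    have h2 := congrFun (congrFun (h.ev_curv hT x i j) k) l
    rw [AlgHom.mapMatrix_apply, Matrix.map_apply] at h2
    rw [h2] at h1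
    exact h1.trans (by linarith)
  · have h1 := H₄ (p, k, l) x hz
    rw [h.ev_dSpace hT] at h1
    exact h1.trans (by linarith)
  · have h1 := H₅ (p, k, l) x hz
    rw [h.ev_dSpaceBar hT] at h1
    exact h1.trans (by linarith)
  · have hc := h.isCurvatureTensor hT ht (hKU hz)
    have h1 := hc.norm_coord_sq_le X i
    have h2 : (G t z)⁻¹.trace.re ≤ n * C₂ := by
      refine (Complex.re_le_norm _).trans ?_
      rw [Matrix.trace]
      refine (norm_sum_le_of_le _ fun k _ => ?_).trans_eq
        (by rw [Finset.sum_const, Finset.card_univ, Fintype.card_fin, nsmul_eq_mul])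
      exact hinv k k
    have h3 : ‖X i‖ ≤ √(n * C₂) * √(normSq (G t z) X) := by
      rw [← Real.sqrt_mul (by positivity)]
      exact Real.le_sqrt_of_sq_le
        (h1.trans (mul_le_mul_of_nonneg_right h2 (hc.normSq_nonneg X)))
    exact h3.trans (mul_le_mul_of_nonneg_right (by linarith) (Real.sqrt_nonneg _))

/-! ### The quotient of the barrier by the norms -/

theorem normSq_smul (G : Matrix (Fin n) (Fin n) ℂ) (a : ℝ) (X : Fin n → ℂ) :
    normSq G ((a : ℂ) • X) = a ^ 2 * normSq G X := by
  rw [normSq, quad_eq_dotProduct, star_smul, Matrix.mulVec_smul, dotProduct_smul, smul_dotProduct,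
    Complex.star_def, Complex.conj_ofReal, smul_eq_mul, smul_eq_mul, ← mul_assoc,
    ← Complex.ofReal_mul, Complex.re_ofReal_mul, ← quad_eq_dotProduct, normSq, sq]

theorem contract_smul {R : Type*} [CommRing R] (r : Fin n → Fin n → Matrix (Fin n) (Fin n) R)
    (a b : R) (X Z : Fin n → R) :
    contract r (a • X) (b • Z) = (a * b) • contract r X Z := by
  simp only [contract, Finset.smul_sum, smul_smul, Pi.smul_apply, smul_eq_mul]
  refine Finset.sum_congr rfl fun i _ => Finset.sum_congr rfl fun j _ => ?_
  congr 1
  ring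

theorem curvVal_smul (r : Fin n → Fin n → Matrix (Fin n) (Fin n) ℂ) (a b : ℝ)
    (X Z Y : Fin n → ℂ) : curvVal r ((a : ℂ) • X) ((a : ℂ) • Z) ((b : ℂ) • Y) =
      ((a ^ 2 * b ^ 2 : ℝ) : ℂ) * curvVal r X Z Y := by
  rw [curvVal, curvVal, star_smul, star_smul, Complex.star_def, Complex.conj_ofReal,
    Complex.conj_ofReal, contract_smul, quad_eq_dotProduct, quad_eq_dotProduct, Matrix.mulVec_smul,
    Matrix.smul_mulVec, smul_dotProduct, dotProduct_smul, dotProduct_smul]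
  simp only [smul_eq_mul]
  push_cast
  ring

/-- The barrier is homogeneous. -/
theorem barrierVal_smul (G : Matrix (Fin n) (Fin n) ℂ)
    (r : Fin n → Fin n → Matrix (Fin n) (Fin n) ℂ) (B δ s a b : ℝ) (X Z Y : Fin n → ℂ) :
    barrierVal G r B δ s ((a : ℂ) • X) ((a : ℂ) • Z) ((b : ℂ) • Y) =
      a ^ 2 * b ^ 2 * barrierVal G r B δ s X Z Y := by
  have hric : ricVal G r ((a : ℂ) • X) = a ^ 2 * ricVal G r X := by
    rw [ricVal, ricVal, star_smul, Complex.star_def, Complex.conj_ofReal, contract_smul,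
      Matrix.smul_mul, Matrix.trace_smul, smul_eq_mul, ← Complex.ofReal_mul, Complex.re_ofReal_mul,
      sq]
  rw [barrierVal, barrierVal, hric, normSq_smul, normSq_smul, curvVal_smul, curvVal_smul,
    Complex.re_ofReal_mul, Complex.re_ofReal_mul]
  ring

/-- The points over which the maximum is taken: the time, the coordinates of a point, the number
`s`, and the vectors `X`, `Z`, `Y`. -/
abbrev BarrierPoint (n : ℕ) : Type :=
  (ℝ × Cn n) × ℝ × ((Fin n → ℂ) × (Fin n → ℂ)) × (Fin n → ℂ)

/-- The barrier divided by `e^{Kt} (|X|² + |Z|²)|Y|²`. -/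
def barrierQuot (G : ℝ → Cn n → Matrix (Fin n) (Fin n) ℂ) (B L K : ℝ) (q : BarrierPoint n) : ℝ :=
  barrierVal (G q.1.1 q.1.2) (curvMat (G q.1.1) q.1.2) B (Real.exp (-L * q.1.1) / 2) q.2.1
      q.2.2.1.1 q.2.2.1.2 q.2.2.2 /
    (Real.exp (K * q.1.1) * ((normSq (G q.1.1 q.1.2) q.2.2.1.1 +
      normSq (G q.1.1 q.1.2) q.2.2.1.2) * normSq (G q.1.1 q.1.2) q.2.2.2))

/-- The compact set over which the maximum is taken in one chart. -/
def barrierDomain (τ : ℝ) (K : Set (Cn n)) : Set (BarrierPoint n) :=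
  (Set.Icc 0 τ ×ˢ K) ×ˢ Set.Icc (-1) 1 ×ˢ Metric.sphere 0 1 ×ˢ Metric.sphere 0 1

theorem isCompact_barrierDomain (τ : ℝ) {K : Set (Cn n)} (hK : IsCompact K) :
    IsCompact (barrierDomain τ K) :=
  (isCompact_Icc.prod hK).prod (isCompact_Icc.prod ((isCompact_sphere _ _).prod
    (isCompact_sphere _ _)))

section Continuity

variable {Ω : Type*} [TopologicalSpace Ω] {D : Set Ω} {G : Ω → Matrix (Fin n) (Fin n) ℂ}
  {r : Ω → Fin n → Fin n → Matrix (Fin n) (Fin n) ℂ} {X Z Y : Ω → Fin n → ℂ}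

theorem continuousOn_quad (hG : ∀ i j, ContinuousOn (fun q => G q i j) D) (hX : ContinuousOn X D) :
    ContinuousOn (fun q => quad (G q) (X q) (star (X q))) D :=
  continuousOn_finsetSum _ fun i _ => continuousOn_finsetSum _ fun j _ =>
    ((continuousOn_pi.1 hX i).mul (continuousOn_pi.1 hX j).star).mul (hG i j)

theorem continuousOn_normSq (hG : ∀ i j, ContinuousOn (fun q => G q i j) D)
    (hX : ContinuousOn X D) : ContinuousOn (fun q => normSq (G q) (X q)) D :=
  Complex.continuous_re.comp_continuousOn (continuousOn_quad hG hX)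

theorem continuousOn_contract (hr : ∀ i j k l, ContinuousOn (fun q => r q i j k l) D)
    (hX : ContinuousOn X D) (hZ : ContinuousOn Z D) (k l : Fin n) :
    ContinuousOn (fun q => contract (r q) (X q) (star (Z q)) k l) D := by
  simp only [contract_apply]
  exact continuousOn_finsetSum _ fun i _ => continuousOn_finsetSum _ fun j _ =>
    ((continuousOn_pi.1 hX i).mul (continuousOn_pi.1 hZ j).star).mul (hr i j k l)

theorem continuousOn_re_curvVal (hr : ∀ i j k l, ContinuousOn (fun q => r q i j k l) D)
    (hX : ContinuousOn X D) (hZ : ContinuousOn Z D) (hY : ContinuousOn Y D) :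
    ContinuousOn (fun q => (curvVal (r q) (X q) (Z q) (Y q)).re) D :=
  Complex.continuous_re.comp_continuousOn
    (continuousOn_quad (continuousOn_contract hr hX hZ) hY)

theorem continuousOn_ricVal (hG : ∀ i j, ContinuousOn (fun q => (G q)⁻¹ i j) D)
    (hr : ∀ i j k l, ContinuousOn (fun q => r q i j k l) D) (hX : ContinuousOn X D) :
    ContinuousOn (fun q => ricVal (G q) (r q) (X q)) D := by
  refine Complex.continuous_re.comp_continuousOn ?_
  simp only [Matrix.trace, Matrix.diag_apply, Matrix.mul_apply]
  exact continuousOn_finsetSum _ fun i _ => continuousOn_finsetSum _ fun j _ =>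
    (continuousOn_contract hr hX hX i j).mul (hG j i)

end Continuity

theorem normSq_add_pos {G : Matrix (Fin n) (Fin n) ℂ}
    {r : Fin n → Fin n → Matrix (Fin n) (Fin n) ℂ} (h : IsCurvatureTensor G r)
    {X Z : Fin n → ℂ} (hXZ : (X, Z) ≠ 0) : 0 < normSq G X + normSq G Z := by
  by_cases hX : X = 0
  · have hZ : Z ≠ 0 := fun hZ => hXZ (by rw [hX, hZ]; rfl)
    linarith [h.normSq_nonneg X, h.pos Z hZ]
  · linarith [h.normSq_nonneg Z, h.pos X hX]

theorem IsLocalFlow.continuousOn_barrierQuot {T τ : ℝ} (hT : 0 < T) (hτ : τ ≤ T)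
    {U S : Set (Cn n)} {G : ℝ → Cn n → Matrix (Fin n) (Fin n) ℂ} (h : IsLocalFlow T U G)
    (hSU : S ⊆ U) (B L K : ℝ) : ContinuousOn (barrierQuot G B L K) (barrierDomain τ S) := by
  have hm : Set.MapsTo (fun q : BarrierPoint n => q.1) (barrierDomain τ S) (Set.Icc 0 T ×ˢ U) :=
    fun q hq => ⟨⟨hq.1.1.1, hq.1.1.2.trans hτ⟩, hSU hq.1.2⟩
  have hev : ∀ f : smoothFun (Set.Icc 0 T ×ˢ U),
      ContinuousOn (fun q : BarrierPoint n => extZero f.1 q.1) (barrierDomain τ S) := fun f =>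
    (contDiffOn f).continuousOn.comp continuousOn_fst hm
  have hG : ∀ i j, ContinuousOn (fun q : BarrierPoint n => G q.1.1 q.1.2 i j)
      (barrierDomain τ S) := fun i j => (hev (h.mat i j)).congr fun q hq =>
    (extZero_apply (x := q.1) (h.mat i j).1 (hm hq)).symm
  have hGi : ∀ i j, ContinuousOn (fun q : BarrierPoint n => (G q.1.1 q.1.2)⁻¹ i j)
      (barrierDomain τ S) := fun i j => (hev (h.mat⁻¹ i j)).congr fun q hq =>
    (congrFun (congrFun (h.ev_mat_inv ⟨q.1, hm hq⟩) i) j).symm.trans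
      (extZero_apply (x := q.1) (h.mat⁻¹ i j).1 (hm hq)).symm
  have hr : ∀ i j k l, ContinuousOn (fun q : BarrierPoint n => curvMat (G q.1.1) q.1.2 i j k l)
      (barrierDomain τ S) := fun i j k l =>
    (hev (curv (dSpace hT h.isOpen) (dSpaceBar hT h.isOpen) h.mat h.mat⁻¹ i j k l)).congr
      fun q hq => (congrFun (congrFun (h.ev_curv hT ⟨q.1, hm hq⟩ i j) k) l).symm.trans
        (extZero_apply (x := q.1) (curv (dSpace hT h.isOpen) (dSpaceBar hT h.isOpen) h.mat h.mat⁻¹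
          i j k l).1 (hm hq)).symm
  have hX : ContinuousOn (fun q : BarrierPoint n => q.2.2.1.1) (barrierDomain τ S) := by fun_prop
  have hZ : ContinuousOn (fun q : BarrierPoint n => q.2.2.1.2) (barrierDomain τ S) := by fun_prop
  have hY : ContinuousOn (fun q : BarrierPoint n => q.2.2.2) (barrierDomain τ S) := by fun_prop
  have nX := continuousOn_normSq hG hX
  have nZ := continuousOn_normSq hG hZ
  have nY := continuousOn_normSq hG hY
  have cXX := continuousOn_re_curvVal hr hX hX hY
  have cXZ := continuousOn_re_curvVal hr hX hZ hY
  have rX := continuousOn_ricVal hGi hr hX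
  refine ContinuousOn.div ?_ (by fun_prop) fun q hq => ?_
  · simp only [barrierVal]
    fun_prop
  · have hc := h.isCurvatureTensor hT (hm hq).1 (hm hq).2
    have h1 : q.2.2.1 ≠ 0 := ne_zero_of_mem_unit_sphere ⟨_, hq.2.2.1⟩
    have h2 : q.2.2.2 ≠ 0 := ne_zero_of_mem_unit_sphere ⟨_, hq.2.2.2⟩
    have h3 := normSq_add_pos hc h1
    have h4 := hc.pos _ h2
    positivity

/-- A bound for the quotient on the product of the unit spheres is a bound for the barrier on all
vectors. -/
theorem barrierVal_le_of_barrierQuot_le {T : ℝ} (hT : 0 < T) {U S : Set (Cn n)}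
    {G : ℝ → Cn n → Matrix (Fin n) (Fin n) ℂ} (h : IsLocalFlow T U G) (hSU : S ⊆ U)
    {B L K τ w : ℝ} (hτ : τ ≤ T) (hw : ∀ q ∈ barrierDomain τ S, barrierQuot G B L K q ≤ w)
    {t : ℝ} (ht : t ∈ Set.Icc 0 τ) {z : Cn n} (hz : z ∈ S) {s : ℝ} (hs : s ∈ Set.Icc (-1) 1)
    (X Z Y : Fin n → ℂ) :
    barrierVal (G t z) (curvMat (G t) z) B (Real.exp (-L * t) / 2) s X Z Y ≤
      w * Real.exp (K * t) * ((normSq (G t z) X + normSq (G t z) Z) * normSq (G t z) Y) := by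
  have hc := h.isCurvatureTensor hT ⟨ht.1, ht.2.trans hτ⟩ (hSU hz)
  have hsm := fun a b : ℝ =>
    barrierVal_smul (G t z) (curvMat (G t) z) B (Real.exp (-L * t) / 2) s a b X Z Y
  have hXZ' : ‖(X, Z)‖ = 0 → barrierVal (G t z) (curvMat (G t) z) B (Real.exp (-L * t) / 2) s X Z Y
      = 0 ∧ normSq (G t z) X + normSq (G t z) Z = 0 := by
    intro h0
    have h1 := hsm 0 1
    rw [norm_eq_zero, Prod.mk_eq_zero] at h0
    obtain ⟨rfl, rfl⟩ := h0
    have h2 := normSq_smul (G t z) 0 0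
    simp at h2
    simp only [Complex.ofReal_zero, zero_smul, Complex.ofReal_one, one_smul, ne_eq,
      OfNat.ofNat_ne_zero, not_false_eq_true, zero_pow, zero_mul] at h1
    exact ⟨h1, by rw [h2, add_zero]⟩
  have hY' : ‖Y‖ = 0 → barrierVal (G t z) (curvMat (G t) z) B (Real.exp (-L * t) / 2) s X Z Y
      = 0 ∧ normSq (G t z) Y = 0 := by
    intro h0
    have h1 := hsm 1 0
    rw [norm_eq_zero] at h0
    subst h0
    have h2 := normSq_smul (G t z) 0 0
    simp at h2
    simp only [Complex.ofReal_zero, zero_smul, Complex.ofReal_one, one_smul, ne_eq,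
      OfNat.ofNat_ne_zero, not_false_eq_true, zero_pow, zero_mul, mul_zero] at h1
    exact ⟨h1, h2⟩
  by_cases hXZ : ‖(X, Z)‖ = 0
  · rw [(hXZ' hXZ).1, (hXZ' hXZ).2]; simp
  by_cases hY : ‖Y‖ = 0
  · rw [(hY' hY).1, (hY' hY).2]; simp
  set a : ℝ := ‖(X, Z)‖⁻¹ with ha
  set b : ℝ := ‖Y‖⁻¹ with hb
  have hmem : ((t, z), s, ((a : ℂ) • X, (a : ℂ) • Z), (b : ℂ) • Y) ∈ barrierDomain τ S := by
    refine ⟨⟨ht, hz⟩, hs, ?_, ?_⟩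
    · rw [mem_sphere_zero_iff_norm, ← Prod.smul_mk, norm_smul, Complex.norm_real, ha, norm_inv,
        norm_norm, inv_mul_cancel₀ hXZ]
    · rw [mem_sphere_zero_iff_norm, norm_smul, Complex.norm_real, hb, norm_inv, norm_norm,
        inv_mul_cancel₀ hY]
  have key := hw _ hmem
  have p1 : 0 < normSq (G t z) X + normSq (G t z) Z :=
    normSq_add_pos hc fun h0 => hXZ (by rw [h0, norm_zero])
  have p2 : 0 < normSq (G t z) Y := hc.pos Y fun h0 => hY (by rw [h0, norm_zero])
  have a0 : a ≠ 0 := inv_ne_zero hXZ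
  have b0 : b ≠ 0 := inv_ne_zero hY
  have p3 : 0 < a ^ 2 * normSq (G t z) X + a ^ 2 * normSq (G t z) Z := by
    rw [← mul_add]; positivity
  rw [barrierQuot, hsm, normSq_smul, normSq_smul, normSq_smul, div_le_iff₀ (by positivity)] at key
  have hab : 0 < a ^ 2 * b ^ 2 := by positivity
  refine le_of_mul_le_mul_left (key.trans_eq ?_) hab
  ring

end Bounds

/-! ### Preservation of non-positivity on a compact manifold -/

section Global

variable {n : ℕ} {M : Type*} [TopologicalSpace M] [ChartedSpace (Cn n) M]

theorem eval₄_chernCurv (G : Cn n → Matrix (Fin n) (Fin n) ℂ) (z : Cn n) (X Y : Fin n → ℂ) :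
    eval₄ (fun i j k l => chernCurv G i j k l z) X Y = curvVal (curvMat G z) X X Y := by
  simp only [eval₄, curvVal, quad, contract_apply, Finset.mul_sum, smul_eq_mul, Pi.star_apply,
    curvMat, Matrix.of_apply]
  calc _ = ∑ i, ∑ k, ∑ j, ∑ l, chernCurv G i j k l z * X i * conj (X j) * Y k * conj (Y l) :=
        Finset.sum_congr rfl fun i _ => Finset.sum_comm
    _ = ∑ k, ∑ i, ∑ l, ∑ j, chernCurv G i j k l z * X i * conj (X j) * Y k * conj (Y l) := by
        rw [Finset.sum_comm]
        exact Finset.sum_congr rfl fun k _ => Finset.sum_congr rfl fun i _ => Finset.sum_comm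
    _ = ∑ k, ∑ l, ∑ i, ∑ j, chernCurv G i j k l z * X i * conj (X j) * Y k * conj (Y l) :=
        Finset.sum_congr rfl fun k _ => Finset.sum_comm
    _ = _ := by
        refine Finset.sum_congr rfl fun k _ => Finset.sum_congr rfl fun l _ =>
          Finset.sum_congr rfl fun i _ => Finset.sum_congr rfl fun j _ => ?_
        simp only [Complex.star_def]
        ring

theorem re_eval₂_firstRicci (G : Cn n → Matrix (Fin n) (Fin n) ℂ) (z : Cn n) (X : Fin n → ℂ) :
    (eval₂ (fun i j => firstRicci G i j z) X).re = ricVal (G z) (curvMat G z) X := by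
  rw [ricVal]
  congr 1
  simp only [eval₂, firstRicci, Matrix.trace, Matrix.diag_apply, Matrix.mul_apply, contract_apply,
    Finset.sum_mul, Pi.star_apply, curvMat, Matrix.of_apply, gInv]
  calc _ = ∑ i, ∑ k, ∑ j, ∑ l, (G z)⁻¹ l k * chernCurv G i j k l z * X i * conj (X j) :=
        Finset.sum_congr rfl fun i _ => Finset.sum_comm
    _ = ∑ k, ∑ i, ∑ l, ∑ j, (G z)⁻¹ l k * chernCurv G i j k l z * X i * conj (X j) := by
        rw [Finset.sum_comm]
        exact Finset.sum_congr rfl fun k _ => Finset.sum_congr rfl fun i _ => Finset.sum_comm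
    _ = ∑ k, ∑ l, ∑ i, ∑ j, (G z)⁻¹ l k * chernCurv G i j k l z * X i * conj (X j) :=
        Finset.sum_congr rfl fun k _ => Finset.sum_comm
    _ = _ := by
        refine Finset.sum_congr rfl fun k _ => Finset.sum_congr rfl fun l _ =>
          Finset.sum_congr rfl fun i _ => Finset.sum_congr rfl fun j _ => ?_
        simp only [Complex.star_def]
        ring

theorem quad_mul_quad (A A' : Matrix (Fin n) (Fin n) ℂ) (X X' Y Y' : Fin n → ℂ) :
    quad A X X' * quad A' Y Y' =
      ∑ i, ∑ j, ∑ k, ∑ l, A i j * A' k l * X i * X' j * Y k * Y' l := by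
  rw [quad, quad, Finset.sum_mul]
  refine Finset.sum_congr rfl fun i _ => ?_
  rw [Finset.sum_mul]
  refine Finset.sum_congr rfl fun j _ => ?_
  rw [Finset.mul_sum]
  refine Finset.sum_congr rfl fun k _ => ?_
  rw [Finset.mul_sum]
  refine Finset.sum_congr rfl fun l _ => ?_
  simp only [smul_eq_mul]
  ring

theorem sum_sum_sum_reverse (f : Fin n → Fin n → Fin n → ℂ) :
    ∑ l, ∑ k, ∑ j, f l k j = ∑ j, ∑ k, ∑ l, f l k j :=
  calc _ = ∑ l, ∑ j, ∑ k, f l k j := Finset.sum_congr rfl fun _ _ => Finset.sum_comm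
    _ = ∑ j, ∑ l, ∑ k, f l k j := Finset.sum_comm
    _ = _ := Finset.sum_congr rfl fun _ _ => Finset.sum_comm

theorem eval₄_tensorB (G : Cn n → Matrix (Fin n) (Fin n) ℂ) (z : Cn n) (X Y : Fin n → ℂ) :
    eval₄ (fun i j k l => tensorB G i j k l z) X Y =
      quad (G z) X (star X) * quad (G z) Y (star Y) +
        quad (G z) X (star Y) * quad (G z) Y (star X) := by
  rw [quad_mul_quad, quad_mul_quad, eval₄, ← Finset.sum_add_distrib]
  refine Finset.sum_congr rfl fun i _ => ?_
  rw [sum_sum_sum_reverse fun l k j => G z i l * G z k j * X i * star Y l * Y k * star X j,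
    ← Finset.sum_add_distrib]
  refine Finset.sum_congr rfl fun j _ => ?_
  rw [← Finset.sum_add_distrib]
  refine Finset.sum_congr rfl fun k _ => ?_
  rw [← Finset.sum_add_distrib]
  refine Finset.sum_congr rfl fun l _ => ?_
  simp only [tensorB, Pi.star_apply, starRingEnd_apply]
  ring

variable [IsManifold 𝓘(ℂ, Cn n) ω M]

theorem HermitianMetric.GriffithsNonpos.re_curvVal_nonpos {g : HermitianMetric n M}
    (hg : g.GriffithsNonpos) {e : OpenPartialHomeomorph M (Cn n)} (he : e ∈ holoCharts n M)
    {z : Cn n} (hz : z ∈ e.target) (X Y : Fin n → ℂ) :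
    (curvVal (curvMat (g.comp e) z) X X Y).re ≤ 0 := by
  obtain ⟨κ, hκ, hle⟩ := hg
  have h1 := hle e he z hz X Y
  rw [eval₄_chernCurv] at h1
  refine h1.trans (mul_nonpos_of_nonpos_of_nonneg (hκ _) ?_)
  have hherm : (g.comp e z)ᴴ = g.comp e z := by ext i j; exact g.conj_comp e z j i
  have hstar : ∀ X Y : Fin n → ℂ, quad (g.comp e z) Y (star X) =
      conj (quad (g.comp e z) X (star Y)) := fun X Y => by
    rw [← Complex.star_def, star_quad, hherm]
  have hreal : ∀ X : Fin n → ℂ, quad (g.comp e z) X (star X) =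
      ((quad (g.comp e z) X (star X)).re : ℂ) := fun X =>
    (Complex.conj_eq_iff_re.1 (hstar X X).symm).symm
  have hnn : ∀ X : Fin n → ℂ, 0 ≤ (quad (g.comp e z) X (star X)).re := fun X => by
    by_cases hX : X = 0
    · simp [hX, quad]
    · exact (g.quad_comp_pos he hz hX).le
  rw [eval₄_tensorB, hstar X Y, Complex.mul_conj, hreal X, hreal Y, ← Complex.ofReal_mul,
    ← Complex.ofReal_add, Complex.ofReal_re]
  exact add_nonneg (mul_nonneg (hnn X) (hnn Y)) (Complex.normSq_nonneg _)

/-- The barrier is independent of the holomorphic chart. -/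
theorem barrierVal_comp_eq (g : HermitianMetric n M) {e e' : OpenPartialHomeomorph M (Cn n)}
    (he : e ∈ holoCharts n M) (he' : e' ∈ holoCharts n M) {z : Cn n} (hz : z ∈ overlap e e')
    (B δ s : ℝ) (X Z Y : Fin n → ℂ) :
    barrierVal (g.comp e z) (curvMat (g.comp e) z) B δ s X Z Y =
      barrierVal (g.comp e' (e' (e.symm z))) (curvMat (g.comp e') (e' (e.symm z))) B δ s
        (X ᵥ* jacobian e e' z) (Z ᵥ* jacobian e e' z) (Y ᵥ* jacobian e e' z) :=
  barrierVal_congr (g.comp_eq_jacobian he he' hz) (g.det_comp_ne_zero he hz.1)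
    (fun i j => g.chernCurv_eq_jacobian he he' hz i j) B δ s X Z Y

/-- A compact manifold is covered by finitely many compact sets contained in charts. -/
theorem exists_compact_pieces (n : ℕ) (M : Type*) [TopologicalSpace M] [ChartedSpace (Cn n) M]
    [CompactSpace M] : ∃ (S : Finset M) (P : M → Set (Cn n)), (∀ p, IsCompact (P p)) ∧
      (∀ p, P p ⊆ (chartAt (Cn n) p).target) ∧ (∀ p, (P p).Nonempty) ∧
      ∀ q, ∃ p ∈ S, q ∈ (chartAt (Cn n) p).source ∧ chartAt (Cn n) p q ∈ P p := by
  have h1 : ∀ p : M, ∃ ε > 0, Metric.closedBall (chartAt (Cn n) p p) ε ⊆ (chartAt (Cn n) p).target :=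
    fun p => Metric.nhds_basis_closedBall.mem_iff.1
      ((chartAt (Cn n) p).open_target.mem_nhds (mem_chart_target (Cn n) p))
  choose ε hε hsub using h1
  obtain ⟨S, hS⟩ := CompactSpace.elim_nhds_subcover
    (fun p : M => (chartAt (Cn n) p).source ∩
      chartAt (Cn n) p ⁻¹' Metric.closedBall (chartAt (Cn n) p p) (ε p)) fun p =>
    Filter.inter_mem ((chartAt (Cn n) p).open_source.mem_nhds (mem_chart_source (Cn n) p))
      (((chartAt (Cn n) p).continuousAt (mem_chart_source (Cn n) p)).preimage_mem_nhds
        (Metric.closedBall_mem_nhds _ (hε p)))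
  refine ⟨S, fun p => Metric.closedBall (chartAt (Cn n) p p) (ε p),
    fun p => isCompact_closedBall _ _, hsub, fun p => ⟨_, Metric.mem_closedBall_self (hε p).le⟩,
    fun q => ?_⟩
  have hq : q ∈ (⊤ : Set M) := trivial
  rw [← hS] at hq
  simp only [Set.mem_iUnion] at hq
  obtain ⟨p, hp, h1, h2⟩ := hq
  exact ⟨p, hp, h1, h2⟩

/-- The barrier remains non-positive for a short time. Otherwise its quotient by
`e^{Kt} (|X|² + |Z|²)|Y|²` has a positive maximum, at a positive time since the initial curvature is
non-positive, and at this maximum the sum of the reaction terms is both negative and non-negative. -/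
theorem exists_barrierVal_nonpos [CompactSpace M] {g : ℝ → HermitianMetric n M} {T : ℝ}
    (hT : 0 < T) (hg : IsHermitianCurvatureFlow g T) (h0 : (g 0).GriffithsNonpos) :
    ∃ τ B L : ℝ, 0 < τ ∧ τ ≤ T ∧ ∀ t ∈ Set.Icc 0 τ, ∀ e ∈ holoCharts n M, ∀ z ∈ e.target,
      ∀ s ∈ Set.Icc (-1 : ℝ) 1, ∀ X Z Y : Fin n → ℂ,
        barrierVal ((g t).comp e z) (curvMat ((g t).comp e) z) B (Real.exp (-L * t) / 2) s X Z Y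
          ≤ 0 := by
  obtain ⟨S, P, hPc, hPt, hPn, hP⟩ := exists_compact_pieces n M
  have hch : ∀ p : M, chartAt (Cn n) p ∈ holoCharts n M := fun p =>
    IsManifold.chart_mem_maximalAtlas p
  have hloc : ∀ p : M, IsLocalFlow T (chartAt (Cn n) p).target
      fun t => (g t).comp (chartAt (Cn n) p) := fun p => hg.isLocalFlow (hch p)
  -- bounds that are uniform over all pieces
  obtain ⟨C, hC0, hC⟩ : ∃ C : ℝ, 0 ≤ C ∧ ∀ p ∈ S, ∀ t ∈ Set.Icc 0 T, ∀ z ∈ P p,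
      HasBounds C ((g t).comp (chartAt (Cn n) p) z) (curvMat ((g t).comp (chartAt (Cn n) p)) z)
        (dMat ((g t).comp (chartAt (Cn n) p)) z) (dbarMat ((g t).comp (chartAt (Cn n) p)) z) := by
    choose C hC0 hC using fun p => (hloc p).exists_hasBounds hT (hPc p) (hPt p)
    exact ⟨∑ p ∈ S, C p, Finset.sum_nonneg fun p _ => hC0 p, fun p hp t ht z hz =>
      (hC p t ht z hz).mono (Finset.single_le_sum (fun p _ => hC0 p) hp)⟩
  obtain ⟨B, L, K, hB, hL, hBLK⟩ := exists_barrier_constants n hC0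
  -- up to the time `log 2 / (L + 1)` the coefficient `e^{-Lt} / 2` lies between `1/4` and `1/2`
  set τ : ℝ := min T (Real.log 2 / (L + 1)) with hτ
  have hlog : 0 < Real.log 2 := Real.log_pos (by norm_num)
  have hτ0 : 0 < τ := lt_min hT (by positivity)
  have hτT : τ ≤ T := min_le_left _ _
  have hδ : ∀ t ∈ Set.Icc 0 τ, 1 / 4 ≤ Real.exp (-L * t) / 2 ∧ Real.exp (-L * t) / 2 ≤ 1 / 2 := by
    intro t ht
    have h1 : L * t ≤ Real.log 2 := by
      have h2 : t ≤ Real.log 2 / (L + 1) := ht.2.trans (min_le_right _ _)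
      rw [le_div_iff₀ (by positivity)] at h2
      nlinarith [ht.1]
    have h3 : Real.exp (-L * t) ≤ 1 := by
      rw [Real.exp_le_one_iff]
      nlinarith [mul_nonneg hL ht.1]
    have h4 : (1 : ℝ) / 2 ≤ Real.exp (-L * t) := by
      have : Real.exp (-Real.log 2) = 1 / 2 := by
        rw [Real.exp_neg, Real.exp_log (by norm_num)]; norm_num
      rw [← this]
      exact Real.exp_le_exp.2 (by linarith)
    constructor <;> linarith
  refine ⟨τ, B, L, hτ0, hτT, fun t ht e he z hz s hs X Z Y => ?_⟩
  by_contra! hpos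
  -- the maximum of the quotient over all pieces
  have hcpt : ∀ p, IsCompact (barrierDomain τ (P p)) := fun p => isCompact_barrierDomain τ (hPc p)
  have hcont : ∀ p, ContinuousOn (barrierQuot (fun t => (g t).comp (chartAt (Cn n) p)) B L K)
      (barrierDomain τ (P p)) := fun p => (hloc p).continuousOn_barrierQuot hT hτT (hPt p) B L K
  have hn : n ≠ 0 := by
    rintro rfl
    have : Y = 0 := Subsingleton.elim _ _
    rw [this] at hpos
    simp [barrierVal, normSq, curvVal, quad] at hpos
  have hne : ∀ p, (barrierDomain τ (P p)).Nonempty := by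
    intro p
    have : Nonempty (Fin n) := ⟨⟨0, Nat.pos_of_ne_zero hn⟩⟩
    obtain ⟨x, hx⟩ := hPn p
    obtain ⟨y, hy⟩ := NormedSpace.sphere_nonempty (E := Fin n → ℂ) (x := 0) (r := 1) |>.2 zero_le_one
    obtain ⟨y', hy'⟩ :=
      NormedSpace.sphere_nonempty (E := (Fin n → ℂ) × (Fin n → ℂ)) (x := 0) (r := 1) |>.2 zero_le_one
    exact ⟨((0, x), 0, y', y), ⟨⟨⟨le_rfl, hτ0.le⟩, hx⟩, by norm_num, hy', hy⟩⟩
  choose q hq hqmax using fun p => (hcpt p).exists_isMaxOn (hne p) (hcont p)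
  have hSne : S.Nonempty := by
    obtain ⟨p, hp, -⟩ := hP (e.symm z)
    exact ⟨p, hp⟩
  obtain ⟨p, hp, hpmax⟩ := S.exists_max_image
    (fun p => barrierQuot (fun t => (g t).comp (chartAt (Cn n) p)) B L K (q p)) hSne
  obtain ⟨w, hw⟩ : ∃ w, w = barrierQuot (fun t => (g t).comp (chartAt (Cn n) p)) B L K (q p) :=
    ⟨_, rfl⟩
  -- the maximum bounds the barrier in every chart
  have hglob : ∀ t ∈ Set.Icc 0 τ, ∀ e ∈ holoCharts n M, ∀ z ∈ e.target,
      ∀ s ∈ Set.Icc (-1 : ℝ) 1, ∀ X Z Y : Fin n → ℂ,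
        barrierVal ((g t).comp e z) (curvMat ((g t).comp e) z) B (Real.exp (-L * t) / 2) s X Z Y
          ≤ w * Real.exp (K * t) *
            ((normSq ((g t).comp e z) X + normSq ((g t).comp e z) Z) *
              normSq ((g t).comp e z) Y) := by
    intro t ht e he z hz s hs X Z Y
    obtain ⟨p', hp', h1, h2⟩ := hP (e.symm z)
    have hov : z ∈ overlap e (chartAt (Cn n) p') := ⟨hz, h1⟩
    have hJ := (g t).comp_eq_jacobian he (hch p') hov
    rw [barrierVal_comp_eq (g t) he (hch p') hov, normSq_congr hJ, normSq_congr hJ,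
      normSq_congr hJ]
    exact barrierVal_le_of_barrierQuot_le hT (hloc p') (hPt p') hτT
      (fun q' hq' => (hqmax p' hq').trans ((hpmax p' hp').trans_eq hw.symm)) ht h2 hs _ _ _
  have hw0 : 0 < w := by
    by_contra! hw0
    refine absurd (hglob t ht e he z hz s hs X Z Y) (not_le.2 (lt_of_le_of_lt ?_ hpos))
    have hnn : ∀ X : Fin n → ℂ, 0 ≤ normSq ((g t).comp e z) X :=
      ((hg.isLocalFlow he).isCurvatureTensor hT ⟨ht.1, ht.2.trans hτT⟩ hz).normSq_nonneg
    exact mul_nonpos_of_nonpos_of_nonneg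
      (mul_nonpos_of_nonpos_of_nonneg hw0 (Real.exp_pos _).le)
      (mul_nonneg (add_nonneg (hnn _) (hnn _)) (hnn _))
  -- the equality at the maximum point
  clear hpos
  have hqp := hq p
  generalize q p = q₀ at hqp hw
  obtain ⟨⟨t₀, z₀⟩, s₀, ⟨X₀, Z₀⟩, Y₀⟩ := q₀
  obtain ⟨⟨ht₀, hz₀⟩, hs₀, hXZ₀, hY₀⟩ := hqp
  have hz₀' : z₀ ∈ (chartAt (Cn n) p).target := hPt p hz₀
  have ht₀T : t₀ ∈ Set.Icc 0 T := ⟨ht₀.1, ht₀.2.trans hτT⟩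
  have hct := (hloc p).isCurvatureTensor hT ht₀T hz₀'
  have hXZ : 0 < normSq ((g t₀).comp (chartAt (Cn n) p) z₀) X₀ +
      normSq ((g t₀).comp (chartAt (Cn n) p) z₀) Z₀ :=
    normSq_add_pos hct (ne_zero_of_mem_unit_sphere ⟨_, hXZ₀⟩)
  have hY0 : Y₀ ≠ 0 := ne_zero_of_mem_unit_sphere ⟨_, hY₀⟩
  have hYpos := hct.pos Y₀ hY0
  have heq : barrierVal ((g t₀).comp (chartAt (Cn n) p) z₀)
      (curvMat ((g t₀).comp (chartAt (Cn n) p)) z₀) B (Real.exp (-L * t₀) / 2) s₀ X₀ Z₀ Y₀ =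
      w * Real.exp (K * t₀) * ((normSq ((g t₀).comp (chartAt (Cn n) p) z₀) X₀ +
        normSq ((g t₀).comp (chartAt (Cn n) p) z₀) Z₀) *
          normSq ((g t₀).comp (chartAt (Cn n) p) z₀) Y₀) := by
    rw [hw, barrierQuot, mul_assoc, div_mul_cancel₀]
    positivity
  have hbd := hC p hp t₀ ht₀T z₀ hz₀
  obtain ⟨hδ1, hδ2⟩ := hδ t₀ ht₀
  obtain ⟨hinit, hreact⟩ := hBLK hct hbd X₀ Z₀ Y₀
  have hw' : 0 < w * Real.exp (K * t₀) := mul_pos hw0 (Real.exp_pos _)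
  rcases ht₀.1.eq_or_lt with h | ht₀pos
  · -- at the initial time the barrier is non-positive
    have hle := barrierVal_nonpos hct (fun X Y => by
      rw [← show (0 : ℝ) = t₀ from h]; exact h0.re_curvVal_nonpos (hch p) hz₀' X Y) (by linarith) hδ2 hs₀.1
      (hinit _ (by linarith) (by linarith)) (s := s₀) (X := X₀)
    rw [heq] at hle
    exact absurd hle (not_le.2 (by positivity))
  · have hneg := hreact s₀ _ _ hY0 hXZ hs₀.1 hs₀.2 hδ1 hδ2 hw'
      (fun s hs hs' Z Y => hglob t₀ ht₀ _ (hch p) z₀ hz₀' s ⟨hs, hs'⟩ X₀ Z Y) heq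
    have hnonneg := (hloc p).reaction_sum_nonneg_of_max hT ht₀pos ht₀T.2 hz₀' hs₀.1 hs₀.2 X₀ Z₀ Y₀
      (fun t ht ht' z hz s hs hs' X Z Y =>
        hglob t ⟨ht, ht'.trans ht₀.2⟩ _ (hch p) z hz s ⟨hs, hs'⟩ X Z Y) heq rfl rfl rfl rfl
    exact absurd hnonneg (not_le.2 hneg)

end Global

end HermitianGeometry

end

theorem theorem1p1 {n : ℕ} {M : Type*} [TopologicalSpace M] [T2Space M] [CompactSpace M]
    [ChartedSpace (HermitianGeometry.Cn n) M]
    [IsManifold 𝓘(ℂ, HermitianGeometry.Cn n) ω M]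
    (g₀ : HermitianGeometry.HermitianMetric n M) (hg₀ : g₀.GriffithsNonpos)
    (T : ℝ) (hT : 0 < T) (g : ℝ → HermitianGeometry.HermitianMetric n M)
    (hg : HermitianGeometry.IsHermitianCurvatureFlow g T) (hinit : g 0 = g₀) :
    ∃ τ : ℝ, 0 < τ ∧ τ ≤ T ∧ ∀ t ∈ Set.Icc 0 τ, (g t).FirstRicciNonpos := by
  subst hinit
  obtain ⟨τ, B, L, hτ, hτT, hle⟩ := HermitianGeometry.exists_barrierVal_nonpos hT hg hg₀
  refine ⟨τ, hτ, hτT, fun t ht e he z hz X => ?_⟩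
  rw [HermitianGeometry.re_eval₂_firstRicci]
  by_cases hX : X = 0
  · simp [hX, HermitianGeometry.ricVal, HermitianGeometry.contract]
  -- for `s = 0`, `Z = 0` and `Y = X` only the Ricci term of the barrier remains
  have h := hle t ht e he z hz 0 (by norm_num) X 0 X
  have hpos : 0 < HermitianGeometry.normSq ((g t).comp e z) X := (g t).quad_comp_pos he hz hX
  have h0 : HermitianGeometry.normSq ((g t).comp e z) 0 = 0 := by
    simp [HermitianGeometry.normSq, HermitianGeometry.quad]
  have h1 : HermitianGeometry.curvVal
      (HermitianGeometry.curvMat ((g t).comp e) z) X 0 X = 0 := by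
    simp [HermitianGeometry.curvVal, HermitianGeometry.quad, HermitianGeometry.contract]
  simp only [HermitianGeometry.barrierVal, h0, h1] at h
  by_contra! hr
  have := mul_pos hr hpos
  simp at h
  linarith
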